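/- **Conventions.** $\lambda$ is the security parameter. A QPT algorithm is a polynomial-time uniform family of quantum circuits (over $\{H,T,\mathrm{CNOT}\}$, with ancillas in state $|0\rangle$, measurement of classical outputs and tracing out of the unused qubits); lengths of strings and registers are polynomial-time computable functions of $\lambda$. All algorithms of the schemes below are QPT. A *secret key single-decryptor encryption (SDE) scheme* with plaintext space $\mathcal M$ consists of algorithms $\mathcal{KG}(1^\lambda)\to(\mathsf{ek},dk)$ with a classical encryption key $\mathsf{ek}$ and a quantum decryption key $dk$, $\mathsf{Enc}(\mathsf{ek},m)\to\mathsf{ct}\in\{0,1\}^{\ell}$ with $\ell=\ell(\lambda)$, and $\mathcal{D}ec(dk,\mathsf{ct})\to m'\in\mathcal M\cup\{\bot\}$, such that an honest ciphertext of any $m\in\mathcal M$ is decrypted to $m$ with probability at least $1-\mathrm{negl}(\lambda)$. A *secret key unclonable encryption (SKUE) scheme* consists of algorithms $\mathsf{KG}(1^\lambda)\to\mathsf{uk}$ with a classical key $\mathsf{uk}$, $\mathcal{E}nc(\mathsf{uk},m)\to ct$ with a quantum ciphertext $ct$, and $\mathcal{D}ec(\mathsf{uk},ct)\to m'\in\mathcal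 M\cup\{\bot\}$, with the same correctness requirement. *One-out-of-many one-time anti-piracy* of an SDE scheme. In the game with an adversary $(A_0,A_1,\dots,A_n)$, the challenger generates $(\mathsf{ek},dk)\leftarrow\mathcal{KG}(1^\lambda)$ and sends $dk$ to $A_0$, who sends $m_0,m_1\in\mathcal M$ to the challenger and creates a joint state over $n$ registers $R_1,\dots,R_n$, of which $R_i$ goes to $A_i$. Each $A_i$ outputs a quantum decryptor $D_i$, that is, a quantum state together with an efficient classical description of unitaries $U_{i,\mathsf{ct}}$; on input $\mathsf{ct}$ one applies $U_{i,\mathsf{ct}}$ to the state and measures one output qubit. The challenger draws $\alpha\leftarrow\{1,\dots,n\}$ and $\mathsf{coin}\leftarrow\{0,1\}$ uniformly and $\mathsf{ct}\leftarrow\mathsf{Enc}(\mathsf{ek},m_{\mathsf{coin}})$ and runs $D_\alpha$ on $\mathsf{ct}$; the adversary wins if the result is $\mathsf{coin}$. The scheme is secure if for every polynomially bounded function $n=n(\lambda)$ for which $1^\lambda\mapsto 1^{n(\lambda)}$ is polynomial-time computable and every QPT adversary $(A_0,\dots,A_n)$ the winning probability is at most $\frac12+\frac1{2n}+\mathrm{negl}(\lambda)$.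 *One-out-of-many one-time unclonable-indistinguishability* of an SKUE scheme. In the game, $A_0$ sends $m_0,m_1\in\mathcal M$; the challenger draws $\mathsf{coin}\leftarrow\{0,1\}$ uniformly, generates $\mathsf{uk}\leftarrow\mathsf{KG}(1^\lambda)$ and gives $ct\leftarrow\mathcal{E}nc(\mathsf{uk},m_{\mathsf{coin}})$ to $A_0$, who creates a joint state over $n$ registers $R_1,\dots,R_n$, of which $R_i$ goes to $A_i$. The challenger draws $\alpha\leftarrow\{1,\dots,n\}$ uniformly and gives $\mathsf{uk}$ to $A_\alpha$ only; the adversary wins if $A_\alpha$ outputs $\mathsf{coin}$. The scheme is secure if the winning probability is at most $\frac12+\frac1{2n}+\mathrm{negl}(\lambda)$ for all $n$ and all adversaries as above. **Transformation.** Given an SDE scheme $\mathsf{SDE}$ with ciphertexts in $\{0,1\}^\ell$, let $\mathsf{UE}$ be as follows. $\mathsf{UE.KG}$: output a uniform $\mathsf{uk}\in\{0,1\}^\ell$. $\mathsf{UE}.\mathcal{E}nc(\mathsf{uk},m)$: generate $(\mathsf{ek},dk)\leftarrow\mathsf{SDE}.\mathcal{KG}(1^\lambda)$ and $\mathsf{ct}\leftarrow\mathsf{SDE.Enc}(\mathsf{ek},m)$,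 and output $(\mathsf{ct}\oplus\mathsf{uk},dk)$. $\mathsf{UE}.\mathcal{D}ec(\mathsf{uk},(c,dk))$: output $\mathsf{SDE}.\mathcal{D}ec(dk,c\oplus\mathsf{uk})$. **Theorem.** If $\mathsf{SDE}$ is a secret key SDE scheme that is one-out-of-many one-time anti-piracy secure, then $\mathsf{UE}$ is an SKUE scheme (with QPT algorithms and decryption correctness) that is one-out-of-many one-time unclonable-indistinguishable secure. -/

import Mathlib

open scoped BigOperators

namespace OneOutOfMany

/-! ## Quantum circuits over the universal gate set H, T, CNOT -/

/-- A qubit wire, addressed by (port, block, position). There are infinitely many wires; all wires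
that carry no input start in the state `|0⟩`. -/
abbrev Wire := ℕ × ℕ × ℕ

inductive Gate where
  | H (w : Wire)
  | T (w : Wire)
  | CNOT (c t : Wire)

/-- Classical assignments of bits to the wires: the labels of the computational basis. -/
abbrev Config := Wire → Bool

/-- Pure states (unnormalized): finite linear combinations of computational basis states. -/
abbrev PureState := Config →₀ ℂ

/-- The image of a computational basis state under a gate (a `CNOT` whose control is its target is
the identity). -/
noncomputable def Gate.onBasis : Gate → Config → PureState
  | .H w, x =>
      Finsupp.single (Function.update x w false) ((1 / Real.sqrt 2 : ℝ) : ℂ) +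
      Finsupp.single (Function.update x w true)
        (if x w then -((1 / Real.sqrt 2 : ℝ) : ℂ) else ((1 / Real.sqrt 2 : ℝ) : ℂ))
  | .T w, x => Finsupp.single x (if x w then Complex.exp (Real.pi / 4 * Complex.I) else 1)
  | .CNOT c t, x =>
      Finsupp.single (if c = t then x else Function.update x t (xor (x c) (x t))) 1

/-- The unitary of a gate. -/
noncomputable def Gate.unitary (g : Gate) : PureState →ₗ[ℂ] PureState :=
  Finsupp.linearCombination ℂ g.onBasis

/-- The unitary of a circuit; the gate at the head of the list is applied first. -/
noncomputable def circuitUnitary : List Gate → PureState →ₗ[ℂ] PureState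
  | [] => LinearMap.id
  | g :: C => (circuitUnitary C).comp g.unitary

/-! ## Registers and (unnormalized) density matrices -/

/-- Operators on the system of the qubits labelled by `α`. -/
abbrev Op (α : Type) := Matrix (α → Bool) (α → Bool) ℂ

/-- Bit strings of length `n`. -/
abbrev Bits (n : ℕ) := Fin n → Bool

/-- The wires on which the qubits labelled by `α` are placed. -/
class Register (α : Type) where
  wire : α → Wire
  wire_injective : Function.Injective wire

instance instRegisterFin (n : ℕ) : Register (Fin n) where
  wire j := (0, 0, j)
  wire_injective a b h := by
    simpa [Fin.ext_iff] using h

instance instRegisterBlocks (n m : ℕ) : Register (Fin n × Fin m) where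
  wire q := (0, q.1, q.2)
  wire_injective a b h := by
    simpa [Prod.ext_iff, Fin.ext_iff] using h

instance instRegisterSum (α β : Type) [Register α] [Register β] : Register (α ⊕ β) where
  wire
    | .inl a => (2 * (Register.wire a).1, (Register.wire a).2)
    | .inr b => (2 * (Register.wire b).1 + 1, (Register.wire b).2)
  wire_injective := by
    rintro (a | a) (b | b) h
    · simp only [Prod.mk.injEq] at h
      exact congrArg _ (Register.wire_injective (Prod.ext (by omega) h.2))
    · simp only [Prod.mk.injEq] at h
      omega
    · simp only [Prod.mk.injEq] at h
      omega
    · simp only [Prod.mk.injEq] at h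
      exact congrArg _ (Register.wire_injective (Prod.ext (by omega) h.2))

/-- The trace of an unnormalized state: the probability of the branch that it describes. -/
noncomputable def pr {α : Type} [Fintype α] [DecidableEq α] (ρ : Op α) : ℝ := (Matrix.trace ρ).re

/-- The computational basis state `|x⟩⟨x|`. -/
def basisState {α : Type} [Fintype α] [DecidableEq α] (x : α → Bool) : Op α := Matrix.single x x 1

/-- The product state `ρ ⊗ σ`. -/
def tensor {α β : Type} (ρ : Op α) (σ : Op β) : Op (α ⊕ β) :=
  Matrix.of fun x y => ρ (x ∘ Sum.inl) (y ∘ Sum.inl) * σ (x ∘ Sum.inr) (y ∘ Sum.inr)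

/-- The unnormalized state of `β` after a measurement of `α` with outcome `x`. -/
def afterOutcome {α β : Type} (ρ : Op (α ⊕ β)) (x : α → Bool) : Op β :=
  Matrix.of fun y z => ρ (Sum.elim x y) (Sum.elim x z)

/-- View a pair of registers as one register, and conversely. -/
def join {a b : ℕ} (ρ : Op (Fin a ⊕ Fin b)) : Op (Fin (a + b)) :=
  ρ.submatrix (fun z => z ∘ finSumFinEquiv) (fun z => z ∘ finSumFinEquiv)

def unjoin {a b : ℕ} (ρ : Op (Fin (a + b))) : Op (Fin a ⊕ Fin b) :=
  ρ.submatrix (fun z => z ∘ finSumFinEquiv.symm) (fun z => z ∘ finSumFinEquiv.symm)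

/-- The reduced state `ρ[R_i]` of a state over the registers `R_0, …, R_{n-1}` of `r` qubits:
the partial trace over all other registers. -/
noncomputable def reduced {n r : ℕ} (i : Fin n) (ρ : Op (Fin n × Fin r)) : Op (Fin r) :=
  Matrix.of fun x y => ∑ z : Fin n × Fin r → Bool,
    if (fun j => z (i, j)) = x then ρ z (fun q => if q.1 = i then y q.2 else z q) else 0

/-- The basis state of all wires in which the qubits of `α` carry `x` and all others carry `0`. -/
noncomputable def initialState {α : Type} [Register α] (x : α → Bool) : PureState :=
  Finsupp.single (Function.extend Register.wire x (fun _ => false)) 1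

/-- The entry `(x, y)` of the partial trace of `|ψ⟩⟨φ|` over all wires outside `β`. -/
noncomputable def tracedEntry {β : Type} [Fintype β] [Register β] (ψ φ : PureState)
    (x y : β → Bool) : ℂ :=
  ψ.sum fun z c =>
    if (fun b : β => z (Register.wire b)) = x then
      c * (starRingEnd ℂ) (φ (Function.extend Register.wire y z)) else 0

/-- The channel of a circuit: place the input on the wires of `α`, add ancillas in state `|0⟩`,
apply the circuit, and trace out all wires outside `β`. -/
noncomputable def circuitChannel (α β : Type) [Fintype α] [DecidableEq α] [Register α]
    [Fintype β] [Register β] (C : List Gate) (ρ : Op α) : Op β :=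
  Matrix.of fun x y => ∑ a : α → Bool, ∑ a' : α → Bool, ρ a a' *
    tracedEntry (circuitUnitary C (initialState a)) (circuitUnitary C (initialState a')) x y

/-- The input-output behaviour of a quantum algorithm with classical input register `α`, quantum
input register `β`, classical (measured) output register `γ` and quantum output register `δ`:
on classical input `x` and state `ρ`, the unnormalized output state for each classical output `y`;
its trace is the probability of `y` if `ρ` is normalized. A missing register is `Fin 0`; the only
bit string in it is `![]` and its only density matrix is `1`. -/
abbrev QAlg (α β γ δ : Type) := (α → Bool) → Op β → (γ → Bool) → Op δ

/-- The circuit `C` implements the algorithm `F`. -/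
def Implements {α β γ δ : Type} [Fintype α] [DecidableEq α] [Register α] [Fintype β]
    [DecidableEq β] [Register β] [Fintype γ] [Register γ] [Fintype δ] [Register δ]
    (C : List Gate) (F : QAlg α β γ δ) : Prop :=
  ∀ (x : α → Bool) (ρ : Op β) (y : γ → Bool),
    afterOutcome (circuitChannel (α ⊕ β) (γ ⊕ δ) C (tensor (basisState x) ρ)) y = F x ρ y

/-! ## Polynomial time: programs over stacks of bits, with a step count -/

/-- The contents of the variables; each variable holds a stack of bits. -/
abbrev Store := ℕ → List Bool

inductive Test where
  | nonempty (x : ℕ)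
  | top (x : ℕ)

def Test.holds (σ : Store) : Test → Prop
  | .nonempty x => σ x ≠ []
  | .top x => (σ x).head? = some true

/-- Programs that compute with stacks and print gates. In a gate, a wire is given by a constant port
and two variables whose stack heights are the block and the position. -/
inductive Program where
  | skip
  | push (x : ℕ) (b : Bool)
  | pop (x : ℕ)
  | emitH (p x y : ℕ)
  | emitT (p x y : ℕ)
  | emitCNOT (p x y q u v : ℕ)
  | seq (P Q : Program)
  | ite (c : Test) (P Q : Program)
  | while (c : Test) (P : Program)

def wireAt (σ : Store) (p x y : ℕ) : Wire := (p, (σ x).length, (σ y).length)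

/-- `Exec P σ C t σ'`: started in `σ`, the program `P` halts after `t` steps in `σ'` and has printed
the circuit `C`. Every elementary command and every test is one step. -/
inductive Exec : Program → Store → List Gate → ℕ → Store → Prop
  | skip (σ : Store) : Exec .skip σ [] 1 σ
  | push (σ : Store) (x : ℕ) (b : Bool) :
      Exec (.push x b) σ [] 1 (Function.update σ x (b :: σ x))
  | pop (σ : Store) (x : ℕ) : Exec (.pop x) σ [] 1 (Function.update σ x (σ x).tail)
  | emitH (σ : Store) (p x y : ℕ) : Exec (.emitH p x y) σ [.H (wireAt σ p x y)] 1 σ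
  | emitT (σ : Store) (p x y : ℕ) : Exec (.emitT p x y) σ [.T (wireAt σ p x y)] 1 σ
  | emitCNOT (σ : Store) (p x y q u v : ℕ) :
      Exec (.emitCNOT p x y q u v) σ [.CNOT (wireAt σ p x y) (wireAt σ q u v)] 1 σ
  | seq {P Q : Program} {σ σ' σ'' : Store} {C D : List Gate} {s t : ℕ} :
      Exec P σ C s σ' → Exec Q σ' D t σ'' → Exec (.seq P Q) σ (C ++ D) (s + t) σ''
  | iteTrue {c : Test} {P Q : Program} {σ σ' : Store} {C : List Gate} {t : ℕ} :
      c.holds σ → Exec P σ C t σ' → Exec (.ite c P Q) σ C (t + 1) σ'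
  | iteFalse {c : Test} {P Q : Program} {σ σ' : Store} {C : List Gate} {t : ℕ} :
      ¬ c.holds σ → Exec Q σ C t σ' → Exec (.ite c P Q) σ C (t + 1) σ'
  | whileTrue {c : Test} {P : Program} {σ σ' σ'' : Store} {C D : List Gate} {s t : ℕ} :
      c.holds σ → Exec P σ C s σ' → Exec (.while c P) σ' D t σ'' →
        Exec (.while c P) σ (C ++ D) (s + t + 1) σ''
  | whileFalse {c : Test} {P : Program} {σ : Store} :
      ¬ c.holds σ → Exec (.while c P) σ [] 1 σ

/-- The input `(1^κ, 1^i)` in variables `0` and `1`; all other variables are empty. -/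
def inputStore (κ i : ℕ) : Store := fun x =>
  if x = 0 then List.replicate κ true else if x = 1 then List.replicate i true else []

/-- `1^κ ↦ 1^(f κ)` is computable in polynomial time; in particular `f` is polynomially bounded. -/
def PolyTimeLength (f : ℕ → ℕ) : Prop :=
  ∃ (P : Program) (p : Polynomial ℕ), ∀ κ : ℕ, ∃ (t : ℕ) (σ : Store),
    Exec P (inputStore κ 0) [] t σ ∧ t ≤ p.eval κ ∧ σ 0 = List.replicate (f κ) true

/-- Quantum polynomial time, for a family of `n κ` algorithms for each security parameter `κ`:
one program prints, on input `(1^κ, 1^i)` and in time polynomial in `κ`, a quantum circuit that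
implements the `i`-th algorithm. -/
def IsQPTFamily {n : ℕ → ℕ} {α β γ δ : ℕ → Type}
    [∀ κ, Fintype (α κ)] [∀ κ, DecidableEq (α κ)] [∀ κ, Register (α κ)]
    [∀ κ, Fintype (β κ)] [∀ κ, DecidableEq (β κ)] [∀ κ, Register (β κ)]
    [∀ κ, Fintype (γ κ)] [∀ κ, Register (γ κ)] [∀ κ, Fintype (δ κ)] [∀ κ, Register (δ κ)]
    (F : ∀ κ, Fin (n κ) → QAlg (α κ) (β κ) (γ κ) (δ κ)) : Prop :=
  ∃ (P : Program) (p : Polynomial ℕ), ∀ (κ : ℕ) (i : Fin (n κ)),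
    ∃ (C : List Gate) (t : ℕ) (σ : Store),
      Exec P (inputStore κ i) C t σ ∧ t ≤ p.eval κ ∧ Implements C (F κ i)

/-- Quantum polynomial time, for one algorithm for each security parameter. -/
def IsQPT {α β γ δ : ℕ → Type}
    [∀ κ, Fintype (α κ)] [∀ κ, DecidableEq (α κ)] [∀ κ, Register (α κ)]
    [∀ κ, Fintype (β κ)] [∀ κ, DecidableEq (β κ)] [∀ κ, Register (β κ)]
    [∀ κ, Fintype (γ κ)] [∀ κ, Register (γ κ)] [∀ κ, Fintype (δ κ)] [∀ κ, Register (δ κ)]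
    (F : ∀ κ, QAlg (α κ) (β κ) (γ κ) (δ κ)) : Prop :=
  IsQPTFamily (n := fun _ => 1) (fun κ _ => F κ)

/-- Negligible functions. -/
def Negligible (ε : ℕ → ℝ) : Prop :=
  Asymptotics.SuperpolynomialDecay Filter.atTop (fun κ : ℕ => (κ : ℝ)) ε

/-- The output "the plaintext `m`" of a decryption algorithm; a leading `false` stands for `⊥`. -/
def decrypted {k : ℕ} (m : Bits k) : Fin 1 ⊕ Fin k → Bool := Sum.elim (fun _ => true) m

/-! ## Secret key single-decryptor encryption -/

/-- The algorithms of a secret key SDE scheme. Plaintexts, encryption keys and ciphertexts are bit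
strings, decryption keys are quantum states. -/
structure SDE where
  msgLen : ℕ → ℕ
  ekLen : ℕ → ℕ
  dkLen : ℕ → ℕ
  ctLen : ℕ → ℕ
  /-- the plaintext space -/
  Msg : ∀ κ, Set (Bits (msgLen κ))
  /-- the output is `(ek, dk)` -/
  KG : ∀ κ, QAlg (Fin 0) (Fin 0) (Fin (ekLen κ)) (Fin (dkLen κ))
  /-- the input is `(ek, m)`, the output is `ct` -/
  Enc : ∀ κ, QAlg (Fin (ekLen κ) ⊕ Fin (msgLen κ)) (Fin 0) (Fin (ctLen κ)) (Fin 0)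
  /-- the input is `ct` and `dk`, the output is a plaintext or `⊥` -/
  Dec : ∀ κ, QAlg (Fin (ctLen κ)) (Fin (dkLen κ)) (Fin 1 ⊕ Fin (msgLen κ)) (Fin 0)

namespace SDE

/-- The probability that an honestly generated ciphertext of `m` is decrypted to `m`. -/
noncomputable def decProb (S : SDE) (κ : ℕ) (m : Bits (S.msgLen κ)) : ℝ :=
  ∑ ek : Bits (S.ekLen κ), ∑ ct : Bits (S.ctLen κ),
    pr (S.Enc κ (Sum.elim ek m) 1 ct) * pr (S.Dec κ ct (S.KG κ ![] 1 ek) (decrypted m))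

/-- `S` is a secret key SDE scheme: its algorithms are efficient and it is correct. -/
structure IsScheme (S : SDE) : Prop where
  msgLen_poly : PolyTimeLength S.msgLen
  ekLen_poly : PolyTimeLength S.ekLen
  dkLen_poly : PolyTimeLength S.dkLen
  ctLen_poly : PolyTimeLength S.ctLen
  kg_qpt : IsQPT S.KG
  enc_qpt : IsQPT S.Enc
  dec_qpt : IsQPT S.Dec
  correct : ∃ ε, Negligible ε ∧ ∀ κ, ∀ m ∈ S.Msg κ, 1 - ε κ ≤ S.decProb κ m

/-- Adversaries `(A_0, A_1, …, A_n)` in the one-out-of-many one-time anti-piracy game. -/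
structure Adversary (S : SDE) (n : ℕ → ℕ) where
  /-- size of each of the registers `R_i` -/
  regLen : ℕ → ℕ
  /-- size of the classical description of the unitaries of a quantum decryptor -/
  descLen : ℕ → ℕ
  /-- size of the quantum state of a quantum decryptor -/
  stateLen : ℕ → ℕ
  /-- `A_0`: on input `dk`, output `(m_0, m_1)` and a state over `n` registers -/
  share : ∀ κ, QAlg (Fin 0) (Fin (S.dkLen κ)) (Fin (S.msgLen κ) ⊕ Fin (S.msgLen κ))
    (Fin (n κ) × Fin (regLen κ))
  /-- `A_i`: on input register `R_i`, output a quantum decryptor, which consists of a quantum state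
  and a classical description of unitaries -/
  decryptor : ∀ κ, Fin (n κ) →
    QAlg (Fin 0) (Fin (regLen κ)) (Fin (descLen κ)) (Fin (stateLen κ))
  /-- evaluation of the decryptor output by `A_i`: given the description and `ct`, apply the unitary
  for `ct` to the state (and ancillas) and measure one output qubit -/
  eval : ∀ κ, Fin (n κ) →
    QAlg (Fin (descLen κ) ⊕ Fin (S.ctLen κ)) (Fin (stateLen κ)) (Fin 1) (Fin 0)

/-- The adversary is QPT, and the messages that it sends in the game are plaintexts. -/
structure Adversary.IsAdmissible {S : SDE} {n : ℕ → ℕ} (A : S.Adversary n) : Prop where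
  regLen_poly : PolyTimeLength A.regLen
  descLen_poly : PolyTimeLength A.descLen
  stateLen_poly : PolyTimeLength A.stateLen
  share_qpt : IsQPT A.share
  decryptor_qpt : IsQPTFamily A.decryptor
  eval_qpt : IsQPTFamily A.eval
  msg_mem : ∀ κ (ek : Bits (S.ekLen κ)) (m₀ m₁ : Bits (S.msgLen κ)),
    pr (A.share κ ![] (S.KG κ ![] 1 ek) (Sum.elim m₀ m₁)) ≠ 0 → m₀ ∈ S.Msg κ ∧ m₁ ∈ S.Msg κ

/-- The probability that the adversary wins the one-out-of-many one-time anti-piracy game: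
`(ek, dk)` is generated, `A_0` turns `dk` into `(m_0, m_1)` and a state over `n` registers, a
uniform index `α` and a uniform bit `coin` are chosen, `ct` is an encryption of `m_coin`, `A_α` turns
`R_α` into a quantum decryptor, and the decryptor outputs `coin` on input `ct`. -/
noncomputable def Adversary.winProb {S : SDE} {n : ℕ → ℕ} (A : S.Adversary n) (κ : ℕ) : ℝ :=
  ∑ ek : Bits (S.ekLen κ), ∑ m₀ : Bits (S.msgLen κ), ∑ m₁ : Bits (S.msgLen κ),
  ∑ α : Fin (n κ), ∑ coin : Bool, ∑ ct : Bits (S.ctLen κ), ∑ u : Bits (A.descLen κ),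
    (1 / (n κ : ℝ)) * (1 / 2) *
    pr (S.Enc κ (Sum.elim ek (if coin then m₁ else m₀)) 1 ct) *
    pr (A.eval κ α (Sum.elim u ct)
      (A.decryptor κ α ![]
        (reduced α (A.share κ ![] (S.KG κ ![] 1 ek) (Sum.elim m₀ m₁))) u)
      (fun _ => coin))

/-- One-out-of-many one-time anti-piracy security. -/
def IsAntiPiracySecure (S : SDE) : Prop :=
  ∀ n : ℕ → ℕ, PolyTimeLength n → ∀ A : S.Adversary n, A.IsAdmissible →
    ∃ ε, Negligible ε ∧ ∀ κ, A.winProb κ ≤ 1 / 2 + 1 / (2 * (n κ : ℝ)) + ε κ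

end SDE

/-! ## Secret key unclonable encryption -/

/-- The algorithms of an SKUE scheme. Plaintexts and keys are bit strings, ciphertexts are quantum
states. -/
structure SKUE where
  msgLen : ℕ → ℕ
  ukLen : ℕ → ℕ
  ctLen : ℕ → ℕ
  /-- the plaintext space -/
  Msg : ∀ κ, Set (Bits (msgLen κ))
  /-- the output is `uk` -/
  KG : ∀ κ, QAlg (Fin 0) (Fin 0) (Fin (ukLen κ)) (Fin 0)
  /-- the input is `(uk, m)`, the output is the state `ct` -/
  Enc : ∀ κ, QAlg (Fin (ukLen κ) ⊕ Fin (msgLen κ)) (Fin 0) (Fin 0) (Fin (ctLen κ))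
  /-- the input is `uk` and the state `ct`, the output is a plaintext or `⊥` -/
  Dec : ∀ κ, QAlg (Fin (ukLen κ)) (Fin (ctLen κ)) (Fin 1 ⊕ Fin (msgLen κ)) (Fin 0)

namespace SKUE

/-- The probability that an honestly generated ciphertext of `m` is decrypted to `m`. -/
noncomputable def decProb (U : SKUE) (κ : ℕ) (m : Bits (U.msgLen κ)) : ℝ :=
  ∑ uk : Bits (U.ukLen κ),
    pr (U.KG κ ![] 1 uk) * pr (U.Dec κ uk (U.Enc κ (Sum.elim uk m) 1 ![]) (decrypted m))

/-- `U` is an SKUE scheme: its algorithms are efficient and it is correct. -/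
structure IsScheme (U : SKUE) : Prop where
  msgLen_poly : PolyTimeLength U.msgLen
  ukLen_poly : PolyTimeLength U.ukLen
  ctLen_poly : PolyTimeLength U.ctLen
  kg_qpt : IsQPT U.KG
  enc_qpt : IsQPT U.Enc
  dec_qpt : IsQPT U.Dec
  correct : ∃ ε, Negligible ε ∧ ∀ κ, ∀ m ∈ U.Msg κ, 1 - ε κ ≤ U.decProb κ m

/-- Adversaries `(A_0, A_1, …, A_n)` in the one-out-of-many one-time unclonable-indistinguishability
game. -/
structure Adversary (U : SKUE) (n : ℕ → ℕ) where
  /-- size of the state that `A_0` keeps while it waits for the ciphertext -/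
  stateLen : ℕ → ℕ
  /-- size of each of the registers `R_i` -/
  regLen : ℕ → ℕ
  /-- `A_0`, first stage: output `(m_0, m_1)` and keep a state -/
  choose : ∀ κ, QAlg (Fin 0) (Fin 0) (Fin (U.msgLen κ) ⊕ Fin (U.msgLen κ)) (Fin (stateLen κ))
  /-- `A_0`, second stage: on input the kept state and `ct`, output a state over `n` registers -/
  share : ∀ κ, QAlg (Fin 0) (Fin (stateLen κ) ⊕ Fin (U.ctLen κ)) (Fin 0)
    (Fin (n κ) × Fin (regLen κ))
  /-- `A_i`: on input `uk` and register `R_i`, output a bit -/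
  guess : ∀ κ, Fin (n κ) → QAlg (Fin (U.ukLen κ)) (Fin (regLen κ)) (Fin 1) (Fin 0)

/-- The adversary is QPT, and the messages that it sends are plaintexts. -/
structure Adversary.IsAdmissible {U : SKUE} {n : ℕ → ℕ} (A : U.Adversary n) : Prop where
  stateLen_poly : PolyTimeLength A.stateLen
  regLen_poly : PolyTimeLength A.regLen
  choose_qpt : IsQPT A.choose
  share_qpt : IsQPT A.share
  guess_qpt : IsQPTFamily A.guess
  msg_mem : ∀ κ (m₀ m₁ : Bits (U.msgLen κ)),
    pr (A.choose κ ![] 1 (Sum.elim m₀ m₁)) ≠ 0 → m₀ ∈ U.Msg κ ∧ m₁ ∈ U.Msg κ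

/-- The probability that the adversary wins the one-out-of-many one-time
unclonable-indistinguishability game: `A_0` sends `(m_0, m_1)`, a uniform bit `coin` and `uk` are
generated, `A_0` turns the encryption of `m_coin` into a state over `n` registers, a uniform index
`α` is chosen, and `A_α` outputs `coin` on input `uk` and `R_α`. -/
noncomputable def Adversary.winProb {U : SKUE} {n : ℕ → ℕ} (A : U.Adversary n) (κ : ℕ) : ℝ :=
  ∑ m₀ : Bits (U.msgLen κ), ∑ m₁ : Bits (U.msgLen κ), ∑ coin : Bool,
  ∑ uk : Bits (U.ukLen κ), ∑ α : Fin (n κ),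
    (1 / (n κ : ℝ)) * (1 / 2) * pr (U.KG κ ![] 1 uk) *
    pr (A.guess κ α uk
      (reduced α (A.share κ ![]
        (tensor (A.choose κ ![] 1 (Sum.elim m₀ m₁))
          (U.Enc κ (Sum.elim uk (if coin then m₁ else m₀)) 1 ![])) ![]))
      (fun _ => coin))

/-- One-out-of-many one-time unclonable-indistinguishability. -/
def IsUnclonableIndSecure (U : SKUE) : Prop :=
  ∀ n : ℕ → ℕ, PolyTimeLength n → ∀ A : U.Adversary n, A.IsAdmissible →
    ∃ ε, Negligible ε ∧ ∀ κ, A.winProb κ ≤ 1 / 2 + 1 / (2 * (n κ : ℝ)) + ε κ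

end SKUE

/-! ## The transformation -/

/-- Bitwise exclusive or. -/
def bitXor {n : ℕ} (x y : Bits n) : Bits n := fun j => xor (x j) (y j)

/-- The SKUE scheme obtained from an SDE scheme. The key `uk` is uniform. A ciphertext of `m` is
`(ct ⊕ uk, dk)`, where `(ek, dk)` is a fresh key pair and `ct` is an SDE ciphertext of `m` under
`ek`. Decryption reads the classical part `c` of the ciphertext and runs the SDE decryption on
`c ⊕ uk` and `dk`. -/
noncomputable def SDE.toSKUE (S : SDE) : SKUE where
  msgLen := S.msgLen
  ukLen := S.ctLen
  ctLen := fun κ => S.ctLen κ + S.dkLen κ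
  Msg := S.Msg
  KG := fun κ _ ρ _ => (1 / 2 ^ S.ctLen κ : ℂ) • ρ
  Enc := fun κ x ρ _ =>
    ∑ ek : Bits (S.ekLen κ), ∑ ct : Bits (S.ctLen κ),
      ((pr (S.Enc κ (Sum.elim ek (x ∘ Sum.inr)) 1 ct) : ℝ) : ℂ) •
        join (tensor (basisState (bitXor ct (x ∘ Sum.inl))) (S.KG κ ![] ρ ek))
  Dec := fun κ uk ρ y =>
    ∑ c : Bits (S.ctLen κ), S.Dec κ (bitXor c uk) (afterOutcome (unjoin ρ) c) y

end OneOutOfMany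

namespace OneOutOfMany

/-! ## Sesquilinear forms on pure states and their pullbacks along circuits -/

/-! The classical part of a ciphertext is a one-time pad, and a one-time pad can be read in both
directions: for uniform `uk` the pair (`ct ⊕ uk`, `uk`) is distributed as (`c`, `c ⊕ ct`) for
uniform `c`. An adversary against the transformed scheme therefore yields one against the SDE
scheme, `SKUE.Adversary.toSDE`. Its first stage samples `c`, presents `(c, dk)` as the ciphertext,
and puts a copy of `c` in front of every register. A register is itself the quantum decryptor: once
`ct` is known, it computes `uk = c ⊕ ct` and makes the original guess. The simulation is perfect, so
`SKUE.Adversary.winProb_toSDE` is an equality and the negligible function is inherited unchanged.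
Correctness is simpler: the mask cancels for every value of `uk` (`SDE.decProb_toSKUE`).

The equality of probabilities is a computation with finite sums. Algorithms implemented by circuits
are linear in their quantum input (`Implements.actsLinearly`), so mixtures over keys, ciphertexts
and masks can be pulled out. A classical prefix commutes with the partial trace (`reduced_attach`).
The substitution `c = ct ⊕ uk` (`sum_bitXor`, used in `pr_unmask_maskedShare`) then matches the two
games.

Most of the work is efficiency in the concrete machine model. Circuits are analysed in the
Heisenberg picture: the partial trace to an output register is a sesquilinear form on pure states,
and `pull` transports forms backwards through a circuit. Blocks of CNOT gates only relabel basis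
states, and a subroutine placed on its own ports acts through its kernel `kern` while the remaining
wires are frozen (`pull_map`, `pull_call`). A value copied by CNOT gates to wires that are later
traced out becomes classical; the lemmas on `AgreeOff` express this. The three circuits needed are
treated in `implements_unmaskGates`, `implements_maskedEncGates` and `implements_maskedShareGates`.

The programs that print these circuits are assembled with the predicate `Compiles`. Every subroutine
gets its own space of variables, where it runs unchanged by the frame property `Exec.relocate`;
lengths are computed once in advance and kept in unary. -/

/-- The sesquilinear form on pure states with matrix `G` in the computational basis. -/
noncomputable def sesq (G : Config → Config → ℂ) (ψ φ : PureState) : ℂ :=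
  ψ.sum fun z c => φ.sum fun z' c' => c * (starRingEnd ℂ) c' * G z z'

noncomputable def ket (z : Config) : PureState := Finsupp.single z 1

theorem sesq_add_left (G : Config → Config → ℂ) (ψ₁ ψ₂ φ : PureState) :
    sesq G (ψ₁ + ψ₂) φ = sesq G ψ₁ φ + sesq G ψ₂ φ := by
  unfold sesq
  rw [Finsupp.sum_add_index']
  · intro z; simp [Finsupp.sum]
  · intro z c₁ c₂
    simp [Finsupp.sum, add_mul, Finset.sum_add_distrib]

theorem sesq_add_right (G : Config → Config → ℂ) (ψ φ₁ φ₂ : PureState) :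
    sesq G ψ (φ₁ + φ₂) = sesq G ψ φ₁ + sesq G ψ φ₂ := by
  unfold sesq
  rw [← Finsupp.sum_add]
  refine Finsupp.sum_congr fun z _ => ?_
  rw [Finsupp.sum_add_index']
  · intro z; simp
  · intro z c₁ c₂
    simp [mul_add, add_mul]

theorem sesq_smul_left (G : Config → Config → ℂ) (c : ℂ) (ψ φ : PureState) :
    sesq G (c • ψ) φ = c * sesq G ψ φ := by
  unfold sesq
  rw [Finsupp.sum_smul_index']
  · simp [Finsupp.sum, Finset.mul_sum, mul_assoc]
  · intro z; simp [Finsupp.sum]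

theorem sesq_smul_right (G : Config → Config → ℂ) (c : ℂ) (ψ φ : PureState) :
    sesq G ψ (c • φ) = (starRingEnd ℂ) c * sesq G ψ φ := by
  unfold sesq
  rw [Finsupp.mul_sum]
  refine Finsupp.sum_congr fun z _ => ?_
  rw [Finsupp.sum_smul_index', Finsupp.mul_sum]
  · refine Finsupp.sum_congr fun z _ => ?_
    simp only [smul_eq_mul, map_mul]
    ring
  · intro z; simp

theorem sesq_zero_left (G : Config → Config → ℂ) (φ : PureState) : sesq G 0 φ = 0 := by
  simp [sesq]

theorem sesq_zero_right (G : Config → Config → ℂ) (ψ : PureState) : sesq G ψ 0 = 0 := by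
  simp [sesq]

theorem sesq_ket (G : Config → Config → ℂ) (z z' : Config) : sesq G (ket z) (ket z') = G z z' := by
  simp [sesq, ket]

/-- Both sides are sesquilinear in `(ψ, φ)`, so it suffices to compare them on basis states. -/
theorem sesq_map (G : Config → Config → ℂ) (U : PureState →ₗ[ℂ] PureState) (ψ φ : PureState) :
    sesq G (U ψ) (U φ) = sesq (fun z z' => sesq G (U (ket z)) (U (ket z'))) ψ φ := by
  have single_eq : ∀ (z : Config) (c : ℂ), Finsupp.single z c = c • ket z := by
    intro z c; simp [ket]
  induction ψ using Finsupp.induction_linear with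
  | zero => simp [sesq_zero_left]
  | add f g hf hg => rw [map_add, sesq_add_left, sesq_add_left, hf, hg]
  | single z c =>
    rw [single_eq, map_smul, sesq_smul_left, sesq_smul_left]
    congr 1
    induction φ using Finsupp.induction_linear with
    | zero => simp [sesq_zero_right]
    | add f g hf hg => rw [map_add, sesq_add_right, sesq_add_right, hf, hg]
    | single z' c' =>
      rw [single_eq, map_smul, sesq_smul_right, sesq_smul_right, sesq_ket]

/-- The two relabelings may differ. This is needed because the frozen wires around a subroutine can
carry different values in the two arguments. -/
theorem sesq_mapDomain (G : Config → Config → ℂ) (e e' : Config → Config) (ψ φ : PureState) :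
    sesq G (ψ.mapDomain e) (φ.mapDomain e') = sesq (fun w w' => G (e w) (e' w')) ψ φ := by
  unfold sesq
  rw [Finsupp.sum_mapDomain_index]
  · refine Finsupp.sum_congr fun z _ => ?_
    rw [Finsupp.sum_mapDomain_index]
    · intro z; simp
    · intro z c₁ c₂; simp [mul_add, add_mul]
  · intro z; simp [Finsupp.sum]
  · intro z c₁ c₂
    simp [Finsupp.sum, add_mul, Finset.sum_add_distrib]

theorem sesq_sum {ι : Type*} (s : Finset ι) (G : ι → Config → Config → ℂ) (c : ι → ℂ)
    (ψ φ : PureState) :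
    sesq (fun z z' => ∑ i ∈ s, G i z z' * c i) ψ φ = ∑ i ∈ s, sesq (G i) ψ φ * c i := by
  unfold sesq Finsupp.sum
  simp only [Finset.mul_sum, Finset.sum_mul]
  rw [Finset.sum_congr rfl (fun z _ => Finset.sum_comm), Finset.sum_comm]
  simp only [mul_assoc]

/-- The pullback of a sesquilinear form along the unitary of a circuit. -/
noncomputable def pull (C : List Gate) (G : Config → Config → ℂ) (z z' : Config) : ℂ :=
  sesq G (circuitUnitary C (ket z)) (circuitUnitary C (ket z'))

theorem circuitUnitary_append (C D : List Gate) :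
    circuitUnitary (C ++ D) = (circuitUnitary D).comp (circuitUnitary C) := by
  induction C with
  | nil => rfl
  | cons g C ih => simp [circuitUnitary, ih, LinearMap.comp_assoc]

/-- Forms travel backwards: `C` acts on states first, so the form passes through `D` first. -/
theorem pull_append (C D : List Gate) (G : Config → Config → ℂ) :
    pull (C ++ D) G = pull C (pull D G) := by
  funext z z'
  unfold pull
  rw [circuitUnitary_append, LinearMap.comp_apply, LinearMap.comp_apply, sesq_map]

theorem pull_nil (G : Config → Config → ℂ) : pull [] G = G := by
  funext z z'
  simp [pull, circuitUnitary, sesq_ket]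

/-! ## Relocated circuits -/

def Gate.map (f : Wire → Wire) : Gate → Gate
  | .H w => .H (f w)
  | .T w => .T (f w)
  | .CNOT c t => .CNOT (f c) (f t)

/-- Overwrite the wires in the range of `f`. -/
noncomputable def overwrite (f : Wire → Wire) (z w : Config) : Config := Function.extend f w z

theorem overwrite_apply {f : Wire → Wire} (hf : Function.Injective f) (z w : Config) (a : Wire) :
    overwrite f z w (f a) = w a := hf.extend_apply _ _ _

theorem overwrite_apply_of_notMem {f : Wire → Wire} (z w : Config) {v : Wire}
    (hv : ∀ a, f a ≠ v) : overwrite f z w v = z v :=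
  Function.extend_apply' _ _ _ (by rintro ⟨a, ha⟩; exact hv a ha)

theorem overwrite_self {f : Wire → Wire} (hf : Function.Injective f) (z : Config) :
    overwrite f z (z ∘ f) = z := by
  funext v
  by_cases hv : ∃ a, f a = v
  · obtain ⟨a, rfl⟩ := hv
    exact overwrite_apply hf _ _ _
  · exact overwrite_apply_of_notMem _ _ (by simpa using hv)

theorem update_overwrite {f : Wire → Wire} (hf : Function.Injective f) (z w : Config) (a : Wire)
    (b : Bool) :
    Function.update (overwrite f z w) (f a) b = overwrite f z (Function.update w a b) := by
  funext v
  by_cases hv : ∃ a, f a = v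
  · obtain ⟨c, rfl⟩ := hv
    rw [overwrite_apply hf, Function.update_apply, Function.update_apply, overwrite_apply hf]
    simp [hf.eq_iff]
  · have hv' : ∀ a, f a ≠ v := by simpa using hv
    rw [overwrite_apply_of_notMem _ _ hv', Function.update_of_ne (hv' a).symm,
      overwrite_apply_of_notMem _ _ hv']

/-- `overwrite f z` embeds the configurations seen by the gate into those of all wires, with the
surroundings frozen at `z`. A relocated gate touches only wires in the range of `f`, and injectivity
keeps distinct wires distinct, so the embedding intertwines the gate with its relocated version. -/
theorem unitary_map_mapDomain {f : Wire → Wire} (hf : Function.Injective f) (z : Config) (g : Gate)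
    (ψ : PureState) :
    (g.map f).unitary (ψ.mapDomain (overwrite f z)) =
      (g.unitary ψ).mapDomain (overwrite f z) := by
  induction ψ using Finsupp.induction_linear with
  | zero => simp
  | add f g hf hg => simp only [Finsupp.mapDomain_add, map_add, hf, hg]
  | single w c =>
    rw [Finsupp.mapDomain_single, Gate.unitary, Gate.unitary, Finsupp.linearCombination_single,
      Finsupp.linearCombination_single, Finsupp.mapDomain_smul]
    congr 1
    cases g with
    | H a =>
      simp only [Gate.map, Gate.onBasis, Finsupp.mapDomain_add, Finsupp.mapDomain_single,
        update_overwrite hf, overwrite_apply hf]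
    | T a =>
      simp only [Gate.map, Gate.onBasis, Finsupp.mapDomain_single, overwrite_apply hf]
    | CNOT a b =>
      simp only [Gate.map, Gate.onBasis, Finsupp.mapDomain_single, update_overwrite hf,
        overwrite_apply hf, hf.eq_iff]
      split_ifs <;> rfl

theorem circuitUnitary_map_mapDomain {f : Wire → Wire} (hf : Function.Injective f) (z : Config)
    (C : List Gate) (ψ : PureState) :
    circuitUnitary (C.map (Gate.map f)) (ψ.mapDomain (overwrite f z)) =
      (circuitUnitary C ψ).mapDomain (overwrite f z) := by
  induction C generalizing ψ with
  | nil => rfl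
  | cons g C ih =>
    simp only [List.map_cons, circuitUnitary, LinearMap.comp_apply]
    rw [unitary_map_mapDomain hf, ih]

/-- A configuration splits into the part `z ∘ f` on which the circuit acts and a frozen remainder.
The form is pulled back on the former only, and the remainders of `z` and `z'` enter as parameters.
-/
theorem pull_map {f : Wire → Wire} (hf : Function.Injective f) (C : List Gate)
    (G : Config → Config → ℂ) (z z' : Config) :
    pull (C.map (Gate.map f)) G z z' =
      pull C (fun w w' => G (overwrite f z w) (overwrite f z' w')) (z ∘ f) (z' ∘ f) := by
  have h : ∀ z : Config, ket z = (ket (z ∘ f)).mapDomain (overwrite f z) := by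
    intro z
    rw [ket, ket, Finsupp.mapDomain_single, overwrite_self hf]
  unfold pull
  rw [h z, h z', circuitUnitary_map_mapDomain hf, circuitUnitary_map_mapDomain hf, sesq_mapDomain]

/-! ## Blocks of CNOT gates -/

theorem unitary_CNOT_ket {c t : Wire} (h : c ≠ t) (z : Config) :
    (Gate.CNOT c t).unitary (ket z) = ket (Function.update z t (xor (z c) (z t))) := by
  simp [Gate.unitary, ket, Finsupp.linearCombination_single, Gate.onBasis, h]

/-- No target is repeated and no source is a target, so every gate reads an original value and the
gates act as if simultaneously. -/
theorem circuitUnitary_cnots_ket (s : Wire → Wire) (L : List Wire) (hL : L.Nodup)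
    (hs : ∀ t ∈ L, s t ∉ L) (z : Config) :
    circuitUnitary (L.map fun t => .CNOT (s t) t) (ket z) =
      ket fun w => if w ∈ L then xor (z w) (z (s w)) else z w := by
  induction L generalizing z with
  | nil => simp [circuitUnitary]
  | cons t L ih =>
    rw [List.nodup_cons] at hL
    have hst : s t ≠ t := fun h => hs t (by simp) (by simp [h])
    rw [List.map_cons, circuitUnitary, LinearMap.comp_apply, unitary_CNOT_ket hst,
      ih hL.2 (fun u hu hu' => hs u (by simp [hu]) (by simp [hu']))]
    congr 1
    funext w
    by_cases hw : w = t
    · subst hw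
      simp [hL.1, Bool.xor_comm]
    · by_cases hwL : w ∈ L
      · have : s w ≠ t := fun h => hs w (by simp [hwL]) (by simp [h])
        simp [hw, hwL, this]
      · simp [hw, hwL]

/-- Add, for `i < n` and `j < len`, the wire `(p, r i, o + j)` to the wire `(q, i, o' + j)`. -/
def xorGates (p : ℕ) (r : ℕ → ℕ) (o q o' n len : ℕ) : List Gate :=
  (List.range n).flatMap fun i => (List.range len).map fun j =>
    .CNOT (p, r i, o + j) (q, i, o' + j)

def InBlocks (q o' n len : ℕ) (w : Wire) : Prop :=
  w.1 = q ∧ w.2.1 < n ∧ o' ≤ w.2.2 ∧ w.2.2 < o' + len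

instance (q o' n len : ℕ) (w : Wire) : Decidable (InBlocks q o' n len w) :=
  inferInstanceAs (Decidable (_ ∧ _))

/-- The truncated subtraction is harmless, since `InBlocks` guarantees that the position is at least
`o'`. -/
def xorConfig (p : ℕ) (r : ℕ → ℕ) (o q o' n len : ℕ) (z : Config) : Config := fun w =>
  if InBlocks q o' n len w then xor (z w) (z (p, r w.2.1, w.2.2 - o' + o)) else z w

theorem circuitUnitary_xorGates {p q : ℕ} (hpq : p ≠ q) (r : ℕ → ℕ) (o o' n len : ℕ)
    (z : Config) :
    circuitUnitary (xorGates p r o q o' n len) (ket z) =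
      ket (xorConfig p r o q o' n len z) := by
  -- The targets in printing order; the source of a gate is a function of its target.
  let L : List Wire := (List.range n).flatMap fun i => (List.range len).map fun j => (q, i, o' + j)
  have hmem : ∀ w, w ∈ L ↔ InBlocks q o' n len w := by
    rintro ⟨a, b, c⟩
    simp only [L, InBlocks, List.mem_flatMap, List.mem_map, List.mem_range, Prod.mk.injEq]
    constructor
    · rintro ⟨i, hi, j, hj, rfl, rfl, rfl⟩
      exact ⟨rfl, hi, by omega, by omega⟩
    · rintro ⟨rfl, hi, h1, h2⟩
      exact ⟨b, hi, c - o', by omega, rfl, rfl, by omega⟩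
  have hgates : xorGates p r o q o' n len =
      L.map fun t => .CNOT (p, r t.2.1, t.2.2 - o' + o) t := by
    simp only [xorGates, L, List.map_flatMap, List.map_map]
    congr 1
    funext i
    congr 1
    funext j
    simp [add_comm]
  have hnodup : L.Nodup := by
    rw [List.nodup_flatMap]
    refine ⟨fun i _ => List.Nodup.map (fun a b h => by simpa using h) List.nodup_range, ?_⟩
    refine List.Pairwise.imp ?_ (List.pairwise_lt_range)
    intro a b hab
    rw [Function.onFun, List.disjoint_left]
    intro w hw hw'
    simp only [List.mem_map] at hw hw'
    obtain ⟨j, -, rfl⟩ := hw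
    obtain ⟨j', -, h⟩ := hw'
    simp only [Prod.mk.injEq] at h
    omega
  rw [hgates, circuitUnitary_cnots_ket _ _ hnodup]
  · simp only [hmem]
    rfl
  · intro t _ h
    exact hpq ((hmem _).1 h).1

theorem pull_xorGates {p q : ℕ} (hpq : p ≠ q) (r : ℕ → ℕ) (o o' n len : ℕ)
    (G : Config → Config → ℂ) (z z' : Config) :
    pull (xorGates p r o q o' n len) G z z' =
      G (xorConfig p r o q o' n len z) (xorConfig p r o q o' n len z') := by
  rw [pull, circuitUnitary_xorGates hpq, circuitUnitary_xorGates hpq, sesq_ket]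

/-- Move the wires `(p, i, o + j)` to `(q, i, o' + j)`, for `i < n` and `j < len`, provided that the
latter are in state `|0⟩`. -/
def moveGates (p o q o' n len : ℕ) : List Gate :=
  xorGates p id o q o' n len ++ xorGates q id o' p o n len

/-- The effect for arbitrary contents of the target. The source block ends up with the old contents
of the target, hence blank if the target was blank. -/
def moveConfig (p o q o' n len : ℕ) (z : Config) : Config := fun w =>
  if InBlocks q o' n len w then xor (z w) (z (p, w.2.1, w.2.2 - o' + o))
  else if InBlocks p o n len w then z (q, w.2.1, w.2.2 - o + o') else z w

theorem pull_moveGates {p q : ℕ} (hpq : p ≠ q) (o o' n len : ℕ)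
    (G : Config → Config → ℂ) (z z' : Config) :
    pull (moveGates p o q o' n len) G z z' =
      G (moveConfig p o q o' n len z) (moveConfig p o q o' n len z') := by
  have h : ∀ z, xorConfig q id o' p o n len (xorConfig p id o q o' n len z) =
      moveConfig p o q o' n len z := by
    intro z
    funext ⟨a, b, c⟩
    by_cases ha : a = p
    · subst ha
      have h1 : ¬ InBlocks q o' n len (a, b, c) := fun h => hpq h.1
      by_cases h2 : InBlocks a o n len (a, b, c)
      · obtain ⟨-, h3, h4, h5⟩ := id h2
        simp only at h3 h4 h5
        have h6 : InBlocks q o' n len (q, b, c - o + o') := ⟨rfl, h3, by simp, by simp; omega⟩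
        have h7 : c - o + o' - o' + o = c := by omega
        simp only [xorConfig, moveConfig, h1, h2, h6, if_true, if_false, id, h7]
        cases z (a, b, c) <;> cases z (q, b, c - o + o') <;> rfl
      · simp [xorConfig, moveConfig, h1, h2]
    · have h1 : ¬ InBlocks p o n len (a, b, c) := fun h => ha h.1
      simp [xorConfig, moveConfig, h1]
  rw [moveGates, pull_append, pull_xorGates hpq, pull_xorGates hpq.symm, h, h]

/-! ## Forms that are local to a register, and the kernel of a circuit -/

/-- Two configurations agree on all wires outside the range of `w`. -/
def AgreeOff {β : Type} (w : β → Wire) (z z' : Config) : Prop :=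
  ∀ v, (∀ b, w b ≠ v) → z v = z' v

open Classical in
/-- The form that acts as `h` on the wires in the range of `w` and traces out all others. -/
noncomputable def loc {β : Type} (w : β → Wire) (h : (β → Bool) → (β → Bool) → ℂ)
    (z z' : Config) : ℂ :=
  if AgreeOff w z z' then h (z ∘ w) (z' ∘ w) else 0

noncomputable def initConfig {α : Type} [Register α] (x : α → Bool) : Config :=
  Function.extend Register.wire x (fun _ => false)

theorem initConfig_wire {α : Type} [Register α] (x : α → Bool) (a : α) :
    initConfig x (Register.wire a) = x a := Register.wire_injective.extend_apply _ _ _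

theorem initConfig_of_notMem {α : Type} [Register α] (x : α → Bool) {v : Wire}
    (hv : ∀ a : α, Register.wire a ≠ v) : initConfig x v = false :=
  Function.extend_apply' _ _ _ (by rintro ⟨a, ha⟩; exact hv a ha)

theorem eq_initConfig {α : Type} [Register α] (x : α → Bool) (z : Config)
    (h : ∀ a, z (Register.wire a) = x a) (h' : ∀ v, (∀ a : α, Register.wire a ≠ v) → z v = false) :
    z = initConfig x := by
  funext v
  by_cases hv : ∃ a : α, Register.wire a = v
  · obtain ⟨a, rfl⟩ := hv
    rw [h, initConfig_wire]
  · have hv' : ∀ a : α, Register.wire a ≠ v := by simpa using hv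
    rw [h' v hv', initConfig_of_notMem _ hv']

/-- Identifies the only basis state paired with `z` by a partial trace that reads `y` on the second
index. -/
theorem extend_wire_eq_iff {β : Type} [Register β] (y : β → Bool) (z z' : Config) :
    Function.extend Register.wire y z = z' ↔
      AgreeOff (Register.wire : β → Wire) z z' ∧ z' ∘ Register.wire = y := by
  constructor
  · rintro rfl
    refine ⟨fun v hv => ?_, ?_⟩
    · rw [Function.extend_apply' _ _ _ (by rintro ⟨a, ha⟩; exact hv a ha)]
    · exact Function.extend_comp Register.wire_injective _ _
  · rintro ⟨h, rfl⟩
    funext v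
    by_cases hv : ∃ a : β, Register.wire a = v
    · obtain ⟨a, rfl⟩ := hv
      rw [Register.wire_injective.extend_apply]
      rfl
    · rw [Function.extend_apply' _ _ _ hv]
      exact h v (by simpa using hv)

/-- For each `z` in the support of `ψ`, the inner sum of the form has at most one nonzero term,
located at the extension of `y` by `z`. -/
theorem tracedEntry_eq_sesq {β : Type} [Fintype β] [DecidableEq β] [Register β]
    (ψ φ : PureState) (x y : β → Bool) :
    tracedEntry ψ φ x y =
      sesq (loc Register.wire fun a b => if a = x ∧ b = y then 1 else 0) ψ φ := by
  classical
  unfold tracedEntry sesq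
  refine Finsupp.sum_congr fun z _ => ?_
  rw [Finsupp.sum, Finset.sum_eq_single (Function.extend Register.wire y z)]
  · obtain ⟨h1, h2⟩ := (extend_wire_eq_iff y z _).1 rfl
    rw [loc, if_pos h1, h2]
    by_cases h : (fun b : β => z (Register.wire b)) = x
    · have h' : z ∘ Register.wire = x := h
      simp [h, h']
    · have h' : z ∘ Register.wire ≠ x := h
      simp [h, h']
  · intro z' _ hz'
    rw [loc]
    split_ifs with h1 h2
    · exact absurd ((extend_wire_eq_iff y z z').2 ⟨h1, h2.2⟩).symm hz'
    · simp
    · simp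
  · intro h
    rw [Finsupp.notMem_support_iff] at h
    simp [h]

/-- The entries of the channel of a circuit in the computational basis. -/
noncomputable def kern (α β : Type) [Register α] [Fintype β] [Register β] (C : List Gate)
    (a a' : α → Bool) (b b' : β → Bool) : ℂ :=
  tracedEntry (circuitUnitary C (initialState a)) (circuitUnitary C (initialState a')) b b'

/-- Expand `h` in matrix units; a matrix unit pulls back to an entry of the kernel. This is how a
circuit known only through the algorithm it implements enters a computation. -/
theorem pull_loc {α β : Type} [Register α] [Fintype β] [DecidableEq β] [Register β]
    (C : List Gate) (h : (β → Bool) → (β → Bool) → ℂ) (a a' : α → Bool) :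
    pull C (loc Register.wire h) (initConfig a) (initConfig a') =
      ∑ b, ∑ b', kern α β C a a' b b' * h b b' := by
  have hG : loc (Register.wire : β → Wire) h = fun z z' =>
      ∑ i ∈ (Finset.univ : Finset ((β → Bool) × (β → Bool))),
        loc Register.wire (fun a b => if a = i.1 ∧ b = i.2 then 1 else 0) z z' * h i.1 i.2 := by
    funext z z'
    simp only [loc]
    split_ifs
    · rw [Finset.sum_eq_single (z ∘ Register.wire, z' ∘ Register.wire)]
      · simp
      · rintro ⟨b, b'⟩ - hb
        rw [if_neg, zero_mul]
        rintro ⟨rfl, rfl⟩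
        exact hb rfl
      · simp
    · simp
  rw [hG, pull, sesq_sum, Fintype.sum_prod_type]
  simp only [kern, tracedEntry_eq_sesq]
  rfl

theorem kern_eq_pull {α β : Type} [Register α] [Fintype β] [DecidableEq β] [Register β]
    (C : List Gate) (a a' : α → Bool) (b b' : β → Bool) :
    kern α β C a a' b b' =
      pull C (loc Register.wire fun x y => if x = b ∧ y = b' then 1 else 0)
        (initConfig a) (initConfig a') := by
  rw [kern, tracedEntry_eq_sesq]
  rfl

theorem sum_sum_type {α β M : Type*} [Fintype α] [Fintype β] [DecidableEq α] [DecidableEq β]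
    [AddCommMonoid M] (f : (α ⊕ β → Bool) → M) :
    ∑ a, f a = ∑ x : α → Bool, ∑ y : β → Bool, f (Sum.elim x y) := by
  rw [← Fintype.sum_prod_type']
  exact (Fintype.sum_equiv (Equiv.sumArrowEquivProdArrow α β Bool).symm _ _ fun _ => rfl).symm

/-- The basis state on the classical input kills all terms except those in which both indices carry
`x`. What remains is an explicit formula for the algorithm, linear in `ρ`. -/
theorem implements_iff {α β γ δ : Type} [Fintype α] [DecidableEq α] [Register α] [Fintype β]
    [DecidableEq β] [Register β] [Fintype γ] [Register γ] [Fintype δ] [Register δ]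
    {C : List Gate} {F : QAlg α β γ δ} :
    Implements C F ↔ ∀ x ρ y d d', F x ρ y d d' = ∑ b, ∑ b', ρ b b' *
      kern (α ⊕ β) (γ ⊕ δ) C (Sum.elim x b) (Sum.elim x b') (Sum.elim y d) (Sum.elim y d') := by
  have key : ∀ x ρ y d d',
      afterOutcome (circuitChannel (α ⊕ β) (γ ⊕ δ) C (tensor (basisState x) ρ)) y d d' =
      ∑ b, ∑ b', ρ b b' *
        kern (α ⊕ β) (γ ⊕ δ) C (Sum.elim x b) (Sum.elim x b') (Sum.elim y d) (Sum.elim y d') := by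
    intro x ρ y d d'
    simp only [afterOutcome, circuitChannel, Matrix.of_apply, tensor, basisState]
    rw [sum_sum_type, Finset.sum_eq_single x]
    · refine Finset.sum_congr rfl fun b _ => ?_
      rw [sum_sum_type, Finset.sum_eq_single x]
      · refine Finset.sum_congr rfl fun b' _ => ?_
        simp only [Sum.elim_comp_inl, Sum.elim_comp_inr, Matrix.single_apply_same, one_mul]
        rfl
      · intro x' _ hx'
        refine Finset.sum_eq_zero fun b' _ => ?_
        simp [Ne.symm hx']
      · simp
    · intro x' _ hx'
      refine Finset.sum_eq_zero fun b _ => ?_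
      refine Finset.sum_eq_zero fun a _ => ?_
      simp [Ne.symm hx']
    · simp
  constructor
  · intro h x ρ y d d'
    rw [← key, h]
  · intro h x ρ y
    ext d d'
    rw [key, h]

/-! ## Relocated programs -/

def portMap (f : ℕ → ℕ) (w : Wire) : Wire := (f w.1, w.2)

theorem portMap_injective {f : ℕ → ℕ} (hf : Function.Injective f) :
    Function.Injective (portMap f) := by
  rintro ⟨a, b⟩ ⟨a', b'⟩ h
  simp only [portMap, Prod.mk.injEq] at h
  rw [hf h.1, h.2]

def Test.relocate (g : ℕ → ℕ) : Test → Test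
  | .nonempty x => .nonempty (g x)
  | .top x => .top (g x)

/-- Rename the ports by `f` and the variables by `g`. -/
def Program.relocate (f g : ℕ → ℕ) : Program → Program
  | .skip => .skip
  | .push x b => .push (g x) b
  | .pop x => .pop (g x)
  | .emitH p x y => .emitH (f p) (g x) (g y)
  | .emitT p x y => .emitT (f p) (g x) (g y)
  | .emitCNOT p x y q u v => .emitCNOT (f p) (g x) (g y) (f q) (g u) (g v)
  | .seq P Q => .seq (P.relocate f g) (Q.relocate f g)
  | .ite c P Q => .ite (c.relocate g) (P.relocate f g) (Q.relocate f g)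
  | .while c P => .while (c.relocate g) (P.relocate f g)

theorem Test.holds_relocate {g : ℕ → ℕ} {σ τ : Store} (h : ∀ x, τ (g x) = σ x) (c : Test) :
    (c.relocate g).holds τ ↔ c.holds σ := by
  cases c <;> simp [Test.relocate, Test.holds, h]

theorem wireAt_relocate {g : ℕ → ℕ} {σ τ : Store} (h : ∀ x, τ (g x) = σ x) (f : ℕ → ℕ)
    (p x y : ℕ) : wireAt τ (f p) (g x) (g y) = portMap f (wireAt σ p x y) := by
  simp [wireAt, portMap, h]

/-- A frame property: the renamed program sees only the variables in the range of `g`, so it runs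
step by step as before and preserves all others. Ports do not influence control flow, so nothing is
required of `f`. -/
theorem Exec.relocate (f : ℕ → ℕ) {g : ℕ → ℕ} (hg : Function.Injective g) {P : Program}
    {σ σ' : Store} {C : List Gate} {t : ℕ} (hP : Exec P σ C t σ') (τ : Store)
    (h : ∀ x, τ (g x) = σ x) :
    ∃ τ', Exec (P.relocate f g) τ (C.map (Gate.map (portMap f))) t τ' ∧
      (∀ x, τ' (g x) = σ' x) ∧ ∀ y, (∀ x, g x ≠ y) → τ' y = τ y := by
  induction hP generalizing τ with
  | skip σ => exact ⟨τ, .skip τ, h, fun _ _ => rfl⟩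
  | push σ x b =>
    refine ⟨_, .push τ (g x) b, fun y => ?_, fun y hy => Function.update_of_ne (hy x).symm _ _⟩
    simp [Function.update_apply, hg.eq_iff, h]
  | pop σ x =>
    refine ⟨_, .pop τ (g x), fun y => ?_, fun y hy => Function.update_of_ne (hy x).symm _ _⟩
    simp [Function.update_apply, hg.eq_iff, h]
  | emitH σ p x y =>
    refine ⟨τ, ?_, h, fun _ _ => rfl⟩
    rw [List.map_singleton, Gate.map, ← wireAt_relocate h]
    exact .emitH τ _ _ _
  | emitT σ p x y =>
    refine ⟨τ, ?_, h, fun _ _ => rfl⟩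
    rw [List.map_singleton, Gate.map, ← wireAt_relocate h]
    exact .emitT τ _ _ _
  | emitCNOT σ p x y q u v =>
    refine ⟨τ, ?_, h, fun _ _ => rfl⟩
    rw [List.map_singleton, Gate.map, ← wireAt_relocate h, ← wireAt_relocate h]
    exact .emitCNOT τ _ _ _ _ _ _
  | seq _ _ ih₁ ih₂ =>
    obtain ⟨τ₁, e₁, h₁, k₁⟩ := ih₁ τ h
    obtain ⟨τ₂, e₂, h₂, k₂⟩ := ih₂ τ₁ h₁
    refine ⟨τ₂, ?_, h₂, fun y hy => (k₂ y hy).trans (k₁ y hy)⟩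
    rw [List.map_append]
    exact .seq e₁ e₂
  | iteTrue hc _ ih =>
    obtain ⟨τ₁, e₁, h₁, k₁⟩ := ih τ h
    exact ⟨τ₁, .iteTrue ((Test.holds_relocate h _).2 hc) e₁, h₁, k₁⟩
  | iteFalse hc _ ih =>
    obtain ⟨τ₁, e₁, h₁, k₁⟩ := ih τ h
    exact ⟨τ₁, .iteFalse (fun hc' => hc ((Test.holds_relocate h _).1 hc')) e₁, h₁, k₁⟩
  | whileTrue hc _ _ ih₁ ih₂ =>
    obtain ⟨τ₁, e₁, h₁, k₁⟩ := ih₁ τ h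
    obtain ⟨τ₂, e₂, h₂, k₂⟩ := ih₂ τ₁ h₁
    refine ⟨τ₂, ?_, h₂, fun y hy => (k₂ y hy).trans (k₁ y hy)⟩
    rw [List.map_append]
    exact .whileTrue ((Test.holds_relocate h _).2 hc) e₁ e₂
  | whileFalse hc =>
    exact ⟨τ, .whileFalse (fun hc' => hc ((Test.holds_relocate h _).1 hc')), h, fun _ _ => rfl⟩

/-- One step pushes at most one bit. -/
theorem Exec.length_le {P : Program} {σ σ' : Store} {C : List Gate} {t : ℕ}
    (hP : Exec P σ C t σ') (x : ℕ) : (σ' x).length ≤ (σ x).length + t := by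
  induction hP with
  | push σ y b =>
    by_cases h : x = y
    · subst h; simp
    · simp [Function.update_of_ne h]
  | pop σ y =>
    by_cases h : x = y
    · subst h; simp; omega
    · simp [Function.update_of_ne h]
  | _ => omega

/-! ## Polynomially bounded functions -/

def PolyBounded (f : ℕ → ℕ) : Prop := ∃ p : Polynomial ℕ, ∀ κ, f κ ≤ p.eval κ

namespace PolyBounded

theorem const (c : ℕ) : PolyBounded fun _ => c := ⟨Polynomial.C c, by simp⟩

theorem id : PolyBounded fun κ => κ := ⟨Polynomial.X, by simp⟩

theorem add {f g : ℕ → ℕ} (hf : PolyBounded f) (hg : PolyBounded g) :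
    PolyBounded fun κ => f κ + g κ := by
  obtain ⟨p, hp⟩ := hf
  obtain ⟨q, hq⟩ := hg
  exact ⟨p + q, fun κ => by rw [Polynomial.eval_add]; exact add_le_add (hp κ) (hq κ)⟩

theorem mul {f g : ℕ → ℕ} (hf : PolyBounded f) (hg : PolyBounded g) :
    PolyBounded fun κ => f κ * g κ := by
  obtain ⟨p, hp⟩ := hf
  obtain ⟨q, hq⟩ := hg
  exact ⟨p * q, fun κ => by rw [Polynomial.eval_mul]; exact Nat.mul_le_mul (hp κ) (hq κ)⟩

theorem mono {f g : ℕ → ℕ} (hg : PolyBounded g) (h : ∀ κ, f κ ≤ g κ) : PolyBounded f := by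
  obtain ⟨q, hq⟩ := hg
  exact ⟨q, fun κ => (h κ).trans (hq κ)⟩

end PolyBounded

/-- The unary result is a stack that starts with `κ` bits and grows by at most one bit per step. -/
theorem PolyTimeLength.polyBounded {f : ℕ → ℕ} (hf : PolyTimeLength f) : PolyBounded f := by
  obtain ⟨P, p, h⟩ := hf
  refine (PolyBounded.add .id ⟨p, fun _ => le_rfl⟩).mono fun κ => ?_
  obtain ⟨t, σ, hP, ht, hσ⟩ := h κ
  have := hP.length_le 0
  simp only [hσ, inputStore, if_true, List.length_replicate] at this
  omega

/-! ## Stores with unary main variables -/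

/-- The store in which the main variable `Nat.pair 0 x` holds `1^(u x)` and all other variables have
the contents given by `τ`. -/
def mainStore (u : ℕ → ℕ) (τ : Store) : Store := fun v =>
  if v.unpair.1 = 0 then List.replicate (u v.unpair.2) true else τ v

theorem mainStore_main (u : ℕ → ℕ) (τ : Store) (x : ℕ) :
    mainStore u τ (Nat.pair 0 x) = List.replicate (u x) true := by
  simp [mainStore]

theorem mainStore_of_ne {v : ℕ} (hv : v.unpair.1 ≠ 0) (u : ℕ → ℕ) (τ : Store) :
    mainStore u τ v = τ v := by
  simp [mainStore, hv]

theorem update_mainStore_main (u : ℕ → ℕ) (τ : Store) (x m : ℕ) :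
    Function.update (mainStore u τ) (Nat.pair 0 x) (List.replicate m true) =
      mainStore (Function.update u x m) τ := by
  funext v
  by_cases hv : v = Nat.pair 0 x
  · subst hv
    simp [mainStore]
  · rw [Function.update_of_ne hv]
    by_cases h0 : v.unpair.1 = 0
    · have : v.unpair.2 ≠ x := fun h => hv (by rw [← Nat.pair_unpair v, h0, h])
      simp [mainStore, h0, Function.update_of_ne this]
    · simp [mainStore, h0]

theorem update_mainStore_of_ne {v : ℕ} (hv : v.unpair.1 ≠ 0) (u : ℕ → ℕ) (τ : Store)
    (l : List Bool) :
    Function.update (mainStore u τ) v l = mainStore u (Function.update τ v l) := by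
  funext w
  by_cases hw : w = v
  · subst hw
    simp [mainStore, hv]
  · simp [mainStore, Function.update_of_ne hw]

theorem eq_mainStore {u : ℕ → ℕ} {σ : Store}
    (h : ∀ x, σ (Nat.pair 0 x) = List.replicate (u x) true) : σ = mainStore u σ := by
  funext v
  by_cases h0 : v.unpair.1 = 0
  · rw [← Nat.pair_unpair v, h0, h, mainStore_main]
  · rw [mainStore_of_ne h0]

theorem exec_push_main {u v : ℕ → ℕ} {x : ℕ} (h : v = Function.update u x (u x + 1)) (τ : Store) :
    Exec (.push (Nat.pair 0 x) true) (mainStore u τ) [] 1 (mainStore v τ) := by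
  have := Exec.push (mainStore u τ) (Nat.pair 0 x) true
  rwa [mainStore_main, ← List.replicate_succ, update_mainStore_main, ← h] at this

theorem exec_pop_main {u v : ℕ → ℕ} {x : ℕ} (h : v = Function.update u x (u x - 1)) (τ : Store) :
    Exec (.pop (Nat.pair 0 x)) (mainStore u τ) [] 1 (mainStore v τ) := by
  have := Exec.pop (mainStore u τ) (Nat.pair 0 x)
  rwa [mainStore_main, List.tail_replicate, update_mainStore_main, ← h] at this

theorem holds_nonempty_main (u : ℕ → ℕ) (τ : Store) (x : ℕ) :
    (Test.nonempty (Nat.pair 0 x)).holds (mainStore u τ) ↔ u x ≠ 0 := by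
  simp [Test.holds, mainStore_main]

theorem wireAt_main (u : ℕ → ℕ) (τ : Store) (p x y : ℕ) :
    wireAt (mainStore u τ) p (Nat.pair 0 x) (Nat.pair 0 y) = (p, u x, u y) := by
  simp [wireAt, mainStore_main]

/-! ## Loops -/

/-- `σ j` is the store after `j` rounds. Each of the `m` rounds takes `T` steps and a test; the
final `1` is the failed test. -/
theorem exec_while {c : Test} {B : Program} {T : ℕ} (m : ℕ) (σ : ℕ → Store)
    (E : ℕ → List Gate) (h : ∀ j < m, c.holds (σ j) ∧ Exec B (σ j) (E j) T (σ (j + 1)))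
    (hm : ¬ c.holds (σ m)) :
    Exec (.while c B) (σ 0) ((List.range m).flatMap E) (m * (T + 1) + 1) (σ m) := by
  induction m generalizing σ E with
  | zero => simpa using Exec.whileFalse hm
  | succ m ih =>
    have h0 := h 0 (by omega)
    have := ih (fun j => σ (j + 1)) (fun j => E (j + 1)) (fun j hj => h (j + 1) (by omega)) hm
    rw [List.range_succ_eq_map, List.flatMap_cons, List.flatMap_map]
    have ht : (m + 1) * (T + 1) + 1 = T + (m * (T + 1) + 1) + 1 := by ring
    rw [ht]
    exact .whileTrue h0.1 h0.2 this

/-- The contents of the main variables in a `for` loop with counter `c` and scratch variable `t`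
in which `a` and `b` are incremented. -/
def loopState (u : ℕ → ℕ) (c t a b i j : ℕ) : ℕ → ℕ := fun s =>
  if s = c then u c - i else if s = t then i else if s = a then u a + j
  else if s = b then u b + j else u s

/-- Run `B` once for each bit in the main variable `c`, where the main variables `a` and `b` are
incremented after each round, and restore all main variables at the end. -/
def forProgram (c t a b : ℕ) (B : Program) : Program :=
  .seq
    (.while (.nonempty (Nat.pair 0 c)) (.seq (.pop (Nat.pair 0 c)) (.seq (.push (Nat.pair 0 t) true)
      (.seq B (.seq (.push (Nat.pair 0 a) true) (.push (Nat.pair 0 b) true))))))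
    (.while (.nonempty (Nat.pair 0 t)) (.seq (.pop (Nat.pair 0 t)) (.seq (.push (Nat.pair 0 c) true)
      (.seq (.pop (Nat.pair 0 a)) (.pop (Nat.pair 0 b))))))

/-- A round consists of four stack operations and a test, with `T` steps for the body in the first
loop only. Each loop ends with one failed test. -/
def forTime (m T : ℕ) : ℕ := (m * (T + 5) + 1) + (m * 5 + 1)

/-- The first loop drains the counter into `t`; the second refills it from `t` and undoes the
increments. In round `j` the body sees `loopState` with `j + 1` and `j`, because the counter has
already been decremented while `a` and `b` have not yet been incremented. -/
theorem exec_forProgram {c t a b : ℕ} (hct : c ≠ t) (hca : c ≠ a) (hcb : c ≠ b) (hta : t ≠ a)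
    (htb : t ≠ b) (hab : a ≠ b) {B : Program} {u : ℕ → ℕ} (τ : Store) (hu : u t = 0)
    (E : ℕ → List Gate) {T : ℕ}
    (hB : ∀ j < u c, Exec B (mainStore (loopState u c t a b (j + 1) j) τ) (E j) T
      (mainStore (loopState u c t a b (j + 1) j) τ)) :
    Exec (forProgram c t a b B) (mainStore u τ) ((List.range (u c)).flatMap E)
      (forTime (u c) T) (mainStore u τ) := by
  have h0 : loopState u c t a b 0 0 = u := by
    funext s
    simp only [loopState]
    split_ifs <;> simp_all
  have first : Exec (.while (.nonempty (Nat.pair 0 c)) (.seq (.pop (Nat.pair 0 c))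
      (.seq (.push (Nat.pair 0 t) true) (.seq B (.seq (.push (Nat.pair 0 a) true)
        (.push (Nat.pair 0 b) true)))))) (mainStore (loopState u c t a b 0 0) τ)
      ((List.range (u c)).flatMap E) (u c * (T + 4 + 1) + 1)
      (mainStore (loopState u c t a b (u c) (u c)) τ) := by
    refine exec_while (u c) (fun j => mainStore (loopState u c t a b j j) τ) E ?_ ?_
    · intro j hj
      refine ⟨(holds_nonempty_main _ _ _).2 (by simp [loopState]; omega), ?_⟩
      have e₁ := exec_pop_main (u := loopState u c t a b j j) (x := c) rfl τ
      have e₂ := exec_push_main (u := Function.update (loopState u c t a b j j) c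
          (loopState u c t a b j j c - 1)) (x := t)
        (v := loopState u c t a b (j + 1) j) (by
        funext s
        simp only [loopState, Function.update_apply]
        split_ifs <;> omega) τ
      have e₃ := exec_push_main (u := loopState u c t a b (j + 1) j) (x := a) rfl τ
      have e₄ := exec_push_main (u := Function.update (loopState u c t a b (j + 1) j) a
          (loopState u c t a b (j + 1) j a + 1)) (x := b)
        (v := loopState u c t a b (j + 1) (j + 1)) (by
        funext s
        simp only [loopState, Function.update_apply]
        split_ifs <;> omega) τ
      have := Exec.seq e₁ (Exec.seq e₂ (Exec.seq (hB j hj) (Exec.seq e₃ e₄)))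
      simp only [List.nil_append, List.append_nil] at this
      convert this using 1
      ring
    · simp [holds_nonempty_main, loopState]
  -- The same family of stores is traversed backwards, from `u c` rounds to none.
  have second : Exec (.while (.nonempty (Nat.pair 0 t)) (.seq (.pop (Nat.pair 0 t))
      (.seq (.push (Nat.pair 0 c) true) (.seq (.pop (Nat.pair 0 a)) (.pop (Nat.pair 0 b))))))
      (mainStore (loopState u c t a b (u c - 0) (u c - 0)) τ)
      ((List.range (u c)).flatMap fun _ => []) (u c * (4 + 1) + 1)
      (mainStore (loopState u c t a b (u c - u c) (u c - u c)) τ) := by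
    refine exec_while (u c)
      (fun j => mainStore (loopState u c t a b (u c - j) (u c - j)) τ) (fun _ => []) ?_ ?_
    · intro j hj
      refine ⟨(holds_nonempty_main _ _ _).2 (by simp [loopState, hct.symm]; omega), ?_⟩
      have e₁ := exec_pop_main (u := loopState u c t a b (u c - j) (u c - j)) (x := t) rfl τ
      have e₂ := exec_push_main
        (u := Function.update (loopState u c t a b (u c - j) (u c - j)) t
          (loopState u c t a b (u c - j) (u c - j) t - 1)) (x := c)
        (v := loopState u c t a b (u c - (j + 1)) (u c - j)) (by
        funext s
        simp only [loopState, Function.update_apply]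
        split_ifs <;> omega) τ
      have e₃ := exec_pop_main (u := loopState u c t a b (u c - (j + 1)) (u c - j)) (x := a) rfl τ
      have e₄ := exec_pop_main
        (u := Function.update (loopState u c t a b (u c - (j + 1)) (u c - j)) a
          (loopState u c t a b (u c - (j + 1)) (u c - j) a - 1)) (x := b)
        (v := loopState u c t a b (u c - (j + 1)) (u c - (j + 1))) (by
        funext s
        simp only [loopState, Function.update_apply]
        split_ifs <;> omega) τ
      exact Exec.seq e₁ (Exec.seq e₂ (Exec.seq e₃ e₄))
    · simp [holds_nonempty_main, loopState, hct.symm]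
  simp only [Nat.sub_zero, Nat.sub_self, h0] at first second
  have := Exec.seq first second
  have hnil : ((List.range (u c)).flatMap fun _ => ([] : List Gate)) = [] := by simp
  rw [hnil, List.append_nil] at this
  exact this

/-! ## Copying main variables to the variables of a subroutine -/

/-- Copy the main variable `s` to the variable `v`, using the main variable `2` as scratch space. -/
def feedProgram (s v : ℕ) : Program :=
  .seq
    (.while (.nonempty (Nat.pair 0 s)) (.seq (.pop (Nat.pair 0 s))
      (.seq (.push (Nat.pair 0 2) true) (.push v true))))
    (.while (.nonempty (Nat.pair 0 2)) (.seq (.pop (Nat.pair 0 2)) (.push (Nat.pair 0 s) true)))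

theorem exec_push_of_ne {v : ℕ} (hv : v.unpair.1 ≠ 0) (u : ℕ → ℕ) (τ : Store) (b : Bool) :
    Exec (.push v b) (mainStore u τ) [] 1 (mainStore u (Function.update τ v (b :: τ v))) := by
  have := Exec.push (mainStore u τ) v b
  rwa [mainStore_of_ne hv, update_mainStore_of_ne hv] at this

theorem exec_pop_of_ne {v : ℕ} (hv : v.unpair.1 ≠ 0) (u : ℕ → ℕ) (τ : Store) :
    Exec (.pop v) (mainStore u τ) [] 1 (mainStore u (Function.update τ v (τ v).tail)) := by
  have := Exec.pop (mainStore u τ) v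
  rwa [mainStore_of_ne hv, update_mainStore_of_ne hv] at this

theorem flatMap_nil {α β : Type*} (l : List α) : (l.flatMap fun _ => ([] : List β)) = [] := by
  simp

/-- Reading a stack destroys it, so `s` is emptied into both `v` and the scratch variable and is
then restored from the latter. -/
theorem exec_feedProgram {s v : ℕ} (hs : s ≠ 2) (hv : v.unpair.1 ≠ 0) {u : ℕ → ℕ} (hu : u 2 = 0)
    {τ : Store} (hτ : τ v = []) :
    Exec (feedProgram s v) (mainStore u τ) [] ((u s * 4 + 1) + (u s * 3 + 1))
      (mainStore u (Function.update τ v (List.replicate (u s) true))) := by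
  have first := exec_while (c := .nonempty (Nat.pair 0 s))
    (B := .seq (.pop (Nat.pair 0 s)) (.seq (.push (Nat.pair 0 2) true) (.push v true)))
    (T := 3) (u s)
    (fun j => mainStore (Function.update (Function.update u s (u s - j)) 2 j)
      (Function.update τ v (List.replicate j true))) (fun _ => []) (by
      intro j hj
      refine ⟨(holds_nonempty_main _ _ _).2 (by simp [hs]; omega), ?_⟩
      have e₁ := exec_pop_main (u := Function.update (Function.update u s (u s - j)) 2 j) (x := s)
        rfl (Function.update τ v (List.replicate j true))
      have e₂ := exec_push_main (u := Function.update (Function.update (Function.update u s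
        (u s - j)) 2 j) s (Function.update (Function.update u s (u s - j)) 2 j s - 1)) (x := 2)
        (v := Function.update (Function.update u s (u s - (j + 1))) 2 (j + 1)) (by
          funext x
          simp only [Function.update_apply]
          split_ifs <;> omega) (Function.update τ v (List.replicate j true))
      have e₃ := exec_push_of_ne hv (Function.update (Function.update u s (u s - (j + 1))) 2 (j + 1))
        (Function.update τ v (List.replicate j true)) true
      rw [Function.update_idem, Function.update_self, ← List.replicate_succ] at e₃
      exact .seq e₁ (.seq e₂ e₃))
    (by simp [holds_nonempty_main, hs])
  have second := exec_while (c := .nonempty (Nat.pair 0 2))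
    (B := .seq (.pop (Nat.pair 0 2)) (.push (Nat.pair 0 s) true))
    (T := 2) (u s)
    (fun j => mainStore (Function.update (Function.update u s j) 2 (u s - j))
      (Function.update τ v (List.replicate (u s) true))) (fun _ => []) (by
      intro j hj
      refine ⟨(holds_nonempty_main _ _ _).2 (by simp; omega), ?_⟩
      have e₁ := exec_pop_main (u := Function.update (Function.update u s j) 2 (u s - j)) (x := 2)
        rfl (Function.update τ v (List.replicate (u s) true))
      have e₂ := exec_push_main (u := Function.update (Function.update (Function.update u s
        j) 2 (u s - j)) 2 (Function.update (Function.update u s j) 2 (u s - j) 2 - 1)) (x := s)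
        (v := Function.update (Function.update u s (j + 1)) 2 (u s - (j + 1))) (by
          funext x
          simp only [Function.update_apply]
          split_ifs <;> omega) (Function.update τ v (List.replicate (u s) true))
      exact .seq e₁ e₂)
    (by simp [holds_nonempty_main])
  rw [flatMap_nil] at first second
  have h₁ : Function.update (Function.update u s (u s - 0)) 2 0 = u := by
    funext x
    simp only [Function.update_apply]
    split_ifs <;> simp_all
  have h₂ : Function.update (Function.update u s (u s)) 2 (u s - u s) = u := by
    funext x
    simp only [Function.update_apply]
    split_ifs <;> simp_all
  have h₃ : Function.update τ v (List.replicate 0 true) = τ := by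
    rw [List.replicate_zero, ← hτ, Function.update_eq_self]
  have h₄ : Function.update (Function.update u s (u s - u s)) 2 (u s) =
      Function.update (Function.update u s 0) 2 (u s - 0) := by simp
  simp only [h₁, h₂, h₃, h₄] at first second
  exact .seq first second

/-! ## Parts of programs that print circuits -/

/-- There is a polynomial-time program that, started in a store with `pre`, ends in a store with
`post` and prints a circuit with `E`. -/
def Compiles {n : ℕ → ℕ} (pre : ∀ κ, Fin (n κ) → Store → Prop)
    (E : ∀ κ, Fin (n κ) → List Gate → Prop) (post : ∀ κ, Fin (n κ) → Store → Prop) : Prop :=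
  ∃ (P : Program) (T : ℕ → ℕ), PolyBounded T ∧ ∀ κ i σ, pre κ i σ →
    ∃ C t σ', Exec P σ C t σ' ∧ t ≤ T κ ∧ E κ i C ∧ post κ i σ'

/-- The main variables have contents `u`, and the variables of all spaces from `k` on are empty. -/
def Ready {n : ℕ → ℕ} (u : ∀ κ, Fin (n κ) → ℕ → ℕ) (k : ℕ) (κ : ℕ) (i : Fin (n κ)) (σ : Store) :
    Prop :=
  ∃ τ, σ = mainStore (u κ i) τ ∧ ∀ k' ≥ k, ∀ x, τ (Nat.pair k' x) = []

namespace Compiles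

variable {n : ℕ → ℕ} {pre mid post : ∀ κ, Fin (n κ) → Store → Prop}
  {E E' : ∀ κ, Fin (n κ) → List Gate → Prop}

theorem seq (h : Compiles pre E mid) (h' : Compiles mid E' post) :
    Compiles pre (fun κ i C => ∃ C₁ C₂, E κ i C₁ ∧ E' κ i C₂ ∧ C = C₁ ++ C₂) post := by
  obtain ⟨P, T, hT, hP⟩ := h
  obtain ⟨P', T', hT', hP'⟩ := h'
  refine ⟨.seq P P', _, hT.add hT', fun κ i σ hσ => ?_⟩
  obtain ⟨C, t, σ', e, ht, hE, hσ'⟩ := hP κ i σ hσ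
  obtain ⟨C', t', σ'', e', ht', hE', hσ''⟩ := hP' κ i σ' hσ'
  exact ⟨C ++ C', t + t', σ'', .seq e e', add_le_add ht ht', ⟨C, C', hE, hE', rfl⟩, hσ''⟩

theorem mono (h : Compiles pre E post) (hE : ∀ κ i C, E κ i C → E' κ i C) :
    Compiles pre E' post := by
  obtain ⟨P, T, hT, hP⟩ := h
  refine ⟨P, T, hT, fun κ i σ hσ => ?_⟩
  obtain ⟨C, t, σ', e, ht, hC, hσ'⟩ := hP κ i σ hσ
  exact ⟨C, t, σ', e, ht, hE κ i C hC, hσ'⟩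

end Compiles

/-- Print `xorGates p r (u y₀) q (u y₁) (u c) (u l)`, where `r` is the identity if `par` holds and
`0` otherwise. -/
def xorProgram (p y₀ q y₁ c l : ℕ) (par : Bool) : Program :=
  forProgram c 3 (if par then 4 else 6) 5 (forProgram l 2 y₀ y₁
    (.emitCNOT p (Nat.pair 0 4) (Nat.pair 0 y₀) q (Nat.pair 0 5) (Nat.pair 0 y₁)))

/-- Variables `4` and `5` are the block indices of source and target, and `y₀` and `y₁` are
positions advanced by the inner loop. Without `par`, the dummy variable `6` is incremented instead
of `4`, so all blocks are read from source block zero. -/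
theorem exec_xorProgram {p y₀ q y₁ c l : ℕ} (par : Bool) (hy₀ : 6 < y₀) (hy₁ : 6 < y₁)
    (hc : 6 < c) (hl : 6 < l) (hy : y₀ ≠ y₁) (hyl : y₀ ≠ l) (hyl' : y₁ ≠ l) (hyc : y₀ ≠ c)
    (hyc' : y₁ ≠ c) (hcl : c ≠ l) {u : ℕ → ℕ} (τ : Store) (hu : ∀ x, 2 ≤ x → x ≤ 6 → u x = 0) :
    Exec (xorProgram p y₀ q y₁ c l par) (mainStore u τ)
      (xorGates p (fun i => if par then i else 0) (u y₀) q (u y₁) (u c) (u l))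
      (forTime (u c) (forTime (u l) 1)) (mainStore u τ) := by
  have h6 : (if par then 4 else 6) = 4 ∨ (if par then 4 else 6) = 6 := by cases par <;> simp
  refine exec_forProgram (by omega) (by omega) (by omega) (by omega) (by omega) (by omega) τ
    (hu 3 (by omega) (by omega)) _ fun i hi => ?_
  generalize hv : loopState u c 3 (if par then 4 else 6) 5 (i + 1) i = v
  have hval : ∀ s, v s = loopState u c 3 (if par then 4 else 6) 5 (i + 1) i s := by simp [hv]
  have v2 : v 2 = 0 := by
    rw [hval, loopState, if_neg (by omega), if_neg (by omega), if_neg (by omega),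
      if_neg (by omega), hu 2 (by omega) (by omega)]
  have vbig : ∀ s, 6 < s → s ≠ c → v s = u s := by
    intro s hs hsc
    rw [hval, loopState, if_neg (by omega), if_neg (by omega), if_neg (by omega),
      if_neg (by omega)]
  have v4 : v 4 = if par then i else 0 := by
    have := hu 4 (by omega) (by omega)
    rw [hval, loopState, if_neg (by omega), if_neg (by omega)]
    cases par <;> simp [this]
  have v5 : v 5 = i := by
    have := hu 5 (by omega) (by omega)
    rw [hval, loopState, if_neg (by omega), if_neg (by omega), if_neg (by omega),
      if_pos rfl, this, zero_add]
  have := exec_forProgram (c := l) (t := 2) (a := y₀) (b := y₁)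
    (B := .emitCNOT p (Nat.pair 0 4) (Nat.pair 0 y₀) q (Nat.pair 0 5) (Nat.pair 0 y₁))
    (by omega) (by omega) (by omega) (by omega) (by omega) hy τ v2
    (fun j => [.CNOT (p, v 4, v y₀ + j) (q, v 5, v y₁ + j)]) (T := 1) (by
      intro j hj
      have := Exec.emitCNOT (mainStore (loopState v l 2 y₀ y₁ (j + 1) j) τ) p (Nat.pair 0 4)
        (Nat.pair 0 y₀) q (Nat.pair 0 5) (Nat.pair 0 y₁)
      rw [wireAt_main, wireAt_main] at this
      convert this using 3
      · simp only [loopState]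
        congr 2 <;> split_ifs <;> omega
      · simp only [loopState]
        congr 2 <;> split_ifs <;> omega)
  rw [vbig l hl (by omega), vbig y₀ hy₀ hyc, vbig y₁ hy₁ hyc', v4, v5] at this
  rw [← List.map_eq_flatMap] at this
  exact this

/-- Variable `6` is the constant block index zero, `7` counts the position, and `8` merely absorbs
the second increment of the loop. -/
theorem exec_hadamardProgram {l : ℕ} (hl : 9 < l) {u : ℕ → ℕ} (τ : Store)
    (hu : ∀ x, 2 ≤ x → x ≤ 8 → u x = 0) :
    Exec (forProgram l 2 7 8 (.emitH 0 (Nat.pair 0 6) (Nat.pair 0 7))) (mainStore u τ)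
      ((List.range (u l)).map fun j => .H (0, 0, j)) (forTime (u l) 1) (mainStore u τ) := by
  rw [List.map_eq_flatMap]
  refine exec_forProgram (by omega) (by omega) (by omega) (by omega) (by omega) (by omega) τ
    (hu 2 (by omega) (by omega)) _ fun j hj => ?_
  have := Exec.emitH (mainStore (loopState u l 2 7 8 (j + 1) j) τ) 0 (Nat.pair 0 6) (Nat.pair 0 7)
  rw [wireAt_main] at this
  convert this using 3
  · have h6 := hu 6 (by omega) (by omega)
    have h7 := hu 7 (by omega) (by omega)
    simp only [loopState]
    congr 2 <;> split_ifs <;> omega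

/-! ## Compiling calls and blocks -/

theorem forTime_polyBounded {f g : ℕ → ℕ} (hf : PolyBounded f) (hg : PolyBounded g) :
    PolyBounded fun κ => forTime (f κ) (g κ) :=
  ((hf.mul (hg.add (.const 5))).add (.const 1)).add ((hf.mul (.const 5)).add (.const 1))

theorem unpair_pair_ne {k : ℕ} (hk : 1 ≤ k) (x : ℕ) : (Nat.pair k x).unpair.1 ≠ 0 := by
  simp; omega

theorem pair_injective (k : ℕ) : Function.Injective (Nat.pair k) := fun _ _ h =>
  (Nat.pair_eq_pair.1 h).2

/-- Run a subroutine in space `k` on an input that is already there. -/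
theorem Exec.call {P : Program} {σ σ' : Store} {C : List Gate} {t : ℕ} (hP : Exec P σ C t σ')
    (f : ℕ → ℕ) {k : ℕ} (hk : 1 ≤ k) (u : ℕ → ℕ) (τ : Store) (hτ : ∀ x, τ (Nat.pair k x) = σ x) :
    ∃ τ', Exec (P.relocate f (Nat.pair k)) (mainStore u τ) (C.map (Gate.map (portMap f))) t
      (mainStore u τ') ∧ (∀ x, τ' (Nat.pair k x) = σ' x) ∧
      ∀ k' x, k' ≠ k → k' ≠ 0 → τ' (Nat.pair k' x) = τ (Nat.pair k' x) := by
  obtain ⟨τ', e, h, h'⟩ := hP.relocate f (pair_injective k) (mainStore u τ) fun x => by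
    rw [mainStore_of_ne (unpair_pair_ne hk x), hτ]
  have hne : ∀ k' x, k' ≠ k → ∀ y, Nat.pair k y ≠ Nat.pair k' x := fun k' x hk' y h =>
    hk' (Nat.pair_eq_pair.1 h).1.symm
  refine ⟨τ', ?_, h, fun k' x hk' h0 => ?_⟩
  · have := eq_mainStore (u := u) (σ := τ') fun x => by
      rw [h' _ (hne 0 x (by omega)), mainStore_main]
    rwa [← this]
  · rw [h' _ (hne k' x hk'), mainStore_of_ne (by simpa using h0)]

/-- The subroutine runs in the fresh space `k` on a copy of `1^κ`, and its unary result is moved to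
the main variable `d`. Its leftovers are never cleaned up; the next call uses space `k + 1`. -/
theorem Compiles.callLength {n : ℕ → ℕ} {u : ∀ κ, Fin (n κ) → ℕ → ℕ} {k : ℕ} (hk : 1 ≤ k)
    {f : ℕ → ℕ} (hf : PolyTimeLength f) {d : ℕ} (h0 : ∀ κ i, u κ i 0 = κ)
    (h2 : ∀ κ i, u κ i 2 = 0) (hud : ∀ κ i, u κ i d = 0) :
    Compiles (Ready u k) (fun _ _ C => C = [])
      (Ready (fun κ i => Function.update (u κ i) d (f κ)) (k + 1)) := by
  have hfb := hf.polyBounded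
  obtain ⟨P, p, hP⟩ := hf
  refine ⟨.seq (feedProgram 0 (Nat.pair k 0)) (.seq (P.relocate id (Nat.pair k))
    (.while (.nonempty (Nat.pair k 0)) (.seq (.pop (Nat.pair k 0)) (.push (Nat.pair 0 d) true)))),
    fun κ => ((κ * 4 + 1) + (κ * 3 + 1)) + (p.eval κ + (f κ * 3 + 1)),
    (((PolyBounded.id.mul (.const 4)).add (.const 1)).add
      ((PolyBounded.id.mul (.const 3)).add (.const 1))).add
        (.add ⟨p, fun _ => le_rfl⟩ ((hfb.mul (.const 3)).add (.const 1))), ?_⟩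
  rintro κ i _ ⟨τ, rfl, hτ⟩
  obtain ⟨t, σ, hPκ, ht, hσ⟩ := hP κ
  have hk0 := unpair_pair_ne hk 0
  have e₁ := exec_feedProgram (s := 0) (by omega) hk0 (h2 κ i) (hτ k le_rfl 0)
  rw [h0] at e₁
  obtain ⟨τ', e₂, hτ', hτ''⟩ := hPκ.call id hk (u κ i)
    (Function.update τ (Nat.pair k 0) (List.replicate κ true)) (fun x => by
      by_cases hx : x = 0
      · subst hx; simp [inputStore]
      · rw [Function.update_of_ne (fun h => hx (pair_injective k h)), hτ k le_rfl]
        simp [inputStore, hx])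
  have e₃ := exec_while (c := .nonempty (Nat.pair k 0))
    (B := .seq (.pop (Nat.pair k 0)) (.push (Nat.pair 0 d) true)) (T := 2) (f κ)
    (fun j => mainStore (Function.update (u κ i) d j)
      (Function.update τ' (Nat.pair k 0) (List.replicate (f κ - j) true))) (fun _ => []) (by
      intro j hj
      refine ⟨?_, ?_⟩
      · rw [Test.holds, mainStore_of_ne hk0]
        simp; omega
      · have a₁ := exec_pop_of_ne hk0 (Function.update (u κ i) d j)
          (Function.update τ' (Nat.pair k 0) (List.replicate (f κ - j) true))
        rw [Function.update_idem, Function.update_self, List.tail_replicate] at a₁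
        exact .seq a₁ (exec_push_main (by simp) _))
    (by rw [Test.holds, mainStore_of_ne hk0]; simp)
  -- The target variable was empty, so the store before the first round of the moving loop is the
  -- one left by the subroutine.
  have s₁ : Function.update (u κ i) d 0 = u κ i := by rw [← hud κ i, Function.update_eq_self]
  have s₂ : Function.update τ' (Nat.pair k 0) (List.replicate (f κ - 0) true) = τ' := by
    rw [Nat.sub_zero, ← hσ, ← hτ', Function.update_eq_self]
  rw [flatMap_nil, s₁, s₂] at e₃
  refine ⟨_, _, _, .seq e₁ (.seq e₂ e₃), by beta_reduce; omega, by simp, _, rfl, fun k' hk' x => ?_⟩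
  have hne : Nat.pair k' x ≠ Nat.pair k 0 := fun h => by
    have := (Nat.pair_eq_pair.1 h).1
    omega
  rw [Function.update_of_ne hne, hτ'' k' x (by omega) (by omega), Function.update_of_ne hne,
    hτ k' (by omega)]

/-- Copying the unary index `i < n κ` takes time proportional to `i`; this is why `n` has to be
polynomially bounded. The circuit is known only to implement the algorithm, so the conclusion is
existential. -/
theorem Compiles.callFamily {n : ℕ → ℕ} {α β γ δ : ℕ → Type}
    [∀ κ, Fintype (α κ)] [∀ κ, DecidableEq (α κ)] [∀ κ, Register (α κ)]
    [∀ κ, Fintype (β κ)] [∀ κ, DecidableEq (β κ)] [∀ κ, Register (β κ)]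
    [∀ κ, Fintype (γ κ)] [∀ κ, Register (γ κ)] [∀ κ, Fintype (δ κ)] [∀ κ, Register (δ κ)]
    {F : ∀ κ, Fin (n κ) → QAlg (α κ) (β κ) (γ κ) (δ κ)} (hF : IsQPTFamily F)
    (hn : PolyBounded n) (f : ℕ → ℕ) {u : ∀ κ, Fin (n κ) → ℕ → ℕ} {k : ℕ} (hk : 1 ≤ k)
    (h0 : ∀ κ i, u κ i 0 = κ) (h1 : ∀ κ i, u κ i 1 = i) (h2 : ∀ κ i, u κ i 2 = 0) :
    Compiles (Ready u k)
      (fun κ i C => ∃ C₀, Implements C₀ (F κ i) ∧ C = C₀.map (Gate.map (portMap f)))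
      (Ready u (k + 1)) := by
  obtain ⟨P, p, hP⟩ := hF
  refine ⟨.seq (feedProgram 0 (Nat.pair k 0)) (.seq (feedProgram 1 (Nat.pair k 1))
    (P.relocate f (Nat.pair k))),
    fun κ => ((κ * 4 + 1) + (κ * 3 + 1)) + (((n κ * 4 + 1) + (n κ * 3 + 1)) + p.eval κ),
    (((PolyBounded.id.mul (.const 4)).add (.const 1)).add
      ((PolyBounded.id.mul (.const 3)).add (.const 1))).add
    ((((hn.mul (.const 4)).add (.const 1)).add
      ((hn.mul (.const 3)).add (.const 1))).add ⟨p, fun _ => le_rfl⟩), ?_⟩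
  rintro κ i _ ⟨τ, rfl, hτ⟩
  obtain ⟨C, t, σ, hPκ, ht, hC⟩ := hP κ i
  have hne1 : Nat.pair k 1 ≠ Nat.pair k 0 := fun h => by simpa using pair_injective k h
  have e₁ := exec_feedProgram (s := 0) (by omega) (unpair_pair_ne hk 0) (h2 κ i) (hτ k le_rfl 0)
  have e₂ := exec_feedProgram (s := 1) (by omega) (unpair_pair_ne hk 1) (h2 κ i)
    (τ := Function.update τ (Nat.pair k 0) (List.replicate (u κ i 0) true))
    (by rw [Function.update_of_ne hne1, hτ k le_rfl])
  rw [h0] at e₁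
  rw [h0, h1] at e₂
  obtain ⟨τ', e₃, -, hτ''⟩ := hPκ.call f hk (u κ i)
    (Function.update (Function.update τ (Nat.pair k 0) (List.replicate κ true)) (Nat.pair k 1)
      (List.replicate i true)) (fun x => by
      by_cases hx : x = 0
      · subst hx
        rw [Function.update_of_ne hne1.symm]
        simp [inputStore]
      by_cases hx1 : x = 1
      · subst hx1
        simp [inputStore]
      · rw [Function.update_of_ne (fun h => hx1 (pair_injective k h)),
          Function.update_of_ne (fun h => hx (pair_injective k h)), hτ k le_rfl]
        simp [inputStore, hx, hx1])
  refine ⟨_, _, _, .seq e₁ (.seq e₂ e₃), ?_, ⟨C, hC, by simp⟩, _, rfl, fun k' hk' x => ?_⟩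
  · have := i.isLt.le
    beta_reduce
    omega
  have hne : ∀ y, Nat.pair k' x ≠ Nat.pair k y := fun y h => by
    have := (Nat.pair_eq_pair.1 h).1
    omega
  rw [hτ'' k' x (by omega) (by omega), Function.update_of_ne (hne 1),
    Function.update_of_ne (hne 0), hτ k' (by omega)]

/-- The main variables after the lengths `L` have been computed: the input is in `0` and `1`, the
number one in `9`, and the lengths are in `10`, `11`, …. -/
def layout (κ i : ℕ) (L : List ℕ) (s : ℕ) : ℕ :=
  if s = 0 then κ else if s = 1 then i else if s = 9 then 1
  else if s < 10 then 0 else L.getD (s - 10) 0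

/-- The induction appends on the right: a new length goes to the first unused main variable and is
computed in the first unused space. -/
theorem Compiles.prelude {n : ℕ → ℕ} (fs : List (ℕ → ℕ)) (hfs : ∀ f ∈ fs, PolyTimeLength f) :
    Compiles (n := n) (fun κ i σ => σ = inputStore κ i) (fun _ _ C => C = [])
      (Ready (fun κ i => layout κ i (fs.map fun f => f κ)) (fs.length + 1)) := by
  induction fs using List.reverseRecOn with
  | nil =>
    refine ⟨.push (Nat.pair 0 9) true, fun _ => 1, .const 1, ?_⟩
    rintro κ i _ rfl
    -- The input format fits the layout because `Nat.pair 0 0 = 0` and `Nat.pair 0 1 = 1`.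
    have hin : inputStore κ i =
        mainStore (fun s => if s = 0 then κ else if s = 1 then i else 0) fun _ => [] := by
      funext v
      by_cases hv : v.unpair.1 = 0
      · obtain ⟨x, rfl⟩ : ∃ x, v = Nat.pair 0 x := ⟨v.unpair.2, by rw [← hv, Nat.pair_unpair]⟩
        rw [mainStore_main]
        have h0 : Nat.pair 0 x = 0 ↔ x = 0 := by
          constructor
          · intro h
            exact pair_injective 0 (h.trans (by decide))
          · rintro rfl; decide
        have h1 : Nat.pair 0 x = 1 ↔ x = 1 := by
          constructor
          · intro h
            exact pair_injective 0 (h.trans (by decide))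
          · rintro rfl; decide
        simp only [inputStore, h0, h1]
        split_ifs <;> simp
      · rw [mainStore_of_ne hv]
        have h0 : v ≠ 0 := by rintro rfl; exact hv (by decide)
        have h1 : v ≠ 1 := by rintro rfl; exact hv (by decide)
        simp [inputStore, h0, h1]
    rw [hin]
    refine ⟨_, _, _, exec_push_main (v := layout κ i []) ?_ _, le_rfl, rfl, _, rfl,
      fun _ _ _ => rfl⟩
    funext s
    simp only [layout, Function.update_apply, List.getD_nil]
    split_ifs <;> first | omega | contradiction
  | append_singleton fs f ih =>
    have h1 := ih fun g hg => hfs g (by simp [hg])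
    have h2 := Compiles.callLength (n := n) (u := fun κ i => layout κ i (fs.map fun f => f κ))
      (k := fs.length + 1) (by omega) (hfs f (by simp)) (d := 10 + fs.length)
      (fun κ i => by simp [layout]) (fun κ i => by simp [layout])
      (fun κ i => by
        simp [layout, show 10 + fs.length ≠ 1 by omega, show 10 + fs.length ≠ 9 by omega])
    have h3 := (h1.seq h2).mono (E' := fun _ _ C => C = []) (by
      rintro κ i C ⟨C₁, C₂, rfl, rfl, rfl⟩
      rfl)
    have hu : ∀ κ (i : Fin (n κ)), Function.update (layout κ i (fs.map fun f => f κ))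
        (10 + fs.length) (f κ) = layout κ i ((fs ++ [f]).map fun f => f κ) := by
      intro κ i
      funext s
      by_cases hs : s = 10 + fs.length
      · subst hs
        simp [layout, show 10 + fs.length ≠ 1 by omega, show 10 + fs.length ≠ 9 by omega]
      · rw [Function.update_of_ne hs]
        by_cases hs' : s < 10
        · simp [layout, hs']
        · have : s - 10 ≠ fs.length := by omega
          simp only [layout]
          split_ifs
          · rfl
          · rfl
          · rfl
          rw [List.map_append]
          rcases lt_or_gt_of_ne this with h | h
          · rw [List.getD_append _ _ _ _ (by simpa using h)]
          · rw [List.getD_eq_default _ _ (by simp; omega), List.getD_eq_default _ _ (by simp; omega)]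
    simp only [hu] at h3
    simpa using h3

theorem Compiles.xorBlock {n : ℕ → ℕ} {u : ∀ κ, Fin (n κ) → ℕ → ℕ} {k : ℕ} (p : ℕ) {y₀ : ℕ}
    (q : ℕ) {y₁ c l : ℕ} (par : Bool) (hy₀ : 6 < y₀) (hy₁ : 6 < y₁)
    (hc : 6 < c) (hl : 6 < l) (hy : y₀ ≠ y₁) (hyl : y₀ ≠ l) (hyl' : y₁ ≠ l) (hyc : y₀ ≠ c)
    (hyc' : y₁ ≠ c) (hcl : c ≠ l) (hu : ∀ κ i x, 2 ≤ x → x ≤ 6 → u κ i x = 0) {a b : ℕ → ℕ}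
    (ha : PolyBounded a) (hb : PolyBounded b) (hua : ∀ κ i, u κ i c = a κ)
    (hub : ∀ κ i, u κ i l = b κ) :
    Compiles (Ready u k) (fun κ i C => C = xorGates p (fun i => if par then i else 0) (u κ i y₀) q
      (u κ i y₁) (a κ) (b κ)) (Ready u k) := by
  refine ⟨xorProgram p y₀ q y₁ c l par, fun κ => forTime (a κ) (forTime (b κ) 1),
    forTime_polyBounded ha (forTime_polyBounded hb (.const 1)), ?_⟩
  rintro κ i _ ⟨τ, rfl, hτ⟩
  have := exec_xorProgram (p := p) (q := q) par hy₀ hy₁ hc hl hy hyl hyl' hyc hyc' hcl τ (hu κ i)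
  rw [hua, hub] at this
  exact ⟨_, _, _, this, le_rfl, rfl, τ, rfl, hτ⟩

theorem Compiles.isQPTFamily {n : ℕ → ℕ} {α β γ δ : ℕ → Type}
    [∀ κ, Fintype (α κ)] [∀ κ, DecidableEq (α κ)] [∀ κ, Register (α κ)]
    [∀ κ, Fintype (β κ)] [∀ κ, DecidableEq (β κ)] [∀ κ, Register (β κ)]
    [∀ κ, Fintype (γ κ)] [∀ κ, Register (γ κ)] [∀ κ, Fintype (δ κ)] [∀ κ, Register (δ κ)]
    {F : ∀ κ, Fin (n κ) → QAlg (α κ) (β κ) (γ κ) (δ κ)}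
    {E : ∀ κ, Fin (n κ) → List Gate → Prop} {post : ∀ κ, Fin (n κ) → Store → Prop}
    (h : Compiles (fun κ i σ => σ = inputStore κ i) E post)
    (hE : ∀ κ i C, E κ i C → Implements C (F κ i)) : IsQPTFamily F := by
  obtain ⟨P, T, ⟨p, hp⟩, hP⟩ := h
  refine ⟨P, p, fun κ i => ?_⟩
  obtain ⟨C, t, σ', e, ht, hC, -⟩ := hP κ i _ rfl
  exact ⟨C, t, σ', e, ht.trans (hp κ), hE κ i C hC⟩

/-! ## Computable lengths -/

theorem PolyTimeLength.zero : PolyTimeLength fun _ => 0 := by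
  refine ⟨.while (.nonempty 0) (.pop 0), Polynomial.C 2 * Polynomial.X + 1, fun κ => ?_⟩
  refine ⟨κ * (1 + 1) + 1, Function.update (inputStore κ 0) 0 [], ?_, ?_, by simp⟩
  · have := exec_while (c := .nonempty 0) (B := .pop 0) (T := 1) κ
      (fun j => Function.update (inputStore κ 0) 0 (List.replicate (κ - j) true)) (fun _ => []) (by
        intro j hj
        refine ⟨by simp [Test.holds]; omega, ?_⟩
        have := Exec.pop (Function.update (inputStore κ 0) 0 (List.replicate (κ - j) true)) 0
        rwa [Function.update_idem, Function.update_self, List.tail_replicate] at this)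
      (by simp [Test.holds])
    have h0 : Function.update (inputStore κ 0) 0 (List.replicate (κ - 0) true) =
        inputStore κ 0 := by
      rw [Function.update_eq_self_iff]
      simp [inputStore]
    rw [h0, flatMap_nil] at this
    simpa using this
  · simp; omega

/-- Compute both lengths into the main variables `10` and `11`, erase the input in variable `0`, and
move both results there. -/
theorem PolyTimeLength.add {f g : ℕ → ℕ} (hf : PolyTimeLength f) (hg : PolyTimeLength g) :
    PolyTimeLength fun κ => f κ + g κ := by
  have hfb := hf.polyBounded
  have hgb := hg.polyBounded
  obtain ⟨P, T, ⟨p, hp⟩, hP⟩ := Compiles.prelude (n := fun _ => 1) [f, g] (by simp [hf, hg])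
  obtain ⟨p', hp'⟩ := ((PolyBounded.id.mul (.const 2)).add (.const 1)).add
    ((((hfb.mul (.const 3)).add (.const 1))).add ((hgb.mul (.const 3)).add (.const 1)))
  let move (d : ℕ) : Program :=
    .while (.nonempty (Nat.pair 0 d)) (.seq (.pop (Nat.pair 0 d)) (.push (Nat.pair 0 0) true))
  have move_exec : ∀ (d : ℕ) (hd : d ≠ 0) (u : ℕ → ℕ) (τ : Store), ∃ v, Exec (move d)
      (mainStore u τ) [] (u d * 3 + 1) (mainStore v τ) ∧ v 0 = u 0 + u d ∧
      ∀ x, x ≠ 0 → x ≠ d → v x = u x := by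
    intro d hd u τ
    refine ⟨Function.update (Function.update u d (u d - u d)) 0 (u 0 + u d), ?_, by simp,
      fun x hx hx' => by simp [hx, hx']⟩
    have := exec_while (c := .nonempty (Nat.pair 0 d))
      (B := .seq (.pop (Nat.pair 0 d)) (.push (Nat.pair 0 0) true)) (T := 2) (u d)
      (fun j => mainStore (Function.update (Function.update u d (u d - j)) 0 (u 0 + j)) τ)
      (fun _ => []) (by
        intro j hj
        refine ⟨(holds_nonempty_main _ _ _).2 (by simp [hd]; omega), ?_⟩
        refine .seq (exec_pop_main rfl τ) (exec_push_main ?_ τ)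
        funext x
        simp only [Function.update_apply]
        split_ifs <;> omega) (by simp [holds_nonempty_main, hd])
    have h0 : Function.update (Function.update u d (u d - 0)) 0 (u 0 + 0) = u := by
      simp
    rw [h0, flatMap_nil] at this
    exact this
  refine ⟨.seq P (.seq (.while (.nonempty (Nat.pair 0 0)) (.pop (Nat.pair 0 0)))
    (.seq (move 10) (move 11))), p + p', fun κ => ?_⟩
  obtain ⟨C, t, _, e, ht, rfl, τ, rfl, -⟩ := hP κ 0 _ rfl
  have e₀ := exec_while (c := .nonempty (Nat.pair 0 0)) (B := .pop (Nat.pair 0 0)) (T := 1) κ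
    (fun j => mainStore (Function.update (layout κ 0 [f κ, g κ]) 0 (κ - j)) τ)
    (fun _ => []) (by
      intro j hj
      exact ⟨(holds_nonempty_main _ _ _).2 (by simp; omega), exec_pop_main (by simp [Nat.sub_sub]) τ⟩)
    (by simp [holds_nonempty_main])
  have h0 : Function.update (layout κ 0 [f κ, g κ]) 0 (κ - 0) = layout κ 0 [f κ, g κ] := by
    rw [Function.update_eq_self_iff]
    simp [layout]
  rw [h0, flatMap_nil] at e₀
  obtain ⟨v, e₁, hv, hv'⟩ := move_exec 10 (by omega)
    (Function.update (layout κ 0 [f κ, g κ]) 0 (κ - κ)) τ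
  obtain ⟨w, e₂, hw, -⟩ := move_exec 11 (by omega) v τ
  refine ⟨_, _, .seq e (.seq e₀ (.seq e₁ e₂)), ?_, ?_⟩
  · have h10 : Function.update (layout κ 0 [f κ, g κ]) 0 (κ - κ) 10 = f κ := by simp [layout]
    have h11 : v 11 = g κ := by
      rw [hv' 11 (by omega) (by omega)]
      simp [layout]
    rw [h10, h11, Polynomial.eval_add]
    have h₁ := hp' κ
    have h₂ := hp κ
    beta_reduce at h₁
    omega
  -- The output variable is the main variable zero, as `Nat.pair 0 0` evaluates to `0`.
  · have : mainStore w τ 0 = List.replicate (w 0) true := mainStore_main w τ 0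
    rw [this, hw, hv, hv' 11 (by omega) (by omega)]
    simp [layout]

/-! ## Initial configurations -/

/-- The `j`-th bit of a bit string, `false` if there is none. -/
def bitAt {n : ℕ} (x : Bits n) (j : ℕ) : Bool := if h : j < n then x ⟨j, h⟩ else false

theorem bitAt_of_lt {n : ℕ} (x : Bits n) {j : ℕ} (h : j < n) : bitAt x j = x ⟨j, h⟩ := dif_pos h

theorem bitAt_of_le {n : ℕ} (x : Bits n) {j : ℕ} (h : n ≤ j) : bitAt x j = false :=
  dif_neg (by omega)

theorem bitAt_bitXor {n : ℕ} (x y : Bits n) (j : ℕ) :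
    bitAt (bitXor x y) j = xor (bitAt x j) (bitAt y j) := by
  unfold bitAt bitXor
  split_ifs <;> rfl

theorem initConfig_fin {n : ℕ} (x : Bits n) (p b j : ℕ) :
    initConfig x (p, b, j) = if p = 0 ∧ b = 0 then bitAt x j else false := by
  by_cases h : p = 0 ∧ b = 0 ∧ j < n
  · obtain ⟨rfl, rfl, hj⟩ := h
    rw [if_pos ⟨rfl, rfl⟩, bitAt_of_lt x hj]
    exact initConfig_wire x ⟨j, hj⟩
  · rw [initConfig_of_notMem]
    · split_ifs with h'
      · rw [bitAt_of_le]
        have := h'.1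
        have := h'.2
        omega
      · rfl
    · intro a ha
      simp only [Register.wire, Prod.mk.injEq] at ha
      have := a.isLt
      omega

/-- A sum of registers puts its left summand on even ports and its right summand on odd ports. -/
theorem initConfig_inl {α β : Type} [Register α] [Register β] (x : α → Bool) (y : β → Bool)
    (p : ℕ) (w : ℕ × ℕ) : initConfig (Sum.elim x y) (2 * p, w) = initConfig x (p, w) := by
  by_cases h : ∃ a : α, Register.wire a = (p, w)
  · obtain ⟨a, ha⟩ := h
    have h' : (Register.wire (Sum.inl a : α ⊕ β)) = (2 * p, w) := by simp [Register.wire, ha]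
    rw [← ha, ← h', initConfig_wire, initConfig_wire, Sum.elim_inl]
  · rw [initConfig_of_notMem, initConfig_of_notMem _ (by simpa using h)]
    rintro (a | b) hab
    · simp only [Register.wire, Prod.mk.injEq] at hab
      exact h ⟨a, Prod.ext (by simpa using hab.1) hab.2⟩
    · simp only [Register.wire, Prod.mk.injEq] at hab
      omega

theorem initConfig_inr {α β : Type} [Register α] [Register β] (x : α → Bool) (y : β → Bool)
    (p : ℕ) (w : ℕ × ℕ) : initConfig (Sum.elim x y) (2 * p + 1, w) = initConfig y (p, w) := by
  by_cases h : ∃ b : β, Register.wire b = (p, w)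
  · obtain ⟨b, hb⟩ := h
    have h' : (Register.wire (Sum.inr b : α ⊕ β)) = (2 * p + 1, w) := by simp [Register.wire, hb]
    rw [← hb, ← h', initConfig_wire, initConfig_wire, Sum.elim_inr]
  · rw [initConfig_of_notMem, initConfig_of_notMem _ (by simpa using h)]
    rintro (a | b) hab
    · simp only [Register.wire, Prod.mk.injEq] at hab
      omega
    · simp only [Register.wire, Prod.mk.injEq] at hab
      exact h ⟨b, Prod.ext (by simpa using hab.1) hab.2⟩

theorem eq_iff_agreeOff {β : Type} (w : β → Wire) (z z' : Config) :
    z = z' ↔ AgreeOff w z z' ∧ z ∘ w = z' ∘ w := by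
  constructor
  · rintro rfl
    exact ⟨fun _ _ => rfl, rfl⟩
  · rintro ⟨h, h'⟩
    funext v
    by_cases hv : ∃ b, w b = v
    · obtain ⟨b, rfl⟩ := hv
      exact congrFun h' b
    · exact h v (by simpa using hv)

/-! ## Sampling a uniform bit string -/

/-- Each gate splits a blank wire evenly. In the induction only the branch with the value `a w`
contributes to the amplitude of `a`. -/
theorem circuitUnitary_hadamards_ket (L : List Wire) (hL : L.Nodup) (z : Config)
    (hz : ∀ w ∈ L, z w = false) (a : Config) [Decidable (∀ v, v ∉ L → a v = z v)] :
    circuitUnitary (L.map .H) (ket z) a =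
      if ∀ v, v ∉ L → a v = z v then ((1 / Real.sqrt 2 : ℝ) : ℂ) ^ L.length else 0 := by
  classical
  induction L generalizing z with
  | nil =>
    have : (∀ v, v ∉ ([] : List Wire) → a v = z v) ↔ z = a := by
      simp [funext_iff, eq_comm]
    simp only [this]
    simp [circuitUnitary, ket, Finsupp.single_apply]
  | cons w L ih =>
    rw [List.nodup_cons] at hL
    have hw : z w = false := hz w (by simp)
    have hu : (Gate.H w).unitary (ket z) =
        ((1 / Real.sqrt 2 : ℝ) : ℂ) • (ket (Function.update z w false) +
          ket (Function.update z w true)) := by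
      simp [Gate.unitary, ket, Finsupp.linearCombination_single, Gate.onBasis, hw]
    have hz' : ∀ c : Bool, ∀ v ∈ L, Function.update z w c v = false := by
      intro c v hv
      rw [Function.update_of_ne (by rintro rfl; exact hL.1 hv), hz v (by simp [hv])]
    rw [List.map_cons, circuitUnitary, LinearMap.comp_apply, hu, map_smul, map_add,
      Finsupp.smul_apply, Finsupp.add_apply, ih hL.2 _ (hz' false), ih hL.2 _ (hz' true)]
    have key : ∀ c : Bool, (∀ v, v ∉ L → a v = Function.update z w c v) ↔
        a w = c ∧ ∀ v, v ∉ w :: L → a v = z v := by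
      intro c
      constructor
      · intro h
        refine ⟨by simpa using h w hL.1, fun v hv => ?_⟩
        simp only [List.mem_cons, not_or] at hv
        rw [h v hv.2, Function.update_of_ne hv.1]
      · rintro ⟨h, h'⟩ v hv
        by_cases hvw : v = w
        · subst hvw; simpa using h
        · rw [Function.update_of_ne hvw]
          exact h' v (by simp [hvw, hv])
    simp only [key]
    by_cases h : ∀ v, v ∉ w :: L → a v = z v
    · rw [if_pos h, List.length_cons, pow_succ']
      cases haw : a w
      · rw [if_pos ⟨rfl, h⟩, if_neg (fun h' => by simpa using h'.1), add_zero, smul_eq_mul]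
      · rw [if_neg (fun h' => by simpa using h'.1), if_pos ⟨rfl, h⟩, zero_add, smul_eq_mul]
    · rw [if_neg h, if_neg fun h' => h h'.2, if_neg fun h' => h h'.2, add_zero, smul_zero]

/-- The circuit that prepares `n` qubits in the state `|+⟩`. -/
def uniformGates (n : ℕ) : List Gate := (List.range n).map fun j => .H (0, 0, j)

/-- Without input all wires start blank, so `initConfig y` is the only basis state of the
superposition that reads `y`. Its amplitude `(1/√2)^n` contributes its squared modulus. -/
theorem kern_uniformGates (n : ℕ) {α : Type} [Register α] [IsEmpty α]
    (a a' : α → Bool) (y : Fin n ⊕ Fin 0 → Bool) :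
    kern α (Fin n ⊕ Fin 0) (uniformGates n) a a' y y = 1 / 2 ^ n := by
  classical
  obtain rfl : a = a' := Subsingleton.elim _ _
  let L : List Wire := (List.range n).map fun j => (0, 0, j)
  have hgates : uniformGates n = L.map .H := by simp [uniformGates, L]
  have hmem : ∀ v, v ∈ L ↔ ∃ b : Fin n ⊕ Fin 0, Register.wire b = v := by
    rintro ⟨p, b, j⟩
    simp only [L, List.mem_map, List.mem_range]
    constructor
    · rintro ⟨i, hi, h⟩
      exact ⟨.inl ⟨i, hi⟩, by simpa [Register.wire] using h⟩
    · rintro ⟨i | i, h⟩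
      · exact ⟨i, i.isLt, by simpa [Register.wire] using h⟩
      · exact i.elim0
  have hnodup : L.Nodup := List.Nodup.map (fun a b h => by simpa using h) List.nodup_range
  have hinit : initConfig a = fun _ => false := by
    funext v
    exact initConfig_of_notMem a fun x => isEmptyElim x
  have amp := circuitUnitary_hadamards_ket L hnodup (initConfig a) (by simp [hinit])
  have hlen : L.length = n := by simp [L]
  have hψ : circuitUnitary (uniformGates n) (initialState a) =
      circuitUnitary (L.map .H) (ket (initConfig a)) := by rw [hgates]; rfl
  rw [kern, tracedEntry, hψ, Finsupp.sum, Finset.sum_eq_single (initConfig y)]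
  · have h1 : (fun b => initConfig y (Register.wire b)) = y := funext fun b => initConfig_wire y b
    have h2 : Function.extend Register.wire y (initConfig y) = initConfig y := by
      rw [extend_wire_eq_iff]
      exact ⟨fun _ _ => rfl, h1⟩
    have h3 : ∀ v, v ∉ L → initConfig y v = initConfig a v := by
      intro v hv
      rw [hinit]
      exact initConfig_of_notMem y (by simpa [hmem] using hv)
    rw [if_pos h1, h2, amp, if_pos h3, hlen, map_pow, Complex.conj_ofReal, ← mul_pow,
      ← Complex.ofReal_mul]
    have : (1 / Real.sqrt 2 * (1 / Real.sqrt 2) : ℝ) = 1 / 2 := by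
      rw [div_mul_div_comm, Real.mul_self_sqrt (by norm_num), one_mul]
    rw [this]
    simp
  · intro z hz hne
    rw [if_neg]
    intro h
    apply hne
    rw [Finsupp.mem_support_iff, amp] at hz
    have hz' := (ite_ne_right_iff.1 hz).1
    refine eq_initConfig y z (fun b => congrFun h b) fun v hv => ?_
    rw [hz' v (by rw [hmem]; simpa using hv), hinit]
  · intro h
    rw [Finsupp.notMem_support_iff] at h
    simp [h]

theorem implements_uniformGates (n : ℕ) :
    Implements (uniformGates n)
      (fun _ ρ _ => (1 / 2 ^ n : ℂ) • ρ : QAlg (Fin 0) (Fin 0) (Fin n) (Fin 0)) := by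
  rw [implements_iff]
  intro x ρ y d d'
  obtain rfl : d = d' := Subsingleton.elim _ _
  rw [Fintype.sum_eq_single d fun b hb => absurd (Subsingleton.elim b d) hb,
    Fintype.sum_eq_single d fun b hb => absurd (Subsingleton.elim b d) hb,
    kern_uniformGates]
  simp [mul_comm]

theorem isQPT_uniform {l : ℕ → ℕ} (hl : PolyTimeLength l) :
    IsQPT (fun κ => (fun _ ρ _ => (1 / 2 ^ l κ : ℂ) • ρ : QAlg (Fin 0) (Fin 0) (Fin (l κ)) (Fin 0)))
    := by
  have h₁ := Compiles.prelude (n := fun _ => 1) [l] (by simpa using hl)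
  have h₂ : Compiles (n := fun _ => 1)
      (Ready (fun κ i => layout κ i ([l].map fun f => f κ)) ([l].length + 1))
      (fun κ _ C => C = uniformGates (l κ))
      (Ready (fun κ i => layout κ i ([l].map fun f => f κ)) ([l].length + 1)) := by
    refine ⟨forProgram 10 2 7 8 (.emitH 0 (Nat.pair 0 6) (Nat.pair 0 7)),
      fun κ => forTime (l κ) 1, forTime_polyBounded hl.polyBounded (.const 1), ?_⟩
    rintro κ i _ ⟨τ, rfl, hτ⟩
    have := exec_hadamardProgram (l := 10) (by omega) (u := layout κ i [l κ]) τ (fun x h h' => by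
      simp only [layout]
      split_ifs <;> omega)
    exact ⟨_, _, _, this, by simp [layout], by simp [layout, uniformGates], τ, rfl, hτ⟩
  refine (h₁.seq h₂).isQPTFamily fun κ i C hC => ?_
  obtain ⟨_, _, rfl, rfl, rfl⟩ := hC
  exact implements_uniformGates (l κ)

/-! ## Algorithms on a masked classical input -/

/-- Run `G` on the classical input `c ⊕ x` and a quantum state, where `x` is a classical input and
`c` is measured in the first part of a quantum input. -/
noncomputable def unmask {ι γ : Type} {a b : ℕ} (e : Fin a → ι)
    (G : QAlg (Fin a) (Fin b) γ (Fin 0)) : QAlg ι (Fin (a + b)) γ (Fin 0) := fun x ρ y =>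
  ∑ c : Bits a, G (bitXor c (x ∘ e)) (afterOutcome (unjoin ρ) c) y

/-- Even ports stay in place, odd ports are moved such that the ports `1` and `3` are not used. -/
def evenFixed (p : ℕ) : ℕ := if p % 2 = 0 then p else p + 4

theorem evenFixed_injective : Function.Injective evenFixed := by
  intro p q h
  unfold evenFixed at h
  split_ifs at h <;> omega

/-- The circuit for `unmask e G`, where `C` is a circuit for `G`. -/
def unmaskGates (p₀ a b : ℕ) (C : List Gate) : List Gate :=
  moveGates (2 * p₀) 0 3 0 1 a ++ (xorGates 3 id 0 0 0 1 a ++ (xorGates 1 id 0 0 0 1 a ++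
    (moveGates 1 a 5 0 1 b ++ C.map (Gate.map (portMap evenFixed)))))

theorem overwrite_portMap {f : ℕ → ℕ} (hf : Function.Injective f) (z w : Config) {p q : ℕ}
    (h : f q = p) (x : ℕ × ℕ) : overwrite (portMap f) z w (p, x) = w (q, x) := by
  subst h
  exact overwrite_apply (portMap_injective hf) z w (q, x)

theorem overwrite_portMap_of_ne {f : ℕ → ℕ} (z w : Config) {p : ℕ} (h : ∀ q, f q ≠ p)
    (x : ℕ × ℕ) : overwrite (portMap f) z w (p, x) = z (p, x) :=
  overwrite_apply_of_notMem _ _ fun a ha => h a.1 (Prod.ext_iff.1 ha).1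

section

variable {ι γ : Type} [Register ι] {a b p₀ : ℕ}

/-- Covers both shapes of the classical input at once: a bare register (`p₀ = 0`) and a register
behind an empty left summand (`p₀ = 1`). -/
theorem initConfig_of_block {e : Fin a → ι} (he : Function.Surjective e)
    (hw : ∀ j, Register.wire (e j) = (p₀, 0, (j : ℕ))) (x : ι → Bool) (p i j : ℕ) :
    initConfig x (p, i, j) = if p = p₀ ∧ i = 0 then bitAt (x ∘ e) j else false := by
  by_cases h : p = p₀ ∧ i = 0 ∧ j < a
  · obtain ⟨rfl, rfl, hj⟩ := h
    rw [if_pos ⟨rfl, rfl⟩, bitAt_of_lt _ hj, ← hw ⟨j, hj⟩, initConfig_wire]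
    rfl
  · rw [initConfig_of_notMem]
    · split_ifs with h'
      · rw [bitAt_of_le]
        have := h'.1
        have := h'.2
        omega
      · rfl
    · intro y hy
      obtain ⟨k, rfl⟩ := he y
      rw [hw, Prod.mk.injEq, Prod.mk.injEq] at hy
      have := k.isLt
      omega

/-- The configuration in which `G` is started by `unmaskGates`. -/
noncomputable def unmaskConfig (a b : ℕ) (x : Bits a) (t : Bits (a + b)) : Config := fun w =>
  if w.2.1 = 0 then
    if w.1 = 0 ∧ w.2.2 < a then xor (bitAt t w.2.2) (bitAt x w.2.2)
    else if w.1 = 1 ∧ w.2.2 < a then bitAt t w.2.2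
    else if w.1 = 3 ∧ w.2.2 < a then bitAt x w.2.2
    else if w.1 = 5 ∧ w.2.2 < b then bitAt t (w.2.2 + a)
    else false
  else false

/-- The mask arrives at port `2 * p₀` and the quantum input at port `1`. The mask is parked at port
`3`, which leaves port `0` blank in either case; the mask and `c` are then added there, and the
remaining `b` qubits go to port `5`, where the relocated circuit expects its quantum input. -/
theorem pull_unmaskGates {e : Fin a → ι} (he : Function.Surjective e) (hp : p₀ ≤ 1)
    (hw : ∀ j, Register.wire (e j) = (p₀, 0, (j : ℕ))) (x : ι → Bool) (t t' : Bits (a + b))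
    (C : List Gate) (G : Config → Config → ℂ) :
    pull (unmaskGates p₀ a b C) G (initConfig (Sum.elim x t)) (initConfig (Sum.elim x t')) =
      pull (C.map (Gate.map (portMap evenFixed))) G (unmaskConfig a b (x ∘ e) t)
        (unmaskConfig a b (x ∘ e) t') := by
  have h : ∀ t : Bits (a + b), moveConfig 1 a 5 0 1 b (xorConfig 1 id 0 0 0 1 a
      (xorConfig 3 id 0 0 0 1 a (moveConfig (2 * p₀) 0 3 0 1 a
        (initConfig (Sum.elim x t))))) = unmaskConfig a b (x ∘ e) t := by
    intro t
    have hz : ∀ p i j, initConfig (Sum.elim x t) (p, i, j) =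
        if i = 0 then if p = 2 * p₀ then bitAt (x ∘ e) j else if p = 1 then bitAt t j else false
        else false := by
      intro p i j
      obtain ⟨q, rfl | rfl⟩ := Nat.even_or_odd' p
      · rw [initConfig_inl, initConfig_of_block he hw]
        split_ifs <;> first | rfl | omega
      · rw [initConfig_inr, initConfig_fin]
        split_ifs <;> first | rfl | omega
    generalize initConfig (Sum.elim x t) = z at hz
    have hx : ∀ j, ¬ j < a → bitAt (x ∘ e) j = false := fun j h => bitAt_of_le _ (by omega)
    have ht : ∀ j, ¬ j < b → bitAt t (j + a) = false := fun j h => bitAt_of_le _ (by omega)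
    have ht' : ∀ j, ¬ j < a + b → bitAt t j = false := fun j h => bitAt_of_le _ (by omega)
    funext ⟨p, i, j⟩
    by_cases hi : i = 0
    · subst hi
      -- A finite check over the ports touched by the gates, with one case for all the others.
      obtain rfl | rfl : p₀ = 0 ∨ p₀ = 1 := by omega
      all_goals
        obtain rfl | rfl | rfl | rfl | rfl | hp : p = 0 ∨ p = 1 ∨ p = 2 ∨ p = 3 ∨ p = 5 ∨
          (p ≠ 0 ∧ p ≠ 1 ∧ p ≠ 2 ∧ p ≠ 3 ∧ p ≠ 5) := by omega
        all_goals
          simp [unmaskConfig, moveConfig, xorConfig, InBlocks, Bool.xor_comm, *]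
          try first
            | grind
            | (by_cases hj : j < a <;> simp [hj, hx])
    · have hi' : ¬ i < 1 := by omega
      simp [unmaskConfig, moveConfig, xorConfig, InBlocks, hz, hi, hi']
  rw [unmaskGates, pull_append, pull_moveGates (by omega), pull_append,
    pull_xorGates (by omega), pull_append, pull_xorGates (by omega), pull_append,
    pull_moveGates (by omega), h, h]

/-- The relocated circuit cannot see the copies of `c` and of the mask at ports `1` and `3`, so it
starts from a genuine initial configuration. -/
theorem unmaskConfig_comp (x : Bits a) (t : Bits (a + b)) :
    unmaskConfig a b x t ∘ portMap evenFixed =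
      initConfig (Sum.elim (bitXor (fun j => t (Fin.castAdd b j)) x)
        (fun j => t (Fin.natAdd a j))) := by
  have h1 : ∀ j, bitAt (bitXor (fun j => t (Fin.castAdd b j)) x) j =
      if j < a then xor (bitAt t j) (bitAt x j) else false := by
    intro j
    split_ifs with h
    · rw [bitAt_bitXor, bitAt_of_lt _ h, bitAt_of_lt t (by omega)]
      rfl
    · rw [bitAt_of_le _ (by omega)]
  have h2 : ∀ j, bitAt (fun j => t (Fin.natAdd a j)) j =
      if j < b then bitAt t (j + a) else false := by
    intro j
    split_ifs with h
    · rw [bitAt_of_lt _ h, bitAt_of_lt t (by omega)]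
      congr 1
      ext
      simp [add_comm]
    · rw [bitAt_of_le _ (by omega)]
  funext ⟨p, i, j⟩
  obtain ⟨q, rfl | rfl⟩ := Nat.even_or_odd' p
  · have hp : evenFixed (2 * q) = 2 * q := by simp [evenFixed]
    rw [initConfig_inl, initConfig_fin, h1, Function.comp_apply, portMap, hp]
    simp only [unmaskConfig]
    split_ifs <;> first | rfl | omega
  · have hp : evenFixed (2 * q + 1) = 2 * q + 5 := by simp [evenFixed]
    rw [initConfig_inr, initConfig_fin, h2, Function.comp_apply, portMap, hp]
    have h0 : ¬ 2 * q + 5 = 0 := by omega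
    have h1 : ¬ 2 * q + 5 = 1 := by omega
    have h3 : ¬ 2 * q + 5 = 3 := by omega
    have h5 : 2 * q + 5 = 5 ↔ q = 0 := by omega
    simp only [unmaskConfig, h0, h1, h3, h5, false_and, if_false]
    split_ifs <;> first | rfl | omega

theorem wire_even [Register γ] (c : γ ⊕ Fin 0) :
    portMap evenFixed (Register.wire c) = Register.wire c := by
  rcases c with c | c
  · simp [portMap, evenFixed, Register.wire]
  · exact c.elim0

/-- The copy of `c` that stays behind at port `1` is traced out, which amounts to measuring `c`.
This produces the condition that the first parts of `t` and `t'` are equal. -/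
theorem agreeOff_unmaskConfig [Register γ] (x : Bits a) (t t' : Bits (a + b)) (w w' : Config) :
    AgreeOff (Register.wire : γ ⊕ Fin 0 → Wire)
      (overwrite (portMap evenFixed) (unmaskConfig a b x t) w)
      (overwrite (portMap evenFixed) (unmaskConfig a b x t') w') ↔
    (fun j => t (Fin.castAdd b j)) = (fun j => t' (Fin.castAdd b j)) ∧
      AgreeOff (Register.wire : γ ⊕ Fin 0 → Wire) w w' := by
  have hinj := portMap_injective evenFixed_injective
  have h1 : ∀ q, evenFixed q ≠ 1 := by intro q; unfold evenFixed; split_ifs <;> omega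
  constructor
  · intro h
    refine ⟨?_, fun v hv => ?_⟩
    -- Port `1` is neither reached by the relocated circuit nor part of the output, so agreement
    -- there is agreement on `c`.
    · funext j
      have := h (1, 0, j) fun c hc => by
        rw [← wire_even] at hc
        exact h1 _ (Prod.ext_iff.1 hc).1
      rw [overwrite_portMap_of_ne _ _ h1, overwrite_portMap_of_ne _ _ h1] at this
      simp only [unmaskConfig, if_true, true_and, j.isLt, one_ne_zero, false_and, if_false,
        bitAt_of_lt _ (show (j : ℕ) < a + b by omega)] at this
      exact this
    · have := h (portMap evenFixed v) fun c hc => by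
        rw [← wire_even] at hc
        exact hv c (hinj hc)
      rwa [overwrite_apply hinj, overwrite_apply hinj] at this
  · rintro ⟨h, h'⟩ v hv
    by_cases hvr : ∃ u, portMap evenFixed u = v
    · obtain ⟨u, rfl⟩ := hvr
      rw [overwrite_apply hinj, overwrite_apply hinj]
      exact h' u fun c hc => hv c (by rw [← hc, wire_even])
    · have hvr' : ∀ u, portMap evenFixed u ≠ v := by simpa using hvr
      rw [overwrite_apply_of_notMem _ _ hvr', overwrite_apply_of_notMem _ _ hvr']
      obtain ⟨p, i, j⟩ := v
      have hp : ∀ q, evenFixed q ≠ p := fun q hq => hvr' (q, i, j) (by simp [portMap, hq])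
      have hp0 : p ≠ 0 := fun h => hp 0 (by simp [evenFixed, h])
      have hp5 : p ≠ 5 := fun h => hp 1 (by simp [evenFixed, h])
      simp only [unmaskConfig, hp0, hp5, false_and, if_false]
      split_ifs with h1 h2
      · have := congrFun h ⟨j, h2.2⟩
        rwa [bitAt_of_lt _ (show j < a + b by omega), bitAt_of_lt _ (show j < a + b by omega)]
      · rfl
      · rfl
      · rfl

theorem kern_unmaskGates [Fintype γ] [DecidableEq γ] [Register γ] {e : Fin a → ι}
    (he : Function.Surjective e) (hp : p₀ ≤ 1)
    (hw : ∀ j, Register.wire (e j) = (p₀, 0, (j : ℕ))) (x : ι → Bool) (t t' : Bits (a + b))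
    (C : List Gate) (y y' : γ ⊕ Fin 0 → Bool) :
    kern (ι ⊕ Fin (a + b)) (γ ⊕ Fin 0) (unmaskGates p₀ a b C) (Sum.elim x t) (Sum.elim x t') y y' =
      if (fun j => t (Fin.castAdd b j)) = (fun j => t' (Fin.castAdd b j)) then
        kern (Fin a ⊕ Fin b) (γ ⊕ Fin 0) C
          (Sum.elim (bitXor (fun j => t (Fin.castAdd b j)) (x ∘ e)) (fun j => t (Fin.natAdd a j)))
          (Sum.elim (bitXor (fun j => t' (Fin.castAdd b j)) (x ∘ e)) (fun j => t' (Fin.natAdd a j)))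
          y y'
      else 0 := by
  have hinj := portMap_injective evenFixed_injective
  have hread : ∀ z w : Config, overwrite (portMap evenFixed) z w ∘
      (Register.wire : γ ⊕ Fin 0 → Wire) = w ∘ Register.wire := by
    intro z w
    funext c
    rw [Function.comp_apply, ← wire_even, overwrite_apply hinj]
    rfl
  rw [kern_eq_pull, pull_unmaskGates he hp hw, pull_map hinj, unmaskConfig_comp, unmaskConfig_comp,
    kern_eq_pull]
  by_cases h : (fun j => t (Fin.castAdd b j)) = (fun j => t' (Fin.castAdd b j))
  · rw [if_pos h]
    congr 1
    funext w w'
    have := agreeOff_unmaskConfig (γ := γ) (x ∘ e) t t' w w'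
    unfold loc
    rw [hread, hread]
    by_cases hw : AgreeOff (Register.wire : γ ⊕ Fin 0 → Wire) w w'
    · rw [if_pos (this.2 ⟨h, hw⟩), if_pos hw]
    · rw [if_neg fun h' => hw (this.1 h').2, if_neg hw]
  -- Distinct values of `c` make the pulled-back form vanish identically: the coherences between
  -- them are lost.
  · rw [if_neg h]
    have : (fun w w' => loc (Register.wire : γ ⊕ Fin 0 → Wire)
        (fun x z => if x = y ∧ z = y' then (1 : ℂ) else 0)
        (overwrite (portMap evenFixed) (unmaskConfig a b (x ∘ e) t) w)
        (overwrite (portMap evenFixed) (unmaskConfig a b (x ∘ e) t') w')) = fun _ _ => 0 := by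
      funext w w'
      exact if_neg fun h' => h ((agreeOff_unmaskConfig (γ := γ) (x ∘ e) t t' w w').1 h').1
    rw [this]
    simp [pull, sesq]

theorem implements_unmaskGates [Fintype ι] [DecidableEq ι] [Fintype γ] [DecidableEq γ] [Register γ]
    {e : Fin a → ι}
    (he : Function.Surjective e) (hp : p₀ ≤ 1)
    (hw : ∀ j, Register.wire (e j) = (p₀, 0, (j : ℕ))) {C : List Gate}
    {G : QAlg (Fin a) (Fin b) γ (Fin 0)} (hC : Implements C G) :
    Implements (unmaskGates p₀ a b C) (unmask e G : QAlg ι (Fin (a + b)) γ (Fin 0)) := by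
  rw [implements_iff] at hC ⊢
  intro x ρ y d d'
  have split : ∀ f : Bits (a + b) → ℂ, ∑ t, f t = ∑ c : Bits a, ∑ s : Bits b,
      f (Sum.elim c s ∘ finSumFinEquiv.symm) := by
    intro f
    rw [← sum_sum_type fun z : Fin a ⊕ Fin b → Bool => f (z ∘ finSumFinEquiv.symm)]
    exact (Fintype.sum_equiv (Equiv.arrowCongr finSumFinEquiv (Equiv.refl Bool)) _ _
      fun _ => rfl).symm
  have hl : ∀ (c : Bits a) (s : Bits b), (fun j => (Sum.elim c s ∘ finSumFinEquiv.symm)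
      (Fin.castAdd b j)) = c := by
    intro c s; funext j; simp
  have hr : ∀ (c : Bits a) (s : Bits b), (fun j => (Sum.elim c s ∘ finSumFinEquiv.symm)
      (Fin.natAdd a j)) = s := by
    intro c s; funext j; simp
  simp only [unmask, Matrix.sum_apply, kern_unmaskGates he hp hw, split, hl, hr, hC]
  refine Finset.sum_congr rfl fun c _ => ?_
  refine Finset.sum_congr rfl fun s _ => ?_
  rw [Finset.sum_eq_single c]
  · simp only [if_true]
    rfl
  · intro c' _ hc'
    simp [Ne.symm hc']
  · simp

end

/-! ## Blocks on computed lengths -/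

/-- In the main variables left by `Compiles.prelude`, the variable `s` holds `g κ`. -/
def Holds (fs : List (ℕ → ℕ)) (s : ℕ) (g : ℕ → ℕ) : Prop :=
  6 < s ∧ PolyBounded g ∧ ∀ κ i, layout κ i (fs.map fun f => f κ) s = g κ

/-- Two variables hold zero because both offsets of a block of gates may be zero, and the loops need
distinct variables for them. -/
theorem holds_zero (fs : List (ℕ → ℕ)) {s : ℕ} (h : s = 7 ∨ s = 8) : Holds fs s fun _ => 0 :=
  ⟨by omega, .const 0, fun κ i => by rcases h with rfl | rfl <;> simp [layout]⟩

theorem holds_one (fs : List (ℕ → ℕ)) : Holds fs 9 fun _ => 1 :=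
  ⟨by omega, .const 1, fun κ i => by simp [layout]⟩

theorem holds_length {fs : List (ℕ → ℕ)} (hfs : ∀ f ∈ fs, PolyTimeLength f) (j : ℕ)
    (hj : j < fs.length) : Holds fs (10 + j) fs[j] := by
  refine ⟨by omega, (hfs _ (List.getElem_mem hj)).polyBounded, fun κ i => ?_⟩
  rw [layout, if_neg (by omega), if_neg (by omega), if_neg (by omega), if_neg (by omega),
    Nat.add_sub_cancel_left, List.getD_eq_getElem _ _ (by simpa using hj), List.getElem_map]

/-- The state of a program after `Compiles.prelude` and `k - 1` calls of subroutines. -/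
abbrev Prepared (n : ℕ → ℕ) (fs : List (ℕ → ℕ)) (k : ℕ) :
    ∀ κ, Fin (n κ) → Store → Prop :=
  Ready (fun κ i => layout κ i (fs.map fun f => f κ)) k

theorem Compiles.xor {n : ℕ → ℕ} {fs : List (ℕ → ℕ)} {k : ℕ} (p : ℕ) (par : Bool) {y₀ : ℕ}
    {o : ℕ → ℕ} (ho : Holds fs y₀ o) (q : ℕ) {y₁ : ℕ} {o' : ℕ → ℕ} (ho' : Holds fs y₁ o')
    {c : ℕ} {a : ℕ → ℕ} (ha : Holds fs c a) {l : ℕ} {b : ℕ → ℕ} (hb : Holds fs l b)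
    (hd : [y₀, y₁, c, l].Nodup) :
    Compiles (Prepared n fs k)
      (fun κ _ C => C = xorGates p (fun i => if par then i else 0) (o κ) q (o' κ) (a κ) (b κ))
      (Prepared n fs k) := by
  simp only [List.nodup_cons, List.mem_cons, List.not_mem_nil, or_false, not_or] at hd
  have := Compiles.xorBlock (n := n) (u := fun κ i => layout κ i (fs.map fun f => f κ)) (k := k)
    p q par ho.1 ho'.1 ha.1 hb.1 hd.1.1 hd.1.2.2 hd.2.1.2 hd.1.2.1 hd.2.1.1 hd.2.2.1
    (fun κ i x h h' => by simp only [layout]; split_ifs <;> omega) ha.2.1 hb.2.1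
    (fun κ i => ha.2.2 κ i) (fun κ i => hb.2.2 κ i)
  simpa only [ho.2.2, ho'.2.2] using this

theorem Compiles.move {n : ℕ → ℕ} {fs : List (ℕ → ℕ)} {k : ℕ} (p : ℕ) {y₀ : ℕ}
    {o : ℕ → ℕ} (ho : Holds fs y₀ o) (q : ℕ) {y₁ : ℕ} {o' : ℕ → ℕ} (ho' : Holds fs y₁ o')
    {c : ℕ} {a : ℕ → ℕ} (ha : Holds fs c a) {l : ℕ} {b : ℕ → ℕ} (hb : Holds fs l b)
    (hd : [y₀, y₁, c, l].Nodup) :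
    Compiles (Prepared n fs k)
      (fun κ _ C => C = moveGates p (o κ) q (o' κ) (a κ) (b κ)) (Prepared n fs k) := by
  have hd' : [y₁, y₀, c, l].Nodup := by
    simp only [List.nodup_cons, List.mem_cons, List.not_mem_nil, or_false, not_or] at hd ⊢
    exact ⟨⟨Ne.symm hd.1.1, hd.2.1.1, hd.2.1.2⟩, ⟨hd.1.2.1, hd.1.2.2⟩, hd.2.2⟩
  refine ((Compiles.xor p true ho q ho' ha hb hd).seq (Compiles.xor q true ho' p ho ha hb hd')).mono
    ?_
  rintro κ i _ ⟨_, _, rfl, rfl, rfl⟩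
  rfl

theorem Compiles.call {n : ℕ → ℕ} {α β γ δ : ℕ → Type}
    [∀ κ, Fintype (α κ)] [∀ κ, DecidableEq (α κ)] [∀ κ, Register (α κ)]
    [∀ κ, Fintype (β κ)] [∀ κ, DecidableEq (β κ)] [∀ κ, Register (β κ)]
    [∀ κ, Fintype (γ κ)] [∀ κ, Register (γ κ)] [∀ κ, Fintype (δ κ)] [∀ κ, Register (δ κ)]
    {F : ∀ κ, Fin (n κ) → QAlg (α κ) (β κ) (γ κ) (δ κ)} (hF : IsQPTFamily F)
    (hn : PolyBounded n) (f : ℕ → ℕ) (fs : List (ℕ → ℕ)) {k : ℕ} (hk : 1 ≤ k) :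
    Compiles (Prepared n fs k)
      (fun κ i C => ∃ C₀, Implements C₀ (F κ i) ∧ C = C₀.map (Gate.map (portMap f)))
      (Prepared n fs (k + 1)) :=
  Compiles.callFamily hF hn f hk (fun κ i => by simp [layout]) (fun κ i => by simp [layout])
    (fun κ i => by simp [layout])

theorem isQPTFamily_unmask {n : ℕ → ℕ} (hn : PolyBounded n) {a b : ℕ → ℕ} (ha : PolyTimeLength a)
    (hb : PolyTimeLength b) {ι γ : ℕ → Type} [∀ κ, Fintype (ι κ)] [∀ κ, DecidableEq (ι κ)]
    [∀ κ, Register (ι κ)] [∀ κ, Fintype (γ κ)] [∀ κ, DecidableEq (γ κ)] [∀ κ, Register (γ κ)]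
    {e : ∀ κ, Fin (a κ) → ι κ} (he : ∀ κ, Function.Surjective (e κ)) {p₀ : ℕ} (hp : p₀ ≤ 1)
    (hw : ∀ κ j, Register.wire (e κ j) = (p₀, 0, (j : ℕ)))
    {G : ∀ κ, Fin (n κ) → QAlg (Fin (a κ)) (Fin (b κ)) (γ κ) (Fin 0)} (hG : IsQPTFamily G) :
    IsQPTFamily (fun κ i => unmask (e κ) (G κ i) :
      ∀ κ, Fin (n κ) → QAlg (ι κ) (Fin (a κ + b κ)) (γ κ) (Fin 0)) := by
  have hfs : ∀ f ∈ [a, b], PolyTimeLength f := by simp [ha, hb]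
  have z₇ := holds_zero [a, b] (s := 7) (by simp)
  have z₈ := holds_zero [a, b] (s := 8) (by simp)
  have one := holds_one [a, b]
  have la := holds_length hfs 0 (by simp)
  have lb := holds_length hfs 1 (by simp)
  refine ((Compiles.prelude (n := n) [a, b] hfs).seq
    ((Compiles.move (2 * p₀) z₇ 3 z₈ one la (by simp)).seq
    ((Compiles.xor 3 true z₇ 0 z₈ one la (by simp)).seq
    ((Compiles.xor 1 true z₇ 0 z₈ one la (by simp)).seq
    ((Compiles.move 1 la 5 z₇ one lb (by simp)).seq
    (Compiles.call hG hn evenFixed [a, b] (by simp))))))).isQPTFamily ?_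
  rintro κ i _ ⟨_, _, rfl, ⟨_, _, rfl, ⟨_, _, rfl, ⟨_, _, rfl, ⟨_, _, rfl, ⟨C, hC, rfl⟩, rfl⟩, rfl⟩,
    rfl⟩, rfl⟩, rfl⟩
  exact implements_unmaskGates (he κ) hp (hw κ) hC

/-! ### Calling a subcircuit on part of a configuration -/

/-- The matrix `h` may depend on the frozen surroundings in `z` and `z'`. Consequently calls can be
nested: the conditions that an outer call imposes on its environment are carried inside the `h` of
an inner one. -/
theorem pull_call {α β : Type} [Register α] [Fintype β] [DecidableEq β] [Register β] {f : ℕ → ℕ}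
    (hf : Function.Injective f) (C : List Gate) {G : Config → Config → ℂ} {z z' : Config}
    {a a' : α → Bool} (hz : z ∘ portMap f = initConfig a) (hz' : z' ∘ portMap f = initConfig a')
    {h : (β → Bool) → (β → Bool) → ℂ}
    (hG : ∀ w w', G (overwrite (portMap f) z w) (overwrite (portMap f) z' w') =
      loc Register.wire h w w') :
    pull (C.map (Gate.map (portMap f))) G z z' = ∑ b, ∑ b', kern α β C a a' b b' * h b b' := by
  rw [pull_map (portMap_injective hf), hz, hz', ← pull_loc]
  congr 1
  funext w w'
  exact hG w w'

theorem initConfig_pair {n m : ℕ} (x : Bits n) (y : Bits m) (t : Fin 0 → Bool) (p i j : ℕ) :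
    initConfig (Sum.elim (Sum.elim x y) t) (p, i, j) =
      if i = 0 then if p = 0 then bitAt x j else if p = 2 then bitAt y j else false else false := by
  obtain ⟨q, rfl | rfl⟩ := Nat.even_or_odd' p
  · rw [initConfig_inl]
    obtain ⟨r, rfl | rfl⟩ := Nat.even_or_odd' q
    · rw [initConfig_inl, initConfig_fin]
      grind
    · rw [initConfig_inr, initConfig_fin]
      grind
  · rw [initConfig_inr, initConfig_fin, bitAt_of_le t (by omega)]
    grind

theorem bitAt_fun {n : ℕ} (g : ℕ → Bool) (j : ℕ) :
    bitAt (fun i : Fin n => g i) j = if j < n then g j else false := by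
  unfold bitAt
  split_ifs <;> rfl

/-! ## Encryption under a fresh key, with a masked ciphertext -/

/-- Generate a key pair `(ek, dk)`, encrypt the message under `ek`, and output the encryption, masked
by the classical input, together with `dk`. -/
noncomputable def maskedEnc {l m k d : ℕ} (KG : QAlg (Fin 0) (Fin 0) (Fin k) (Fin d))
    (Enc : QAlg (Fin k ⊕ Fin m) (Fin 0) (Fin l) (Fin 0)) :
    QAlg (Fin l ⊕ Fin m) (Fin 0) (Fin 0) (Fin (l + d)) := fun x ρ _ =>
  ∑ ek : Bits k, ∑ ct : Bits l, ((pr (Enc (Sum.elim ek (x ∘ Sum.inr)) 1 ct) : ℝ) : ℂ) •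
    join (tensor (basisState (bitXor ct (x ∘ Sum.inl))) (KG ![] ρ ek))

/-- Key generation lives on the odd ports from `3` and encryption on the even ports from `4`; ports
`0`, `1` and `2` are left for the mask, the output and the message. So `ek` and `dk` appear at ports
`3` and `5`, encryption reads `ek` and the message at `4` and `8`, and it leaves `ct` at `4`. -/
def keyPort (p : ℕ) : ℕ := 2 * p + 3

def encPort (p : ℕ) : ℕ := 2 * p + 4

theorem keyPort_injective : Function.Injective keyPort := fun p q h => by
  unfold keyPort at h; omega

theorem encPort_injective : Function.Injective encPort := fun p q h => by
  unfold encPort at h; omega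

/-- The circuit for `maskedEnc KG Enc`, where `K` and `E` are circuits for `KG` and `Enc`. -/
def maskedEncGates (l m k d : ℕ) (K E : List Gate) : List Gate :=
  K.map (Gate.map (portMap keyPort)) ++ (xorGates 3 id 0 4 0 1 k ++ (xorGates 2 id 0 8 0 1 m ++
    (moveGates 5 0 1 l 1 d ++ (E.map (Gate.map (portMap encPort)) ++
      (xorGates 4 id 0 1 0 1 l ++ xorGates 0 id 0 1 0 1 l)))))

section

variable {l m k d : ℕ}

theorem overwrite_keyPort (z w : Config) (p i j : ℕ) : overwrite (portMap keyPort) z w (p, i, j) =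
    if p % 2 = 1 ∧ 3 ≤ p then w ((p - 3) / 2, i, j) else z (p, i, j) := by
  split_ifs with h
  · exact overwrite_portMap keyPort_injective z w (by unfold keyPort; omega) _
  · exact overwrite_portMap_of_ne z w (by intro q; unfold keyPort; omega) _

theorem overwrite_encPort (z w : Config) (p i j : ℕ) : overwrite (portMap encPort) z w (p, i, j) =
    if p % 2 = 0 ∧ 4 ≤ p then w ((p - 4) / 2, i, j) else z (p, i, j) := by
  split_ifs with h
  · exact overwrite_portMap encPort_injective z w (by unfold encPort; omega) _
  · exact overwrite_portMap_of_ne z w (by intro q; unfold encPort; omega) _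

/-- The configuration in which the encryption is started by `maskedEncGates`, where `w` is the
configuration of the key generation. -/
noncomputable def encConfig (k d : ℕ) (x : Bits l) (y : Bits m) (w : Config) : Config :=
  moveConfig 5 0 1 l 1 d (xorConfig 2 id 0 8 0 1 m (xorConfig 3 id 0 4 0 1 k
    (overwrite (portMap keyPort) (initConfig (Sum.elim (Sum.elim x y) (![] : Fin 0 → Bool))) w)))

theorem encConfig_apply (x : Bits l) (y : Bits m) (w : Config) (p i j : ℕ) :
    encConfig k d x y w (p, i, j) =
      if p = 0 then if i = 0 then bitAt x j else false
      else if p = 2 then if i = 0 then bitAt y j else false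
      else if p = 1 then if i = 0 ∧ l ≤ j ∧ j < l + d then w (1, 0, j - l) else false
      else if p = 4 then if i = 0 ∧ j < k then w (0, 0, j) else false
      else if p = 8 then if i = 0 then bitAt y j else false
      else if p = 5 ∧ i = 0 ∧ j < d then false
      else if p % 2 = 1 then w ((p - 3) / 2, i, j) else false := by
  have hz : ∀ p i j, overwrite (portMap keyPort)
      (initConfig (Sum.elim (Sum.elim x y) (![] : Fin 0 → Bool))) w (p, i, j) =
      if p % 2 = 1 ∧ 3 ≤ p then w ((p - 3) / 2, i, j) else
      if i = 0 then if p = 0 then bitAt x j else if p = 2 then bitAt y j else false else false := by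
    intro p i j
    rw [overwrite_keyPort, initConfig_pair]
  rw [encConfig]
  generalize overwrite (portMap keyPort) _ w = z at hz
  have hy : ∀ j, ¬ j < m → bitAt y j = false := fun j h => bitAt_of_le _ (by omega)
  by_cases hi : i = 0
  · subst hi
    obtain rfl | rfl | rfl | rfl | rfl | rfl | rfl | hp : p = 0 ∨ p = 1 ∨ p = 2 ∨ p = 3 ∨ p = 4 ∨
      p = 5 ∨ p = 8 ∨
      (p ≠ 0 ∧ p ≠ 1 ∧ p ≠ 2 ∧ p ≠ 3 ∧ p ≠ 4 ∧ p ≠ 5 ∧ p ≠ 8) := by omega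
    all_goals
      simp [moveConfig, xorConfig, InBlocks, *]
      try grind
  · have hi' : ¬ i < 1 := by omega
    simp [moveConfig, xorConfig, InBlocks, hz, hi, hi']
    try grind

theorem encConfig_comp (x : Bits l) (y : Bits m) (w : Config) :
    encConfig k d x y w ∘ portMap encPort =
      initConfig (Sum.elim (Sum.elim (fun j : Fin k => w (0, 0, j)) y) (![] : Fin 0 → Bool)) := by
  funext ⟨p, i, j⟩
  rw [initConfig_pair, Function.comp_apply, portMap, encConfig_apply,
    bitAt_fun fun j => w (0, 0, j)]
  have hy : ∀ j, ¬ j < m → bitAt y j = false := fun j h => bitAt_of_le _ (by omega)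
  simp only [encPort]
  grind

/-- The final configuration of `maskedEncGates`, where `v` is the configuration of the
encryption. -/
noncomputable def maskedConfig (k d : ℕ) (x : Bits l) (y : Bits m) (w v : Config) : Config :=
  xorConfig 0 id 0 1 0 1 l (xorConfig 4 id 0 1 0 1 l
    (overwrite (portMap encPort) (encConfig k d x y w) v))

theorem maskedConfig_apply (x : Bits l) (y : Bits m) (w v : Config) (p i j : ℕ) :
    maskedConfig k d x y w v (p, i, j) =
      if p = 1 ∧ i = 0 ∧ j < l then xor (v (0, 0, j)) (bitAt x j)
      else if p % 2 = 0 ∧ 4 ≤ p then v ((p - 4) / 2, i, j)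
      else encConfig k d x y w (p, i, j) := by
  by_cases hp : p = 1
  · subst hp
    by_cases hi : i = 0
    · subst hi
      by_cases hj : j < l
      · have hj' : ¬ l ≤ j := by omega
        simp [maskedConfig, xorConfig, InBlocks, overwrite_encPort, encConfig_apply, hj, hj']
      · simp [maskedConfig, xorConfig, InBlocks, overwrite_encPort, hj]
    · have hi' : ¬ i < 1 := by omega
      simp [maskedConfig, xorConfig, InBlocks, overwrite_encPort, hi, hi']
  · simp [maskedConfig, xorConfig, InBlocks, overwrite_encPort, hp]

/-- The output contains only copies of `ct` masked by `x`, next to the moved `dk`. Port `3` still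
holds `ek` and port `4` still holds `ct`, so tracing out forces equal `ek`, equal environments of
key generation, and completely equal final configurations of encryption. -/
theorem agreeOff_maskedConfig (x : Bits l) (y : Bits m) (w w' v v' : Config) :
    AgreeOff (Register.wire : Fin 0 ⊕ Fin (l + d) → Wire) (maskedConfig k d x y w v)
      (maskedConfig k d x y w' v') ↔
    (AgreeOff (Register.wire : Fin k ⊕ Fin d → Wire) w w' ∧
      (fun j : Fin k => w (0, 0, j)) = fun j : Fin k => w' (0, 0, j)) ∧ v = v' := by
  constructor
  · intro h
    have hne : ∀ p i j, p ≠ 1 → maskedConfig k d x y w v (p, i, j) =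
        maskedConfig k d x y w' v' (p, i, j) := by
      intro p i j hp
      refine h _ ?_
      rintro (c | c) hc
      · exact c.elim0
      · simp only [Register.wire, Prod.mk.injEq] at hc
        omega
    simp only [maskedConfig_apply] at hne
    have hw : ∀ p i j, ¬ (p = 1 ∧ i = 0 ∧ j < d) → w (p, i, j) = w' (p, i, j) := by
      intro p i j hp
      have := hne (2 * p + 3) i j (by omega)
      have h1 : ¬ (2 * p + 3) % 2 = 0 := by omega
      have h2 : (2 * p + 3) % 2 = 1 := by omega
      have h3 : ¬ (2 * p + 3 = 5 ∧ i = 0 ∧ j < d) := by omega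
      have h4 : (2 * p + 3 - 3) / 2 = p := by omega
      have h5 : ∀ q, q < 2 → ¬ 2 * p + 3 = q := by omega
      have h6 : ∀ q, ¬ 2 * p + 3 = 2 * q := by omega
      simpa only [encConfig_apply, h1, h2, h3, h4, h5 0 (by omega), h5 1 (by omega), h6 1, h6 2,
        h6 4, false_and, one_ne_zero, if_false, if_true] using this
    refine ⟨⟨?_, ?_⟩, ?_⟩
    · rintro ⟨p, i, j⟩ hp
      refine hw p i j ?_
      rintro ⟨rfl, rfl, hj⟩
      exact hp (.inr ⟨j, hj⟩) (by simp [Register.wire])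
    · funext j
      exact hw 0 0 j (by omega)
    · funext ⟨p, i, j⟩
      have := hne (2 * p + 4) i j (by omega)
      have h1 : (2 * p + 4) % 2 = 0 ∧ 4 ≤ 2 * p + 4 := by omega
      have h4 : (2 * p + 4 - 4) / 2 = p := by omega
      have h5 : ¬ (2 * p + 4 = 1 ∧ i = 0 ∧ j < l) := by omega
      rwa [if_neg h5, if_pos h1, if_neg h5, if_pos h1, h4] at this
  · rintro ⟨⟨h, h'⟩, rfl⟩ ⟨p, i, j⟩ hp
    have hp' : ¬ (p = 1 ∧ i = 0 ∧ j < l + d) := by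
      rintro ⟨rfl, rfl, hj⟩
      exact hp (.inr ⟨j, hj⟩) (by simp [Register.wire])
    have hw : ∀ p i j, ¬ (p = 1 ∧ i = 0 ∧ j < d) → w (p, i, j) = w' (p, i, j) := by
      intro p i j hpij
      by_cases h0 : p = 0 ∧ i = 0 ∧ j < k
      · obtain ⟨rfl, rfl, hj⟩ := h0
        exact congrFun h' ⟨j, hj⟩
      · refine h _ ?_
        rintro (c | c) hc
        · simp only [Register.wire, Prod.mk.injEq] at hc
          have := c.isLt
          omega
        · simp only [Register.wire, Prod.mk.injEq] at hc
          have := c.isLt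
          omega
    have hek : ∀ j, j < k → w (0, 0, j) = w' (0, 0, j) := fun j hj => hw _ _ _ (by omega)
    rw [maskedConfig_apply, maskedConfig_apply, encConfig_apply, encConfig_apply]
    clear h h'
    grind

theorem maskedConfig_comp (x : Bits l) (y : Bits m) (w v : Config) :
    maskedConfig k d x y w v ∘ (Register.wire : Fin 0 ⊕ Fin (l + d) → Wire) =
      Sum.elim ![] (Sum.elim (bitXor (fun j : Fin l => v (0, 0, j)) x)
        (fun j : Fin d => w (1, 0, j)) ∘ finSumFinEquiv.symm) := by
  funext c
  rcases c with c | c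
  · exact c.elim0
  · obtain ⟨c, rfl⟩ := finSumFinEquiv.surjective c
    rcases c with c | c
    · simp [Register.wire, maskedConfig_apply, bitXor, bitAt_of_lt x c.isLt]
    · simp [Register.wire, maskedConfig_apply, encConfig_apply]

/-- Both intermediate classical values are diagonal: `b` and `b'` share the key, and a single `c`
serves both indices of encryption. -/
theorem kern_maskedEncGates (x : Bits l) (y : Bits m) (K E : List Gate)
    (o o' : Fin 0 ⊕ Fin (l + d) → Bool) :
    kern ((Fin l ⊕ Fin m) ⊕ Fin 0) (Fin 0 ⊕ Fin (l + d)) (maskedEncGates l m k d K E)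
        (Sum.elim (Sum.elim x y) ![]) (Sum.elim (Sum.elim x y) ![]) o o' =
      ∑ b : Fin k ⊕ Fin d → Bool, ∑ b' : Fin k ⊕ Fin d → Bool,
        kern (Fin 0 ⊕ Fin 0) (Fin k ⊕ Fin d) K (Sum.elim ![] ![]) (Sum.elim ![] ![]) b b' *
        if b ∘ Sum.inl = b' ∘ Sum.inl then
          ∑ c : Fin l ⊕ Fin 0 → Bool, kern ((Fin k ⊕ Fin m) ⊕ Fin 0) (Fin l ⊕ Fin 0) E
            (Sum.elim (Sum.elim (b ∘ Sum.inl) y) ![]) (Sum.elim (Sum.elim (b ∘ Sum.inl) y) ![])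
              c c *
            if Sum.elim ![] (Sum.elim (bitXor (c ∘ Sum.inl) x) (b ∘ Sum.inr) ∘
                finSumFinEquiv.symm) = o ∧
              Sum.elim ![] (Sum.elim (bitXor (c ∘ Sum.inl) x) (b' ∘ Sum.inr) ∘
                finSumFinEquiv.symm) = o' then 1 else 0
        else 0 := by
  classical
  have hz0 : initConfig (Sum.elim (Sum.elim x y) (![] : Fin 0 → Bool)) ∘ portMap keyPort =
      initConfig (Sum.elim (![] : Fin 0 → Bool) (![] : Fin 0 → Bool)) := by
    funext ⟨p, i, j⟩
    rw [initConfig_of_notMem _ (by rintro (c | c) <;> exact c.elim0), Function.comp_apply, portMap,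
      initConfig_pair]
    simp only [keyPort]
    grind
  have hek : ∀ w : Config, (w ∘ (Register.wire : Fin k ⊕ Fin d → Wire)) ∘ Sum.inl =
      fun j : Fin k => w (0, 0, j) := fun w => by funext j; simp [Register.wire]
  have hdk : ∀ w : Config, (w ∘ (Register.wire : Fin k ⊕ Fin d → Wire)) ∘ Sum.inr =
      fun j : Fin d => w (1, 0, j) := fun w => by funext j; simp [Register.wire]
  have hct : ∀ w : Config, (w ∘ (Register.wire : Fin l ⊕ Fin 0 → Wire)) ∘ Sum.inl =
      fun j : Fin l => w (0, 0, j) := fun w => by funext j; simp [Register.wire]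
  rw [kern_eq_pull, maskedEncGates, pull_append]
  refine pull_call keyPort_injective K hz0 hz0 fun w w' => ?_
  rw [pull_append, pull_xorGates (by omega), pull_append, pull_xorGates (by omega), pull_append,
    pull_moveGates (by omega), pull_append]
  change pull _ _ (encConfig k d x y w) (encConfig k d x y w') = _
  -- The form after encryption is diagonal in the ciphertext and carries along the condition on the
  -- environment of key generation, which is needed for the outer call.
  rw [pull_call encPort_injective E (encConfig_comp x y w) (encConfig_comp x y w')
    (h := fun c c' : Fin l ⊕ Fin 0 → Bool => if c = c' then
      if AgreeOff (Register.wire : Fin k ⊕ Fin d → Wire) w w' ∧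
        (fun j : Fin k => w (0, 0, j)) = fun j : Fin k => w' (0, 0, j) then
      if Sum.elim ![] (Sum.elim (bitXor (c ∘ Sum.inl) x) (fun j : Fin d => w (1, 0, j)) ∘
          finSumFinEquiv.symm) = o ∧
        Sum.elim ![] (Sum.elim (bitXor (c ∘ Sum.inl) x) (fun j : Fin d => w' (1, 0, j)) ∘
          finSumFinEquiv.symm) = o' then 1 else 0 else 0 else 0)]
  · unfold loc
    simp only [hek, hdk]
    by_cases h1 : AgreeOff (Register.wire : Fin k ⊕ Fin d → Wire) w w'
    · by_cases h2 : (fun j : Fin k => w (0, 0, j)) = fun j : Fin k => w' (0, 0, j)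
      · rw [if_pos h1, if_pos h2]
        refine Finset.sum_congr rfl fun c _ => ?_
        rw [Finset.sum_eq_single c]
        · rw [if_pos rfl, if_pos ⟨h1, h2⟩, h2]
        · intro c' _ hc'
          rw [if_neg (Ne.symm hc'), mul_zero]
        · simp
      · rw [if_pos h1, if_neg h2]
        simp [h2]
    · rw [if_neg h1]
      simp [h1]
  · intro v v'
    rw [pull_append, pull_xorGates (by omega), pull_xorGates (by omega)]
    change loc _ _ (maskedConfig k d x y w v) (maskedConfig k d x y w' v') = _
    unfold loc
    rw [maskedConfig_comp, maskedConfig_comp]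
    have key := agreeOff_maskedConfig (k := k) (d := d) x y w w' v v'
    have hv := eq_iff_agreeOff (Register.wire : Fin l ⊕ Fin 0 → Wire) v v'
    by_cases h1 : AgreeOff (Register.wire : Fin k ⊕ Fin d → Wire) w w' ∧
        (fun j : Fin k => w (0, 0, j)) = fun j : Fin k => w' (0, 0, j)
    · by_cases h2 : v = v'
      · subst h2
        rw [if_pos (key.2 ⟨h1, rfl⟩), if_pos (hv.1 rfl).1]
        beta_reduce
        rw [if_pos rfl, if_pos h1, hct]
      · rw [if_neg fun h => h2 (key.1 h).2]
        beta_reduce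
        split_ifs with h3 h4 <;> first | rfl | exact absurd (hv.2 ⟨h3, h4⟩) h2
    · rw [if_neg fun h => h1 (key.1 h).1]
      simp [h1]

end

/-! ## Positivity of diagonal entries -/

theorem kern_diag {α β : Type} [Register α] [Fintype β] [DecidableEq β] [Register β]
    (C : List Gate) (a a' : α → Bool) (b b' : β → Bool) :
    kern α β C a a' b b' = ∑ z ∈ (circuitUnitary C (initialState a)).support,
      if z ∘ Register.wire = b then circuitUnitary C (initialState a) z *
        (starRingEnd ℂ) (circuitUnitary C (initialState a') (Function.extend Register.wire b' z))
      else 0 := rfl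

theorem extend_wire_self {β : Type} [Register β] {b : β → Bool} {z : Config}
    (h : z ∘ Register.wire = b) : Function.extend Register.wire b z = z :=
  (extend_wire_eq_iff b z z).2 ⟨fun _ _ => rfl, h⟩

/-- With equal indices the two amplitudes in each term coincide, leaving squared moduli. -/
theorem kern_diag_eq {α β : Type} [Register α] [Fintype β] [DecidableEq β] [Register β]
    (C : List Gate) (a : α → Bool) (b : β → Bool) :
    kern α β C a a b b = ((∑ z ∈ (circuitUnitary C (initialState a)).support,
      if z ∘ Register.wire = b then Complex.normSq (circuitUnitary C (initialState a) z) else 0 : ℝ)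
        : ℂ) := by
  rw [kern_diag, Complex.ofReal_sum]
  refine Finset.sum_congr rfl fun z _ => ?_
  split_ifs with h
  · rw [extend_wire_self h, Complex.mul_conj]
  · simp

/-- A vanishing sum of squared moduli forces every amplitude with output `b` to vanish, and each
term of the whole row contains such an amplitude as a factor. -/
theorem kern_eq_zero_of_diag {α β : Type} [Register α] [Fintype β] [DecidableEq β] [Register β]
    {C : List Gate} {a : α → Bool} {b : β → Bool} (h : kern α β C a a b b = 0) (a' : α → Bool)
    (b' : β → Bool) : kern α β C a a' b b' = 0 := by
  rw [kern_diag_eq, Complex.ofReal_eq_zero, Finset.sum_eq_zero_iff_of_nonneg] at h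
  · rw [kern_diag]
    refine Finset.sum_eq_zero fun z hz => ?_
    have := h z hz
    split_ifs at this ⊢
    · rw [Complex.normSq_eq_zero] at this
      rw [this, zero_mul]
    · rfl
  · intro z _
    split_ifs
    · exact Complex.normSq_nonneg _
    · rfl

theorem sum_fin_zero {M : Type*} [AddCommMonoid M] (f : (Fin 0 → Bool) → M) :
    ∑ t, f t = f ![] :=
  Fintype.sum_eq_single _ fun t ht => absurd (Subsingleton.elim t ![]) ht

theorem implements_zero_apply {α γ δ : Type} [Fintype α] [DecidableEq α] [Register α]
    [Fintype γ] [DecidableEq γ] [Register γ] [Fintype δ] [DecidableEq δ] [Register δ]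
    {C : List Gate} {F : QAlg α (Fin 0) γ δ} (hC : Implements C F) (x : α → Bool) (ρ : Op (Fin 0))
    (y : γ → Bool) (d d' : δ → Bool) :
    F x ρ y d d' = ρ ![] ![] * kern (α ⊕ Fin 0) (γ ⊕ δ) C (Sum.elim x ![]) (Sum.elim x ![])
      (Sum.elim y d) (Sum.elim y d') := by
  rw [implements_iff.1 hC, sum_fin_zero, sum_fin_zero]

theorem pr_fin_zero (ρ : Op (Fin 0)) : pr ρ = (ρ ![] ![]).re := by
  rw [pr, Matrix.trace, sum_fin_zero]
  rfl

/-- The probabilities of a purely classical algorithm are real. -/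
theorem ofReal_pr_of_implements {α γ : Type} [Fintype α] [DecidableEq α] [Register α]
    [Fintype γ] [DecidableEq γ] [Register γ] {C : List Gate} {F : QAlg α (Fin 0) γ (Fin 0)}
    (hC : Implements C F) (x : α → Bool) (y : γ → Bool) :
    ((pr (F x 1 y) : ℝ) : ℂ) = kern (α ⊕ Fin 0) (γ ⊕ Fin 0) C (Sum.elim x ![]) (Sum.elim x ![])
      (Sum.elim y ![]) (Sum.elim y ![]) := by
  rw [pr_fin_zero, implements_zero_apply hC, kern_diag_eq, Matrix.one_apply_eq, one_mul,
    Complex.ofReal_re]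

/-- If an algorithm without quantum input has an outcome of probability zero, then its unnormalized
state after this outcome vanishes. -/
theorem eq_zero_of_pr_eq_zero {α γ δ : Type} [Fintype α] [DecidableEq α] [Register α]
    [Fintype γ] [DecidableEq γ] [Register γ] [Fintype δ] [DecidableEq δ] [Register δ]
    {C : List Gate} {F : QAlg α (Fin 0) γ δ} (hC : Implements C F) {x : α → Bool} {y : γ → Bool}
    (h : pr (F x 1 y) = 0) : F x 1 y = 0 := by
  -- The probability is a sum of nonnegative diagonal entries, so all of them are zero.
  have hdiag : ∀ d, kern (α ⊕ Fin 0) (γ ⊕ δ) C (Sum.elim x ![]) (Sum.elim x ![])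
      (Sum.elim y d) (Sum.elim y d) = 0 := by
    have hpr : pr (F x 1 y) = ∑ d, (kern (α ⊕ Fin 0) (γ ⊕ δ) C (Sum.elim x ![]) (Sum.elim x ![])
        (Sum.elim y d) (Sum.elim y d)).re := by
      rw [pr, Matrix.trace, Complex.re_sum]
      refine Finset.sum_congr rfl fun d _ => ?_
      rw [Matrix.diag_apply, implements_zero_apply hC, Matrix.one_apply_eq, one_mul]
    rw [hpr, Finset.sum_eq_zero_iff_of_nonneg] at h
    · intro d
      have := h d (Finset.mem_univ d)
      rw [kern_diag_eq, Complex.ofReal_re] at this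
      rw [kern_diag_eq, this, Complex.ofReal_zero]
    · intro d _
      rw [kern_diag_eq, Complex.ofReal_re]
      refine Finset.sum_nonneg fun z _ => ?_
      split_ifs
      · exact Complex.normSq_nonneg _
      · rfl
  ext d d'
  rw [implements_zero_apply hC, kern_eq_zero_of_diag (hdiag d), mul_zero]
  rfl

/-! ## The encryption circuit -/

theorem join_tensor_basisState_apply {l d : ℕ} (c : Bits l) (σ : Op (Fin d))
    (o o' : Bits (l + d)) :
    join (tensor (basisState c) σ) o o' =
      if (fun j => o (Fin.castAdd d j)) = c ∧ (fun j => o' (Fin.castAdd d j)) = c then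
        σ (fun j => o (Fin.natAdd l j)) (fun j => o' (Fin.natAdd l j)) else 0 := by
  have h1 : ∀ o : Bits (l + d), (o ∘ finSumFinEquiv) ∘ Sum.inl = fun j => o (Fin.castAdd d j) :=
    fun o => rfl
  have h2 : ∀ o : Bits (l + d), (o ∘ finSumFinEquiv) ∘ Sum.inr = fun j => o (Fin.natAdd l j) :=
    fun o => rfl
  simp only [join, tensor, basisState, Matrix.submatrix_apply, Matrix.of_apply,
    Matrix.single_apply, h1, h2, eq_comm (a := c), ite_mul, one_mul, zero_mul]

/-- The weights in `maskedEnc` are real parts of traces. By `ofReal_pr_of_implements` nothing is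
lost in passing to the real part, so they agree with the kernel entries of encryption. -/
theorem implements_maskedEncGates {l m k d : ℕ} {K E : List Gate}
    {KG : QAlg (Fin 0) (Fin 0) (Fin k) (Fin d)}
    {Enc : QAlg (Fin k ⊕ Fin m) (Fin 0) (Fin l) (Fin 0)} (hK : Implements K KG)
    (hE : Implements E Enc) : Implements (maskedEncGates l m k d K E) (maskedEnc KG Enc) := by
  rw [implements_iff]
  intro x ρ y o o'
  obtain ⟨x₁, x₂, rfl⟩ : ∃ x₁ x₂, x = Sum.elim x₁ x₂ :=
    ⟨x ∘ Sum.inl, x ∘ Sum.inr, (Sum.elim_comp_inl_inr x).symm⟩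
  obtain rfl : y = ![] := Subsingleton.elim _ _
  rw [sum_fin_zero, sum_fin_zero, kern_maskedEncGates, sum_sum_type]
  simp only [maskedEnc, Matrix.sum_apply, Matrix.smul_apply, join_tensor_basisState_apply,
    Sum.elim_comp_inl, Sum.elim_comp_inr, implements_zero_apply hK, ofReal_pr_of_implements hE,
    smul_eq_mul]
  rw [Finset.mul_sum]
  refine Finset.sum_congr rfl fun ek _ => ?_
  have hsplit : ∀ (u : Bits l) (v : Bits d) (o : Bits (l + d)),
      (Sum.elim ![] (Sum.elim u v ∘ finSumFinEquiv.symm) : Fin 0 ⊕ Fin (l + d) → Bool) =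
        Sum.elim ![] o ↔ (fun j => o (Fin.castAdd d j)) = u ∧ (fun j => o (Fin.natAdd l j)) = v := by
    intro u v o
    constructor
    · intro h
      have h' : ∀ j, (Sum.elim u v ∘ finSumFinEquiv.symm) j = o j := fun j => congrFun h (.inr j)
      constructor
      · funext j; rw [← h']; simp
      · funext j; rw [← h']; simp
    · rintro ⟨rfl, rfl⟩
      congr 1
      funext j
      obtain ⟨j, rfl⟩ := finSumFinEquiv.surjective j
      rcases j with j | j <;> simp
  simp only [hsplit, sum_sum_type (α := Fin l), Sum.elim_comp_inl]
  rw [Finset.sum_eq_single (fun j => o (Fin.natAdd l j))]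
  · rw [sum_sum_type, Finset.sum_eq_single ek]
    · rw [Finset.sum_eq_single (fun j => o' (Fin.natAdd l j))]
      · simp only [Sum.elim_comp_inl, Sum.elim_comp_inr, if_true, sum_fin_zero, and_true]
        rw [Finset.mul_sum, Finset.mul_sum]
        refine Finset.sum_congr rfl fun c _ => ?_
        split_ifs <;> ring
      · intro v _ hv
        simp [Ne.symm hv]
      · simp
    · intro ek' _ hek'
      simp [Ne.symm hek']
    · simp
  · intro v _ hv
    simp [Ne.symm hv]
  · simp

theorem isQPT_maskedEnc {l m k d : ℕ → ℕ} (hl : PolyTimeLength l) (hm : PolyTimeLength m)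
    (hk : PolyTimeLength k) (hd : PolyTimeLength d)
    {KG : ∀ κ, QAlg (Fin 0) (Fin 0) (Fin (k κ)) (Fin (d κ))}
    {Enc : ∀ κ, QAlg (Fin (k κ) ⊕ Fin (m κ)) (Fin 0) (Fin (l κ)) (Fin 0)} (hKG : IsQPT KG)
    (hEnc : IsQPT Enc) : IsQPT (fun κ => maskedEnc (KG κ) (Enc κ)) := by
  have hfs : ∀ f ∈ [l, m, k, d], PolyTimeLength f := by simp [hl, hm, hk, hd]
  have z₇ := holds_zero [l, m, k, d] (s := 7) (by simp)
  have z₈ := holds_zero [l, m, k, d] (s := 8) (by simp)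
  have one := holds_one [l, m, k, d]
  have ll := holds_length hfs 0 (by simp)
  have lm := holds_length hfs 1 (by simp)
  have lk := holds_length hfs 2 (by simp)
  have ld := holds_length hfs 3 (by simp)
  refine ((Compiles.prelude (n := fun _ => 1) [l, m, k, d] hfs).seq
    ((Compiles.call hKG (.const 1) keyPort [l, m, k, d] (by simp)).seq
    ((Compiles.xor 3 true z₇ 4 z₈ one lk (by simp)).seq
    ((Compiles.xor 2 true z₇ 8 z₈ one lm (by simp)).seq
    ((Compiles.move 5 z₇ 1 ll one ld (by simp)).seq
    ((Compiles.call hEnc (.const 1) encPort [l, m, k, d] (by simp)).seq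
    ((Compiles.xor 4 true z₇ 1 z₈ one ll (by simp)).seq
    (Compiles.xor 0 true z₇ 1 z₈ one ll (by simp))))))))).isQPTFamily ?_
  rintro κ i _ ⟨_, _, rfl, ⟨_, _, ⟨K, hK, rfl⟩, ⟨_, _, rfl, ⟨_, _, rfl, ⟨_, _, rfl,
    ⟨_, _, ⟨E, hE, rfl⟩, ⟨_, _, rfl, rfl, rfl⟩, rfl⟩, rfl⟩, rfl⟩, rfl⟩, rfl⟩, rfl⟩
  exact implements_maskedEncGates hK hE

/-! ## Splitting a state among many parties under a uniform mask -/

/-- Put the classical bit string `c` in front of each of the `n` registers. -/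
def attach {n l r : ℕ} (c : Bits l) (σ : Op (Fin n × Fin r)) : Op (Fin n × Fin (l + r)) :=
  Matrix.of fun z z' =>
    if (∀ i, (fun j => z (i, Fin.castAdd r j)) = c) ∧ ∀ i, (fun j => z' (i, Fin.castAdd r j)) = c then
      σ (fun q => z (q.1, Fin.natAdd l q.2)) (fun q => z' (q.1, Fin.natAdd l q.2)) else 0

/-- Run `Choose`, run `Share` on the kept state, a uniform bit string and the given quantum input, and
hand out a copy of the uniform bit string with each register. -/
noncomputable def maskedShare {l d m s n r : ℕ}
    (Choose : QAlg (Fin 0) (Fin 0) (Fin m ⊕ Fin m) (Fin s))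
    (Share : QAlg (Fin 0) (Fin s ⊕ Fin (l + d)) (Fin 0) (Fin n × Fin r)) :
    QAlg (Fin 0) (Fin d) (Fin m ⊕ Fin m) (Fin n × Fin (l + r)) := fun _ ρ y =>
  ∑ c : Bits l, (1 / 2 ^ l : ℂ) •
    attach c (Share ![] (tensor (Choose ![] 1 y) (join (tensor (basisState c) ρ))) ![])

/-- The three subroutines occupy the three residue classes modulo `3` from port `3` on, which leaves
ports `0`, `1` and `2` for input and output. The messages appear at `3` and `9`, the kept state at
`6` and the mask at `5`; `Share` reads the state at `7` and the ciphertext at `13`, and leaves its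
registers at `7`. -/
def choosePort (p : ℕ) : ℕ := 3 * p + 3

def sharePort (p : ℕ) : ℕ := 3 * p + 4

def maskPort (p : ℕ) : ℕ := 3 * p + 5

theorem choosePort_injective : Function.Injective choosePort := fun p q h => by
  unfold choosePort at h; omega

theorem sharePort_injective : Function.Injective sharePort := fun p q h => by
  unfold sharePort at h; omega

theorem maskPort_injective : Function.Injective maskPort := fun p q h => by
  unfold maskPort at h; omega

theorem overwrite_choosePort (z w : Config) (p i j : ℕ) :
    overwrite (portMap choosePort) z w (p, i, j) =
      if p % 3 = 0 ∧ 3 ≤ p then w ((p - 3) / 3, i, j) else z (p, i, j) := by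
  split_ifs with h
  · exact overwrite_portMap choosePort_injective z w (by unfold choosePort; omega) _
  · exact overwrite_portMap_of_ne z w (by intro q; unfold choosePort; omega) _

theorem overwrite_sharePort (z w : Config) (p i j : ℕ) :
    overwrite (portMap sharePort) z w (p, i, j) =
      if p % 3 = 1 ∧ 4 ≤ p then w ((p - 4) / 3, i, j) else z (p, i, j) := by
  split_ifs with h
  · exact overwrite_portMap sharePort_injective z w (by unfold sharePort; omega) _
  · exact overwrite_portMap_of_ne z w (by intro q; unfold sharePort; omega) _

theorem overwrite_maskPort (z w : Config) (p i j : ℕ) :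
    overwrite (portMap maskPort) z w (p, i, j) =
      if p % 3 = 2 ∧ 5 ≤ p then w ((p - 5) / 3, i, j) else z (p, i, j) := by
  split_ifs with h
  · exact overwrite_portMap maskPort_injective z w (by unfold maskPort; omega) _
  · exact overwrite_portMap_of_ne z w (by intro q; unfold maskPort; omega) _

/-- The circuit for `maskedShare Choose Share`, where `A` and `B` are circuits for `Choose` and
`Share`, and `U` samples a uniform bit string. -/
def maskedShareGates (l d m s n r : ℕ) (A U B : List Gate) : List Gate :=
  A.map (Gate.map (portMap choosePort)) ++ (U.map (Gate.map (portMap maskPort)) ++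
    (moveGates 1 0 13 l 1 d ++ (xorGates 3 id 0 0 0 1 m ++ (xorGates 9 id 0 2 0 1 m ++
      (moveGates 6 0 7 0 1 s ++ (xorGates 5 id 0 13 0 1 l ++
        (B.map (Gate.map (portMap sharePort)) ++
          (xorGates 5 (fun _ => 0) 0 1 0 n l ++ moveGates 7 0 1 l n r))))))))

section

variable {l d m s n r : ℕ}

/-- The configuration in which `Share` is started by `maskedShareGates`, where `w` and `u` are the
configurations of `Choose` and of the sampling of the mask. -/
noncomputable def shareConfig (l m s : ℕ) (t : Bits d) (w u : Config) : Config :=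
  xorConfig 5 id 0 13 0 1 l (moveConfig 6 0 7 0 1 s (xorConfig 9 id 0 2 0 1 m
    (xorConfig 3 id 0 0 0 1 m (moveConfig 1 0 13 l 1 d (overwrite (portMap maskPort)
      (overwrite (portMap choosePort) (initConfig (Sum.elim (![] : Fin 0 → Bool) t)) w) u)))))

theorem initConfig_right {k : ℕ} (x : Fin 0 → Bool) (t : Bits k) (p i j : ℕ) :
    initConfig (Sum.elim x t) (p, i, j) = if p = 1 ∧ i = 0 then bitAt t j else false := by
  obtain ⟨q, rfl | rfl⟩ := Nat.even_or_odd' p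
  · rw [initConfig_inl, initConfig_fin, bitAt_of_le x (by omega)]
    grind
  · rw [initConfig_inr, initConfig_fin]
    grind

theorem shareConfig_apply (t : Bits d) (w u : Config) (p i j : ℕ) :
    shareConfig l m s t w u (p, i, j) =
      if p = 0 then if i = 0 ∧ j < m then w (0, 0, j) else false
      else if p = 1 then false
      else if p = 2 then if i = 0 ∧ j < m then w (2, 0, j) else false
      else if p = 6 ∧ i = 0 ∧ j < s then false
      else if p = 7 then if i = 0 ∧ j < s then w (1, 0, j) else false
      else if p = 13 then if i = 0 then if j < l then u (0, 0, j) else bitAt t (j - l) else false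
      else if p % 3 = 0 then w ((p - 3) / 3, i, j)
      else if p % 3 = 2 then u ((p - 5) / 3, i, j)
      else false := by
  have hz : ∀ p i j, overwrite (portMap maskPort)
      (overwrite (portMap choosePort) (initConfig (Sum.elim (![] : Fin 0 → Bool) t)) w) u (p, i, j) =
      if p % 3 = 2 ∧ 5 ≤ p then u ((p - 5) / 3, i, j)
      else if p % 3 = 0 ∧ 3 ≤ p then w ((p - 3) / 3, i, j)
      else if p = 1 ∧ i = 0 then bitAt t j else false := by
    intro p i j
    rw [overwrite_maskPort, overwrite_choosePort, initConfig_right]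
  rw [shareConfig]
  generalize overwrite (portMap maskPort) _ u = z at hz
  have ht : ∀ j, ¬ j < d → bitAt t j = false := fun j h => bitAt_of_le _ (by omega)
  by_cases hi : i = 0
  · subst hi
    obtain rfl | rfl | rfl | rfl | rfl | rfl | rfl | rfl | rfl | hp : p = 0 ∨ p = 1 ∨ p = 2 ∨
      p = 3 ∨ p = 5 ∨ p = 6 ∨ p = 7 ∨ p = 9 ∨ p = 13 ∨
      (p ≠ 0 ∧ p ≠ 1 ∧ p ≠ 2 ∧ p ≠ 3 ∧ p ≠ 5 ∧ p ≠ 6 ∧ p ≠ 7 ∧ p ≠ 9 ∧ p ≠ 13) := by omega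
    all_goals
      simp [moveConfig, xorConfig, InBlocks, *]
      try first
        | grind
        | (by_cases hj : j < l
           · have hj' : ¬ l ≤ j := by omega
             simp [hj, hj']
           · by_cases hj' : j < l + d
             · have hj'' : l ≤ j := by omega
               simp [hj, hj', hj'']
             · simp [hj, hj', ht (j - l) (by omega)])
  · have hi' : ¬ i < 1 := by omega
    simp [moveConfig, xorConfig, InBlocks, hz, hi, hi']
    try grind

theorem initConfig_right_pair {a b : ℕ} (t : Fin 0 → Bool) (x : Bits a) (y : Bits b) (p i j : ℕ) :
    initConfig (Sum.elim t (Sum.elim x y)) (p, i, j) =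
      if i = 0 then if p = 1 then bitAt x j else if p = 3 then bitAt y j else false else false := by
  obtain ⟨q, rfl | rfl⟩ := Nat.even_or_odd' p
  · rw [initConfig_inl, initConfig_fin, bitAt_of_le t (by omega)]
    grind
  · rw [initConfig_inr]
    obtain ⟨r, rfl | rfl⟩ := Nat.even_or_odd' q
    · rw [initConfig_inl, initConfig_fin]
      grind
    · rw [initConfig_inr, initConfig_fin]
      grind

theorem bitAt_append {a b : ℕ} (x : Bits a) (y : Bits b) (j : ℕ) :
    bitAt (Sum.elim x y ∘ finSumFinEquiv.symm) j =
      if j < a then bitAt x j else bitAt y (j - a) := by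
  split_ifs with h
  · rw [bitAt_of_lt _ (show j < a + b by omega), bitAt_of_lt _ h]
    exact congrArg (Sum.elim x y) (finSumFinEquiv_symm_apply_castAdd (⟨j, h⟩ : Fin a))
  · by_cases h' : j < a + b
    · rw [bitAt_of_lt _ h', bitAt_of_lt _ (show j - a < b by omega)]
      have : (⟨j, h'⟩ : Fin (a + b)) = Fin.natAdd a ⟨j - a, by omega⟩ := by ext; simp; omega
      rw [Function.comp_apply, this, finSumFinEquiv_symm_apply_natAdd, Sum.elim_inr]
    · rw [bitAt_of_le _ (by omega), bitAt_of_le _ (by omega)]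

theorem shareConfig_comp (t : Bits d) (w u : Config) :
    shareConfig l m s t w u ∘ portMap sharePort =
      initConfig (Sum.elim (![] : Fin 0 → Bool) (Sum.elim (fun j : Fin s => w (1, 0, j))
        (Sum.elim (fun j : Fin l => u (0, 0, j)) t ∘ finSumFinEquiv.symm))) := by
  funext ⟨p, i, j⟩
  rw [initConfig_right_pair, Function.comp_apply, portMap, shareConfig_apply, bitAt_append,
    bitAt_fun fun j => w (1, 0, j), bitAt_fun fun j => u (0, 0, j)]
  simp only [sharePort]
  grind

/-- The final configuration of `maskedShareGates`, where `v` is the configuration of `Share`. -/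
noncomputable def sharedConfig (l m s n r : ℕ) (t : Bits d) (w u v : Config) : Config :=
  moveConfig 7 0 1 l n r (xorConfig 5 (fun _ => 0) 0 1 0 n l
    (overwrite (portMap sharePort) (shareConfig l m s t w u) v))

theorem sharedConfig_apply (t : Bits d) (w u v : Config) (p i j : ℕ) :
    sharedConfig l m s n r t w u v (p, i, j) =
      if p = 1 then
        if i < n ∧ j < l + r then if j < l then u (0, 0, j) else v (1, i, j - l) else false
      else if p = 7 ∧ i < n ∧ j < r then false
      else if p % 3 = 1 then v ((p - 4) / 3, i, j)
      else shareConfig l m s t w u (p, i, j) := by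
  have hz : ∀ p i j, overwrite (portMap sharePort) (shareConfig l m s t w u) v (p, i, j) =
      if p % 3 = 1 ∧ 4 ≤ p then v ((p - 4) / 3, i, j)
      else if p = 1 then false else if p = 5 then u (0, i, j)
      else shareConfig l m s t w u (p, i, j) := by
    intro p i j
    rw [overwrite_sharePort]
    split_ifs with h1 h2 h3
    · rfl
    · subst h2
      simp [shareConfig_apply]
    · subst h3
      simp [shareConfig_apply]
    · rfl
  rw [sharedConfig]
  generalize overwrite (portMap sharePort) _ v = z at hz
  obtain rfl | rfl | rfl | hp : p = 1 ∨ p = 5 ∨ p = 7 ∨ (p ≠ 1 ∧ p ≠ 5 ∧ p ≠ 7) := by omega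
  · simp [moveConfig, xorConfig, InBlocks, hz]
    grind
  · simp [moveConfig, xorConfig, InBlocks, hz, shareConfig_apply]
  · simp [moveConfig, xorConfig, InBlocks, hz]
  · simp [moveConfig, xorConfig, InBlocks, hz, hp]
    grind

/-- Messages and mask are copied rather than moved, so their originals are traced out. The messages
are thereby measured, and the superposition of masks turns into a uniformly random mask. -/
theorem agreeOff_sharedConfig (t t' : Bits d) (w w' u u' v v' : Config) :
    AgreeOff (Register.wire : (Fin m ⊕ Fin m) ⊕ (Fin n × Fin (l + r)) → Wire)
      (sharedConfig l m s n r t w u v) (sharedConfig l m s n r t' w' u' v') ↔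
    ((AgreeOff (Register.wire : (Fin m ⊕ Fin m) ⊕ Fin s → Wire) w w' ∧
      (w ∘ (Register.wire : (Fin m ⊕ Fin m) ⊕ Fin s → Wire)) ∘ Sum.inl =
        (w' ∘ (Register.wire : (Fin m ⊕ Fin m) ⊕ Fin s → Wire)) ∘ Sum.inl) ∧ u = u') ∧
      AgreeOff (Register.wire : Fin 0 ⊕ (Fin n × Fin r) → Wire) v v' := by
  have hout : ∀ p i j, (∀ c : (Fin m ⊕ Fin m) ⊕ (Fin n × Fin (l + r)),
      Register.wire c ≠ (p, i, j)) ↔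
      ¬ ((p = 0 ∧ i = 0 ∧ j < m) ∨ (p = 2 ∧ i = 0 ∧ j < m) ∨ (p = 1 ∧ i < n ∧ j < l + r)) := by
    intro p i j
    rw [← not_exists, not_iff_not]
    constructor
    · rintro ⟨(c | c) | c, hc⟩
      · simp only [Register.wire, Prod.mk.injEq] at hc
        have := c.isLt
        omega
      · simp only [Register.wire, Prod.mk.injEq] at hc
        have := c.isLt
        omega
      · simp only [Register.wire, Prod.mk.injEq] at hc
        have := c.1.isLt
        have := c.2.isLt
        omega
    · rintro (⟨rfl, rfl, hj⟩ | ⟨rfl, rfl, hj⟩ | ⟨rfl, hi, hj⟩)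
      · exact ⟨.inl (.inl ⟨j, hj⟩), by simp [Register.wire]⟩
      · exact ⟨.inl (.inr ⟨j, hj⟩), by simp [Register.wire]⟩
      · exact ⟨.inr (⟨i, hi⟩, ⟨j, hj⟩), by simp [Register.wire]⟩
  have hst : ∀ p i j, (∀ c : (Fin m ⊕ Fin m) ⊕ Fin s, Register.wire c ≠ (p, i, j)) ↔
      ¬ ((p = 0 ∧ i = 0 ∧ j < m) ∨ (p = 2 ∧ i = 0 ∧ j < m) ∨ (p = 1 ∧ i = 0 ∧ j < s)) := by
    intro p i j
    rw [← not_exists, not_iff_not]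
    constructor
    · rintro ⟨(c | c) | c, hc⟩ <;>
      · simp only [Register.wire, Prod.mk.injEq] at hc
        have := c.isLt
        omega
    · rintro (⟨rfl, rfl, hj⟩ | ⟨rfl, rfl, hj⟩ | ⟨rfl, rfl, hj⟩)
      · exact ⟨.inl (.inl ⟨j, hj⟩), by simp [Register.wire]⟩
      · exact ⟨.inl (.inr ⟨j, hj⟩), by simp [Register.wire]⟩
      · exact ⟨.inr ⟨j, hj⟩, by simp [Register.wire]⟩
  have hreg : ∀ p i j, (∀ c : Fin 0 ⊕ (Fin n × Fin r), Register.wire c ≠ (p, i, j)) ↔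
      ¬ (p = 1 ∧ i < n ∧ j < r) := by
    intro p i j
    rw [← not_exists, not_iff_not]
    constructor
    · rintro ⟨c | c, hc⟩
      · exact c.elim0
      · simp only [Register.wire, Prod.mk.injEq] at hc
        have := c.1.isLt
        have := c.2.isLt
        omega
    · rintro ⟨rfl, hi, hj⟩
      exact ⟨.inr (⟨i, hi⟩, ⟨j, hj⟩), by simp [Register.wire]⟩
  constructor
  · intro h
    -- All output wires have ports below `3`, so everything from port `3` on must agree.
    have hne : ∀ p i j, 3 ≤ p → sharedConfig l m s n r t w u v (p, i, j) =
        sharedConfig l m s n r t' w' u' v' (p, i, j) := by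
      intro p i j hp
      exact h _ ((hout p i j).2 (by omega))
    have hw : ∀ p i j, ¬ (p = 1 ∧ i = 0 ∧ j < s) → w (p, i, j) = w' (p, i, j) := by
      intro p i j hp
      have := hne (3 * p + 3) i j (by omega)
      rw [sharedConfig_apply, sharedConfig_apply, shareConfig_apply, shareConfig_apply] at this
      have h4 : (3 * p + 3 - 3) / 3 = p := by omega
      simp only [h4, show ¬ 3 * p + 3 = 1 by omega, show ¬ 3 * p + 3 = 0 by omega,
        show ¬ 3 * p + 3 = 2 by omega, show ¬ 3 * p + 3 = 7 by omega,
        show ¬ 3 * p + 3 = 13 by omega, show (3 * p + 3) % 3 = 0 by omega,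
        show ¬ (3 * p + 3 = 6 ∧ i = 0 ∧ j < s) by omega,
        false_and, if_false, if_true] at this
      simpa using this
    have hu : u = u' := by
      funext ⟨p, i, j⟩
      have := hne (3 * p + 5) i j (by omega)
      rw [sharedConfig_apply, sharedConfig_apply, shareConfig_apply, shareConfig_apply] at this
      have h4 : (3 * p + 5 - 5) / 3 = p := by omega
      simp only [h4, show ¬ 3 * p + 5 = 1 by omega, show ¬ 3 * p + 5 = 0 by omega,
        show ¬ 3 * p + 5 = 2 by omega, show ¬ 3 * p + 5 = 7 by omega,
        show ¬ 3 * p + 5 = 13 by omega,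
        show (3 * p + 5) % 3 = 2 by omega, show ¬ 3 * p + 5 = 6 by omega,
        false_and, if_false, if_true] at this
      simpa using this
    have hv : ∀ p i j, ¬ (p = 1 ∧ i < n ∧ j < r) → v (p, i, j) = v' (p, i, j) := by
      intro p i j hp
      have := hne (3 * p + 4) i j (by omega)
      rw [sharedConfig_apply, sharedConfig_apply] at this
      have h4 : (3 * p + 4 - 4) / 3 = p := by omega
      simpa only [h4, show ¬ 3 * p + 4 = 1 by omega, show (3 * p + 4) % 3 = 1 by omega,
        show ¬ (3 * p + 4 = 7 ∧ i < n ∧ j < r) by omega, if_false, if_true] using this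
    refine ⟨⟨⟨?_, ?_⟩, hu⟩, ?_⟩
    · rintro ⟨p, i, j⟩ hp
      exact hw p i j (by have := (hst p i j).1 hp; omega)
    · funext c
      rcases c with c | c <;> exact hw _ _ _ (by simp [Register.wire])
    · rintro ⟨p, i, j⟩ hp
      exact hv p i j ((hreg p i j).1 hp)
  · rintro ⟨⟨⟨h1, h2⟩, rfl⟩, h3⟩ ⟨p, i, j⟩ hp
    have hp' := (hout p i j).1 hp
    have hw : ∀ p i j, ¬ (p = 1 ∧ i = 0 ∧ j < s) → w (p, i, j) = w' (p, i, j) := by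
      intro p i j hpij
      by_cases h0 : p = 0 ∧ i = 0 ∧ j < m
      · obtain ⟨rfl, rfl, hj⟩ := h0
        simpa [Register.wire] using congrFun h2 (.inl ⟨j, hj⟩)
      by_cases h0' : p = 2 ∧ i = 0 ∧ j < m
      · obtain ⟨rfl, rfl, hj⟩ := h0'
        simpa [Register.wire] using congrFun h2 (.inr ⟨j, hj⟩)
      · exact h1 _ ((hst p i j).2 (by omega))
    have hv : ∀ p i j, ¬ (p = 1 ∧ i < n ∧ j < r) → v (p, i, j) = v' (p, i, j) := by
      intro p i j hpij
      exact h3 _ ((hreg p i j).2 hpij)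
    clear hst hreg hout hp h1 h2 h3
    by_cases h13 : p % 3 = 1
    · rw [sharedConfig_apply, sharedConfig_apply]
      grind
    · have h1 : ¬ p = 1 := by omega
      have h7 : ¬ p = 7 := by omega
      have h13' : ¬ p = 13 := by omega
      rw [sharedConfig_apply, sharedConfig_apply, shareConfig_apply, shareConfig_apply]
      simp only [h13, h1, h7, h13', false_and, if_false]
      split_ifs <;> first | rfl | omega | exact hw _ _ _ (by omega)

theorem sharedConfig_comp (t : Bits d) (w u v : Config) :
    sharedConfig l m s n r t w u v ∘
        (Register.wire : (Fin m ⊕ Fin m) ⊕ (Fin n × Fin (l + r)) → Wire) =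
      Sum.elim ((w ∘ (Register.wire : (Fin m ⊕ Fin m) ⊕ Fin s → Wire)) ∘ Sum.inl)
        fun q => Sum.elim ((u ∘ (Register.wire : Fin l ⊕ Fin 0 → Wire)) ∘ Sum.inl)
          (fun j => ((v ∘ (Register.wire : Fin 0 ⊕ (Fin n × Fin r) → Wire)) ∘ Sum.inr) (q.1, j))
            (finSumFinEquiv.symm q.2) := by
  funext c
  rcases c with (c | c) | ⟨i, c⟩
  · simp [Register.wire, sharedConfig_apply, shareConfig_apply]
  · simp [Register.wire, sharedConfig_apply, shareConfig_apply]
  · obtain ⟨c, rfl⟩ := finSumFinEquiv.surjective c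
    rcases c with c | c
    · have : (c : ℕ) < l + r := by omega
      simp [Register.wire, sharedConfig_apply, this]
    · simp [Register.wire, sharedConfig_apply]

end

section

variable {l d m s n r : ℕ}

/-- The classical bits that `maskedShareGates` writes on its output wires. -/
def sharedBits (k : Fin m ⊕ Fin m → Bool) (c : Bits l) (v : Fin n × Fin r → Bool) :
    (Fin m ⊕ Fin m) ⊕ (Fin n × Fin (l + r)) → Bool :=
  Sum.elim k fun q => Sum.elim c (fun j => v (q.1, j)) (finSumFinEquiv.symm q.2)

/-- Three nested calls. The kept state has independent indices in `k` and `k'` because it stays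
coherent, whereas the messages and the mask `c` are diagonal. -/
theorem kern_maskedShareGates (t t' : Bits d) (A U B : List Gate)
    (o o' : (Fin m ⊕ Fin m) ⊕ (Fin n × Fin (l + r)) → Bool) :
    kern (Fin 0 ⊕ Fin d) ((Fin m ⊕ Fin m) ⊕ (Fin n × Fin (l + r)))
        (maskedShareGates l d m s n r A U B) (Sum.elim ![] t) (Sum.elim ![] t') o o' =
      ∑ k : (Fin m ⊕ Fin m) ⊕ Fin s → Bool, ∑ k' : (Fin m ⊕ Fin m) ⊕ Fin s → Bool,
        kern (Fin 0 ⊕ Fin 0) ((Fin m ⊕ Fin m) ⊕ Fin s) A (Sum.elim ![] ![]) (Sum.elim ![] ![]) k k' *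
        if k ∘ Sum.inl = k' ∘ Sum.inl then
          ∑ c : Fin l ⊕ Fin 0 → Bool, kern (Fin 0 ⊕ Fin 0) (Fin l ⊕ Fin 0) U
            (Sum.elim ![] ![]) (Sum.elim ![] ![]) c c *
          ∑ v : Fin 0 ⊕ (Fin n × Fin r) → Bool, ∑ v' : Fin 0 ⊕ (Fin n × Fin r) → Bool,
            kern (Fin 0 ⊕ (Fin s ⊕ Fin (l + d))) (Fin 0 ⊕ (Fin n × Fin r)) B
              (Sum.elim ![] (Sum.elim (k ∘ Sum.inr)
                (Sum.elim (c ∘ Sum.inl) t ∘ finSumFinEquiv.symm)))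
              (Sum.elim ![] (Sum.elim (k' ∘ Sum.inr)
                (Sum.elim (c ∘ Sum.inl) t' ∘ finSumFinEquiv.symm))) v v' *
            if sharedBits (k ∘ Sum.inl) (c ∘ Sum.inl) (v ∘ Sum.inr) = o ∧
              sharedBits (k' ∘ Sum.inl) (c ∘ Sum.inl) (v' ∘ Sum.inr) = o' then 1 else 0
        else 0 := by
  classical
  have hz0 : ∀ t : Bits d, initConfig (Sum.elim (![] : Fin 0 → Bool) t) ∘ portMap choosePort =
      initConfig (Sum.elim (![] : Fin 0 → Bool) (![] : Fin 0 → Bool)) := by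
    intro t
    funext ⟨p, i, j⟩
    rw [initConfig_of_notMem _ (by rintro (c | c) <;> exact c.elim0), Function.comp_apply, portMap,
      initConfig_right, if_neg (by unfold choosePort; omega)]
  have hz1 : ∀ (t : Bits d) (w : Config), overwrite (portMap choosePort)
      (initConfig (Sum.elim (![] : Fin 0 → Bool) t)) w ∘ portMap maskPort =
      initConfig (Sum.elim (![] : Fin 0 → Bool) (![] : Fin 0 → Bool)) := by
    intro t w
    funext ⟨p, i, j⟩
    rw [initConfig_of_notMem _ (by rintro (c | c) <;> exact c.elim0), Function.comp_apply, portMap,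
      overwrite_choosePort, initConfig_right, if_neg (by unfold maskPort; omega),
      if_neg (by unfold maskPort; omega)]
  have hs : ∀ w : Config, (fun j : Fin s => w (1, 0, j)) =
      (w ∘ (Register.wire : (Fin m ⊕ Fin m) ⊕ Fin s → Wire)) ∘ Sum.inr := fun w => by
    funext j; simp [Register.wire]
  have hl : ∀ w : Config, (fun j : Fin l => w (0, 0, j)) =
      (w ∘ (Register.wire : Fin l ⊕ Fin 0 → Wire)) ∘ Sum.inl := fun w => by
    funext j; simp [Register.wire]
  rw [kern_eq_pull, maskedShareGates, pull_append]
  refine pull_call choosePort_injective A (hz0 t) (hz0 t') fun w w' => ?_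
  rw [pull_append]
  rw [pull_call maskPort_injective U (hz1 t w) (hz1 t' w')
    (h := fun c c' : Fin l ⊕ Fin 0 → Bool =>
      if AgreeOff (Register.wire : (Fin m ⊕ Fin m) ⊕ Fin s → Wire) w w' ∧
        (w ∘ (Register.wire : (Fin m ⊕ Fin m) ⊕ Fin s → Wire)) ∘ Sum.inl =
          (w' ∘ (Register.wire : (Fin m ⊕ Fin m) ⊕ Fin s → Wire)) ∘ Sum.inl then
      if c = c' then
        ∑ v : Fin 0 ⊕ (Fin n × Fin r) → Bool, ∑ v' : Fin 0 ⊕ (Fin n × Fin r) → Bool,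
          kern (Fin 0 ⊕ (Fin s ⊕ Fin (l + d))) (Fin 0 ⊕ (Fin n × Fin r)) B
            (Sum.elim ![] (Sum.elim ((w ∘ (Register.wire : (Fin m ⊕ Fin m) ⊕ Fin s → Wire)) ∘ Sum.inr)
              (Sum.elim (c ∘ Sum.inl) t ∘ finSumFinEquiv.symm)))
            (Sum.elim ![] (Sum.elim ((w' ∘ (Register.wire : (Fin m ⊕ Fin m) ⊕ Fin s → Wire)) ∘ Sum.inr)
              (Sum.elim (c ∘ Sum.inl) t' ∘ finSumFinEquiv.symm))) v v' *
          if sharedBits ((w ∘ (Register.wire : (Fin m ⊕ Fin m) ⊕ Fin s → Wire)) ∘ Sum.inl)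
              (c ∘ Sum.inl) (v ∘ Sum.inr) = o ∧
            sharedBits ((w' ∘ (Register.wire : (Fin m ⊕ Fin m) ⊕ Fin s → Wire)) ∘ Sum.inl)
              (c ∘ Sum.inl) (v' ∘ Sum.inr) = o' then 1 else 0
      else 0 else 0)]
  · unfold loc
    beta_reduce
    by_cases h1 : AgreeOff (Register.wire : (Fin m ⊕ Fin m) ⊕ Fin s → Wire) w w'
    · by_cases h2 : (w ∘ (Register.wire : (Fin m ⊕ Fin m) ⊕ Fin s → Wire)) ∘ Sum.inl =
          (w' ∘ (Register.wire : (Fin m ⊕ Fin m) ⊕ Fin s → Wire)) ∘ Sum.inl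
      · rw [if_pos h1, if_pos h2]
        refine Finset.sum_congr rfl fun c _ => ?_
        rw [Finset.sum_eq_single c]
        · rw [if_pos rfl, if_pos ⟨h1, h2⟩]
        · intro c' _ hc'
          rw [if_neg (Ne.symm hc'), ite_self, mul_zero]
        · simp
      · rw [if_pos h1, if_neg h2]
        simp [h2]
    · rw [if_neg h1]
      simp [h1]
  · intro u u'
    rw [pull_append, pull_moveGates (by omega), pull_append, pull_xorGates (by omega), pull_append,
      pull_xorGates (by omega), pull_append, pull_moveGates (by omega), pull_append,
      pull_xorGates (by omega), pull_append]
    change pull _ _ (shareConfig l m s t w u) (shareConfig l m s t' w' u') = _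
    -- The innermost form remembers the agreement conditions of both earlier calls.
    rw [pull_call sharePort_injective B (shareConfig_comp t w u) (shareConfig_comp t' w' u')
      (h := fun v v' : Fin 0 ⊕ (Fin n × Fin r) → Bool =>
        if (AgreeOff (Register.wire : (Fin m ⊕ Fin m) ⊕ Fin s → Wire) w w' ∧
          (w ∘ (Register.wire : (Fin m ⊕ Fin m) ⊕ Fin s → Wire)) ∘ Sum.inl =
            (w' ∘ (Register.wire : (Fin m ⊕ Fin m) ⊕ Fin s → Wire)) ∘ Sum.inl) ∧ u = u' then
        if sharedBits ((w ∘ (Register.wire : (Fin m ⊕ Fin m) ⊕ Fin s → Wire)) ∘ Sum.inl)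
            ((u ∘ (Register.wire : Fin l ⊕ Fin 0 → Wire)) ∘ Sum.inl) (v ∘ Sum.inr) = o ∧
          sharedBits ((w' ∘ (Register.wire : (Fin m ⊕ Fin m) ⊕ Fin s → Wire)) ∘ Sum.inl)
            ((u' ∘ (Register.wire : Fin l ⊕ Fin 0 → Wire)) ∘ Sum.inl) (v' ∘ Sum.inr) = o'
          then 1 else 0 else 0)]
    · unfold loc
      have hu := eq_iff_agreeOff (Register.wire : Fin l ⊕ Fin 0 → Wire) u u'
      by_cases h1 : AgreeOff (Register.wire : (Fin m ⊕ Fin m) ⊕ Fin s → Wire) w w' ∧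
        (w ∘ (Register.wire : (Fin m ⊕ Fin m) ⊕ Fin s → Wire)) ∘ Sum.inl =
          (w' ∘ (Register.wire : (Fin m ⊕ Fin m) ⊕ Fin s → Wire)) ∘ Sum.inl
      · by_cases h2 : u = u'
        · subst h2
          rw [if_pos (hu.1 rfl).1]
          beta_reduce
          rw [if_pos h1, if_pos rfl]
          simp only [hs, hl, and_true, if_pos h1]
        · beta_reduce
          simp only [if_neg fun h : _ ∧ u = u' => h2 h.2, mul_zero, Finset.sum_const_zero]
          split_ifs with h3 h4 <;> first | rfl | exact absurd (hu.2 ⟨h3, h4⟩) h2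
      · beta_reduce
        simp only [if_neg fun h : _ ∧ u = u' => h1 h.1, if_neg h1, mul_zero, Finset.sum_const_zero,
          ite_self]
    · intro v v'
      rw [pull_append, pull_xorGates (by omega), pull_moveGates (by omega)]
      change loc _ _ (sharedConfig l m s n r t w u v) (sharedConfig l m s n r t' w' u' v') = _
      unfold loc
      rw [sharedConfig_comp, sharedConfig_comp]
      have key := agreeOff_sharedConfig (l := l) (m := m) (s := s) (n := n) (r := r) t t' w w' u u' v v'
      by_cases h1 : (AgreeOff (Register.wire : (Fin m ⊕ Fin m) ⊕ Fin s → Wire) w w' ∧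
        (w ∘ (Register.wire : (Fin m ⊕ Fin m) ⊕ Fin s → Wire)) ∘ Sum.inl =
          (w' ∘ (Register.wire : (Fin m ⊕ Fin m) ⊕ Fin s → Wire)) ∘ Sum.inl) ∧ u = u'
      · by_cases h2 : AgreeOff (Register.wire : Fin 0 ⊕ (Fin n × Fin r) → Wire) v v'
        · rw [if_pos (key.2 ⟨h1, h2⟩), if_pos h2]
          beta_reduce
          rw [if_pos h1]
          rfl
        · rw [if_neg fun h => h2 (key.1 h).2, if_neg h2]
      · rw [if_neg fun h => h1 (key.1 h).1]
        beta_reduce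
        rw [if_neg h1, ite_self]

end

/-! ### Sums over concatenated bit strings, and the circuit of the first stage of the reduction -/

theorem sum_append {a b : ℕ} {M : Type*} [AddCommMonoid M] (h : Bits (a + b) → M) :
    ∑ g, h g = ∑ x : Bits a, ∑ y : Bits b, h (Sum.elim x y ∘ finSumFinEquiv.symm) := by
  rw [← sum_sum_type fun z : Fin a ⊕ Fin b → Bool => h (z ∘ finSumFinEquiv.symm)]
  refine Fintype.sum_equiv (finSumFinEquiv.symm.arrowCongr (Equiv.refl Bool)) _ _ fun g => ?_
  congr 1
  funext j
  simp [Equiv.arrowCongr]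

theorem join_append {a b : ℕ} (ρ : Op (Fin a ⊕ Fin b)) (z z' : Fin a ⊕ Fin b → Bool) :
    join ρ (z ∘ finSumFinEquiv.symm) (z' ∘ finSumFinEquiv.symm) = ρ z z' := by
  simp [join, Function.comp_assoc]

theorem sum_join_tensor_basisState {l d : ℕ} (c : Bits l) (ρ : Op (Fin d))
    (h : Bits (l + d) → Bits (l + d) → ℂ) :
    ∑ g, ∑ g', join (tensor (basisState c) ρ) g g' * h g g' =
      ∑ t, ∑ t', ρ t t' * h (Sum.elim c t ∘ finSumFinEquiv.symm)
        (Sum.elim c t' ∘ finSumFinEquiv.symm) := by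
  simp only [sum_append, join_append, tensor, basisState, Matrix.of_apply, Sum.elim_comp_inl,
    Sum.elim_comp_inr, Matrix.single_apply]
  rw [Finset.sum_eq_single c]
  · refine Finset.sum_congr rfl fun t _ => ?_
    rw [Finset.sum_eq_single c]
    · simp
    · intro c' _ hc'
      simp [Ne.symm hc']
    · simp
  · intro c' _ hc'
    simp [Ne.symm hc']
  · simp

section

variable {l d m s n r : ℕ}

theorem sharedBits_eq_iff {k : Fin m ⊕ Fin m → Bool} {c : Bits l} {v : Fin n × Fin r → Bool}
    {y : Fin m ⊕ Fin m → Bool} {z : Fin n × Fin (l + r) → Bool} :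
    sharedBits k c v = Sum.elim y z ↔
      k = y ∧ (∀ i, (fun j => z (i, Fin.castAdd r j)) = c) ∧
        v = fun q => z (q.1, Fin.natAdd l q.2) := by
  constructor
  · intro h
    have h' : ∀ q, Sum.elim c (fun j => v (q.1, j)) (finSumFinEquiv.symm q.2) = z q :=
      fun q => congrFun h (.inr q)
    refine ⟨?_, fun i => ?_, ?_⟩
    · simpa [sharedBits] using congrArg (· ∘ Sum.inl) h
    · funext j
      simp [← h']
    · funext q
      simp [← h']
  · rintro ⟨rfl, h, rfl⟩
    unfold sharedBits
    congr 1
    funext ⟨i, j⟩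
    obtain ⟨j, rfl⟩ := finSumFinEquiv.surjective j
    rcases j with j | j
    · simp [← h i]
    · simp

/-- The kernel of `maskedShareGates` for given outputs, when `U` samples a uniform bit string. -/
theorem kern_maskedShareGates_uniform (t t' : Bits d) {A U B : List Gate}
    (hU : Implements U fun (_ : Fin 0 → Bool) (ρ : Op (Fin 0)) (_ : Bits l) => (1 / 2 ^ l : ℂ) • ρ)
    (y : Fin m ⊕ Fin m → Bool) (z z' : Fin n × Fin (l + r) → Bool) :
    kern (Fin 0 ⊕ Fin d) ((Fin m ⊕ Fin m) ⊕ (Fin n × Fin (l + r)))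
        (maskedShareGates l d m s n r A U B) (Sum.elim ![] t) (Sum.elim ![] t') (Sum.elim y z)
          (Sum.elim y z') =
      ∑ f : Bits s, ∑ f' : Bits s,
        kern (Fin 0 ⊕ Fin 0) ((Fin m ⊕ Fin m) ⊕ Fin s) A (Sum.elim ![] ![]) (Sum.elim ![] ![])
          (Sum.elim y f) (Sum.elim y f') *
        ∑ c : Bits l, (1 / 2 ^ l : ℂ) *
          if (∀ i, (fun j => z (i, Fin.castAdd r j)) = c) ∧
              ∀ i, (fun j => z' (i, Fin.castAdd r j)) = c then
            kern (Fin 0 ⊕ (Fin s ⊕ Fin (l + d))) (Fin 0 ⊕ (Fin n × Fin r)) B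
              (Sum.elim ![] (Sum.elim f (Sum.elim c t ∘ finSumFinEquiv.symm)))
              (Sum.elim ![] (Sum.elim f' (Sum.elim c t' ∘ finSumFinEquiv.symm)))
              (Sum.elim ![] fun q => z (q.1, Fin.natAdd l q.2))
              (Sum.elim ![] fun q => z' (q.1, Fin.natAdd l q.2))
          else 0 := by
  have hu : ∀ c : Bits l, kern (Fin 0 ⊕ Fin 0) (Fin l ⊕ Fin 0) U (Sum.elim ![] ![])
      (Sum.elim ![] ![]) (Sum.elim c ![]) (Sum.elim c ![]) = 1 / 2 ^ l := by
    intro c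
    simpa using (implements_zero_apply hU ![] 1 c ![] ![]).symm
  rw [kern_maskedShareGates]
  simp only [sum_sum_type (α := Fin m ⊕ Fin m), sum_sum_type (α := Fin l) (β := Fin 0),
    sum_sum_type (α := Fin 0) (β := Fin n × Fin r), sum_fin_zero,
    Sum.elim_comp_inl, Sum.elim_comp_inr, hu, sharedBits_eq_iff]
  rw [Finset.sum_eq_single y]
  · refine Finset.sum_congr rfl fun f _ => ?_
    rw [Finset.sum_eq_single y]
    · refine Finset.sum_congr rfl fun f' _ => ?_
      refine congrArg (HMul.hMul _) ((if_pos rfl).trans ?_)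
      refine Finset.sum_congr rfl fun c _ => congrArg (HMul.hMul _) ?_
      rw [Finset.sum_eq_single fun q => z (q.1, Fin.natAdd l q.2)]
      · rw [Finset.sum_eq_single fun q => z' (q.1, Fin.natAdd l q.2)]
        · simp
        · intro v _ hv
          simp [hv]
        · simp
      · intro v _ hv
        simp [hv]
      · simp
    · intro y' _ hy'
      simp [hy'.symm]
    · simp
  · intro y' _ hy'
    simp [hy']
  · simp

theorem implements_maskedShareGates {A U B : List Gate}
    {Choose : QAlg (Fin 0) (Fin 0) (Fin m ⊕ Fin m) (Fin s)}
    {Share : QAlg (Fin 0) (Fin s ⊕ Fin (l + d)) (Fin 0) (Fin n × Fin r)}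
    (hA : Implements A Choose)
    (hU : Implements U fun (_ : Fin 0 → Bool) (ρ : Op (Fin 0)) (_ : Bits l) => (1 / 2 ^ l : ℂ) • ρ)
    (hB : Implements B Share) :
    Implements (maskedShareGates l d m s n r A U B) (maskedShare Choose Share) := by
  rw [implements_iff]
  intro x ρ y z z'
  obtain rfl : x = ![] := Subsingleton.elim _ _
  -- The input of `Share` is a product in which `c` is a basis state, so only the sums over the kept
  -- state and over the quantum input survive.
  have hshare : ∀ (c : Bits l) (v v' : Fin n × Fin r → Bool),
      Share ![] (tensor (Choose ![] 1 y) (join (tensor (basisState c) ρ))) ![] v v' =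
        ∑ t, ∑ t', ρ t t' * ∑ f : Bits s, ∑ f' : Bits s,
        kern (Fin 0 ⊕ Fin 0) ((Fin m ⊕ Fin m) ⊕ Fin s) A (Sum.elim ![] ![]) (Sum.elim ![] ![])
          (Sum.elim y f) (Sum.elim y f') *
        kern (Fin 0 ⊕ (Fin s ⊕ Fin (l + d))) (Fin 0 ⊕ (Fin n × Fin r)) B
          (Sum.elim ![] (Sum.elim f (Sum.elim c t ∘ finSumFinEquiv.symm)))
          (Sum.elim ![] (Sum.elim f' (Sum.elim c t' ∘ finSumFinEquiv.symm)))
          (Sum.elim ![] v) (Sum.elim ![] v') := by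
    intro c v v'
    rw [← sum_join_tensor_basisState c ρ fun g g' => ∑ f : Bits s, ∑ f' : Bits s,
        kern (Fin 0 ⊕ Fin 0) ((Fin m ⊕ Fin m) ⊕ Fin s) A (Sum.elim ![] ![]) (Sum.elim ![] ![])
          (Sum.elim y f) (Sum.elim y f') *
        kern (Fin 0 ⊕ (Fin s ⊕ Fin (l + d))) (Fin 0 ⊕ (Fin n × Fin r)) B
          (Sum.elim ![] (Sum.elim f g)) (Sum.elim ![] (Sum.elim f' g'))
          (Sum.elim ![] v) (Sum.elim ![] v'), implements_iff.1 hB]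
    simp only [sum_sum_type (α := Fin s), tensor, Matrix.of_apply, Sum.elim_comp_inl,
      Sum.elim_comp_inr, implements_zero_apply hA, Matrix.one_apply_eq, one_mul, Finset.mul_sum]
    rw [Finset.sum_comm]
    refine Finset.sum_congr rfl fun g _ => ?_
    rw [Finset.sum_comm (γ := Bits (l + d))]
    refine Finset.sum_congr rfl fun f _ => ?_
    rw [Finset.sum_comm]
    refine Finset.sum_congr rfl fun g' _ => Finset.sum_congr rfl fun f' _ => ?_
    ring
  simp only [maskedShare, Matrix.sum_apply, Matrix.smul_apply, attach, Matrix.of_apply, hshare,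
    kern_maskedShareGates_uniform _ _ hU, smul_eq_mul]
  have hcomm : ∀ g : Bits l → Bits d → Bits d → Bits s → Bits s → ℂ,
      ∑ t, ∑ t', ∑ f, ∑ f', ∑ c, g c t t' f f' = ∑ c, ∑ t, ∑ t', ∑ f, ∑ f', g c t t' f f' := by
    intro g
    rw [Finset.sum_comm (γ := Bits l)]
    refine Finset.sum_congr rfl fun t _ => ?_
    rw [Finset.sum_comm (γ := Bits l)]
    refine Finset.sum_congr rfl fun t' _ => ?_
    rw [Finset.sum_comm (γ := Bits l)]
    refine Finset.sum_congr rfl fun f _ => ?_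
    rw [Finset.sum_comm]
  simp only [Finset.mul_sum (s := (Finset.univ : Finset (Bits s))),
    Finset.mul_sum (s := (Finset.univ : Finset (Bits l)))]
  rw [hcomm]
  refine Finset.sum_congr rfl fun c _ => ?_
  split_ifs with h
  · simp only [Finset.mul_sum]
    refine Finset.sum_congr rfl fun t _ => Finset.sum_congr rfl fun t' _ =>
      Finset.sum_congr rfl fun f _ => Finset.sum_congr rfl fun f' _ => ?_
    ring
  · simp

end

theorem isQPT_maskedShare {l d m s n r : ℕ → ℕ} (hl : PolyTimeLength l) (hd : PolyTimeLength d)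
    (hm : PolyTimeLength m) (hs : PolyTimeLength s) (hn : PolyTimeLength n) (hr : PolyTimeLength r)
    {Choose : ∀ κ, QAlg (Fin 0) (Fin 0) (Fin (m κ) ⊕ Fin (m κ)) (Fin (s κ))}
    {Share : ∀ κ, QAlg (Fin 0) (Fin (s κ) ⊕ Fin (l κ + d κ)) (Fin 0) (Fin (n κ) × Fin (r κ))}
    (hChoose : IsQPT Choose) (hShare : IsQPT Share) :
    IsQPT (fun κ => maskedShare (Choose κ) (Share κ)) := by
  have hfs : ∀ f ∈ [l, d, m, s, n, r], PolyTimeLength f := by simp [hl, hd, hm, hs, hn, hr]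
  have z₇ := holds_zero [l, d, m, s, n, r] (s := 7) (by simp)
  have z₈ := holds_zero [l, d, m, s, n, r] (s := 8) (by simp)
  have one := holds_one [l, d, m, s, n, r]
  have ll := holds_length hfs 0 (by simp)
  have ld := holds_length hfs 1 (by simp)
  have lm := holds_length hfs 2 (by simp)
  have ls := holds_length hfs 3 (by simp)
  have ln := holds_length hfs 4 (by simp)
  have lr := holds_length hfs 5 (by simp)
  refine ((Compiles.prelude (n := fun _ => 1) [l, d, m, s, n, r] hfs).seq
    ((Compiles.call hChoose (.const 1) choosePort [l, d, m, s, n, r] (by simp)).seq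
    ((Compiles.call (isQPT_uniform hl) (.const 1) maskPort [l, d, m, s, n, r] (by simp)).seq
    ((Compiles.move 1 z₇ 13 ll one ld (by simp)).seq
    ((Compiles.xor 3 true z₇ 0 z₈ one lm (by simp)).seq
    ((Compiles.xor 9 true z₇ 2 z₈ one lm (by simp)).seq
    ((Compiles.move 6 z₇ 7 z₈ one ls (by simp)).seq
    ((Compiles.xor 5 true z₇ 13 z₈ one ll (by simp)).seq
    ((Compiles.call hShare (.const 1) sharePort [l, d, m, s, n, r] (by simp)).seq
    ((Compiles.xor 5 false z₇ 1 z₈ ln ll (by simp)).seq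
    (Compiles.move 7 z₇ 1 ll ln lr (by simp)))))))))))).isQPTFamily ?_
  rintro κ i _ ⟨_, _, rfl, ⟨_, _, ⟨A, hA, rfl⟩, ⟨_, _, ⟨U, hU, rfl⟩, ⟨_, _, rfl, ⟨_, _, rfl,
    ⟨_, _, rfl, ⟨_, _, rfl, ⟨_, _, rfl, ⟨_, _, ⟨B, hB, rfl⟩, ⟨_, _, rfl, rfl, rfl⟩, rfl⟩, rfl⟩,
    rfl⟩, rfl⟩, rfl⟩, rfl⟩, rfl⟩, rfl⟩, rfl⟩
  exact implements_maskedShareGates hA hU hB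

/-! ## Linearity of algorithms and of operations on registers -/

/-- The algorithm acts linearly on the quantum input. -/
def ActsLinearly {α β γ δ : Type} (F : QAlg α β γ δ) : Prop :=
  ∃ L : (α → Bool) → (γ → Bool) → Op β →ₗ[ℂ] Op δ, F = fun x ρ y => L x y ρ

/-- A `QAlg` is an arbitrary function of the density matrix; linearity comes from being given by a
circuit. It is what allows mixtures to be taken out of the algorithms of schemes and adversaries. -/
theorem Implements.actsLinearly {α β γ δ : Type} [Fintype α] [DecidableEq α] [Register α]
    [Fintype β] [DecidableEq β] [Register β] [Fintype γ] [Register γ] [Fintype δ] [Register δ]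
    {C : List Gate} {F : QAlg α β γ δ} (hC : Implements C F) : ActsLinearly F := by
  refine ⟨fun x y => { toFun := fun ρ => F x ρ y, map_add' := ?_, map_smul' := ?_ }, rfl⟩
  · intro ρ σ
    ext d d'
    simp only [Matrix.add_apply, implements_iff.1 hC, add_mul, Finset.sum_add_distrib]
  · intro c ρ
    ext d d'
    simp only [Matrix.smul_apply, implements_iff.1 hC, smul_eq_mul, Finset.mul_sum, mul_assoc,
      RingHom.id_apply]

theorem IsQPTFamily.exists_implements {n : ℕ → ℕ} {α β γ δ : ℕ → Type}
    [∀ κ, Fintype (α κ)] [∀ κ, DecidableEq (α κ)] [∀ κ, Register (α κ)]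
    [∀ κ, Fintype (β κ)] [∀ κ, DecidableEq (β κ)] [∀ κ, Register (β κ)]
    [∀ κ, Fintype (γ κ)] [∀ κ, Register (γ κ)] [∀ κ, Fintype (δ κ)] [∀ κ, Register (δ κ)]
    {F : ∀ κ, Fin (n κ) → QAlg (α κ) (β κ) (γ κ) (δ κ)} (hF : IsQPTFamily F) (κ : ℕ)
    (i : Fin (n κ)) : ∃ C, Implements C (F κ i) := by
  obtain ⟨P, p, h⟩ := hF
  obtain ⟨C, t, σ, -, -, hC⟩ := h κ i
  exact ⟨C, hC⟩

theorem IsQPT.exists_implements {α β γ δ : ℕ → Type}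
    [∀ κ, Fintype (α κ)] [∀ κ, DecidableEq (α κ)] [∀ κ, Register (α κ)]
    [∀ κ, Fintype (β κ)] [∀ κ, DecidableEq (β κ)] [∀ κ, Register (β κ)]
    [∀ κ, Fintype (γ κ)] [∀ κ, Register (γ κ)] [∀ κ, Fintype (δ κ)] [∀ κ, Register (δ κ)]
    {F : ∀ κ, QAlg (α κ) (β κ) (γ κ) (δ κ)} (hF : IsQPT F) (κ : ℕ) : ∃ C, Implements C (F κ) :=
  IsQPTFamily.exists_implements hF κ 0

theorem IsQPTFamily.actsLinearly {n : ℕ → ℕ} {α β γ δ : ℕ → Type}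
    [∀ κ, Fintype (α κ)] [∀ κ, DecidableEq (α κ)] [∀ κ, Register (α κ)]
    [∀ κ, Fintype (β κ)] [∀ κ, DecidableEq (β κ)] [∀ κ, Register (β κ)]
    [∀ κ, Fintype (γ κ)] [∀ κ, Register (γ κ)] [∀ κ, Fintype (δ κ)] [∀ κ, Register (δ κ)]
    {F : ∀ κ, Fin (n κ) → QAlg (α κ) (β κ) (γ κ) (δ κ)} (hF : IsQPTFamily F) (κ : ℕ)
    (i : Fin (n κ)) : ActsLinearly (F κ i) :=
  (hF.exists_implements κ i).elim fun _ hC => hC.actsLinearly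

/-- The linear map `σ ↦ ρ ⊗ σ`. -/
def tensorMap {α β : Type} (ρ : Op α) : Op β →ₗ[ℂ] Op (α ⊕ β) where
  toFun := tensor ρ
  map_add' σ τ := by ext; simp [tensor, mul_add]
  map_smul' c σ := by ext; simp [tensor, mul_left_comm]

/-- The partial trace over all registers but one, as a linear map. -/
noncomputable def reducedMap {n r : ℕ} (i : Fin n) : Op (Fin n × Fin r) →ₗ[ℂ] Op (Fin r) where
  toFun := reduced i
  map_add' σ τ := by
    ext
    simp only [reduced, Matrix.of_apply, Matrix.add_apply, ← Finset.sum_add_distrib]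
    refine Finset.sum_congr rfl fun z _ => ?_
    split_ifs <;> simp
  map_smul' c σ := by
    ext
    simp only [reduced, Matrix.of_apply, Matrix.smul_apply, smul_eq_mul, Finset.mul_sum,
      RingHom.id_apply, mul_ite, mul_zero]

/-- The measurement of the first part of a register, as a linear map. -/
def measureMap {a b : ℕ} (c : Bits a) : Op (Fin (a + b)) →ₗ[ℂ] Op (Fin b) where
  toFun ρ := afterOutcome (unjoin ρ) c
  map_add' _ _ := rfl
  map_smul' _ _ := rfl

/-- Measuring a prefix that is already classical returns it with certainty and leaves the rest
undisturbed. -/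
theorem afterOutcome_unjoin_join {a b : ℕ} (c c' : Bits a) (σ : Op (Fin b)) :
    afterOutcome (unjoin (join (tensor (basisState c) σ))) c' = if c = c' then σ else 0 := by
  ext y z
  have : afterOutcome (unjoin (join (tensor (basisState c) σ))) c' y z =
      join (tensor (basisState c) σ) (Sum.elim c' y ∘ finSumFinEquiv.symm)
        (Sum.elim c' z ∘ finSumFinEquiv.symm) := rfl
  rw [this, join_append]
  by_cases h : c = c' <;> simp [tensor, basisState, h]

theorem tensor_zero_left {α β : Type} (σ : Op β) : tensor (0 : Op α) σ = 0 := by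
  ext
  simp [tensor]

theorem attach_zero {n l r : ℕ} (c : Bits l) : attach c (0 : Op (Fin n × Fin r)) = 0 := by
  ext
  simp [attach]

/-- The assignment that places `c` in front of each block of `w`. -/
def prepend {n l r : ℕ} (c : Bits l) (w : Fin n × Fin r → Bool) : Fin n × Fin (l + r) → Bool :=
  fun q => Sum.elim c (fun j => w (q.1, j)) (finSumFinEquiv.symm q.2)

theorem prepend_castAdd {n l r : ℕ} (c : Bits l) (w : Fin n × Fin r → Bool) (i : Fin n)
    (j : Fin l) : prepend c w (i, Fin.castAdd r j) = c j := by
  simp [prepend]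

theorem prepend_natAdd {n l r : ℕ} (c : Bits l) (w : Fin n × Fin r → Bool) (i : Fin n)
    (j : Fin r) : prepend c w (i, Fin.natAdd l j) = w (i, j) := by
  simp [prepend]

theorem eq_prepend {n l r : ℕ} {c : Bits l} {z : Fin n × Fin (l + r) → Bool}
    (h : ∀ i, (fun j => z (i, Fin.castAdd r j)) = c) :
    z = prepend c fun q => z (q.1, Fin.natAdd l q.2) := by
  funext ⟨i, j⟩
  obtain ⟨j, rfl⟩ := finSumFinEquiv.surjective j
  rcases j with j | j
  · simp [prepend, ← h i]
  · simp [prepend]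

theorem prepend_injective {n l r : ℕ} (c : Bits l) :
    Function.Injective (prepend c : (Fin n × Fin r → Bool) → _) := by
  intro w w' h
  funext ⟨i, j⟩
  rw [← prepend_natAdd c w, ← prepend_natAdd c w', h]

/-- All prefixes are the same fixed basis string. Tracing out the other registers together with
their copies of `c` therefore leaves one copy, in product with the reduced state. -/
theorem reduced_attach {n l r : ℕ} (i : Fin n) (c : Bits l) (σ : Op (Fin n × Fin r)) :
    reduced i (attach c σ) = join (tensor (basisState c) (reduced i σ)) := by
  ext x y
  rw [join_tensor_basisState_apply, reduced, Matrix.of_apply]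
  -- `attach` vanishes unless every block starts with `c`, so the trace runs only over the range of
  -- `prepend c`.
  rw [← Fintype.sum_of_injective (prepend c) (prepend_injective c)
    (fun w => if (fun j => x (Fin.castAdd r j)) = c ∧ (fun j => y (Fin.castAdd r j)) = c then
      if (fun j => w (i, j)) = fun j => x (Fin.natAdd l j) then
        σ w (fun q => if q.1 = i then y (Fin.natAdd l q.2) else w q) else 0 else 0)]
  · split_ifs with h <;> simp [reduced]
  · intro z hz
    have : ¬ ∀ i, (fun j => z (i, Fin.castAdd r j)) = c := fun h => hz ⟨_, (eq_prepend h).symm⟩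
    simp [attach, this]
  · intro w
    have h1 : (fun j => prepend c w (i, j)) = x ↔
        (fun j => x (Fin.castAdd r j)) = c ∧ (fun j => w (i, j)) = fun j => x (Fin.natAdd l j) := by
      constructor
      · rintro rfl
        exact ⟨funext fun j => prepend_castAdd c w i j,
          funext fun j => (prepend_natAdd c w i j).symm⟩
      · rintro ⟨h, h'⟩
        funext j
        obtain ⟨j, rfl⟩ := finSumFinEquiv.surjective j
        rcases j with j | j
        · rw [finSumFinEquiv_apply_left, prepend_castAdd, ← h]
        · rw [finSumFinEquiv_apply_right, prepend_natAdd, congrFun h' j]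
    -- In the second index only block `i` is replaced by `y`; the others carry `c` already.
    have h2 : (∀ k : Fin n, (fun j : Fin l => if k = i then y (Fin.castAdd r j) else
        prepend c w (k, Fin.castAdd r j)) = c) ↔ (fun j => y (Fin.castAdd r j)) = c := by
      constructor
      · intro h
        simpa using h i
      · intro h k
        split_ifs
        · exact h
        · exact funext fun j => prepend_castAdd c w k j
    have h3 : ∀ k : Fin n, (fun j : Fin l => prepend c w (k, Fin.castAdd r j)) = c :=
      fun k => funext fun j => prepend_castAdd c w k j
    simp only [attach, Matrix.of_apply, h1, h2, h3, implies_true, prepend_natAdd,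
      ite_and]
    split_ifs <;> rfl

/-! ## Probabilities of linear combinations -/

theorem pr_sum {α ι : Type} [Fintype α] [DecidableEq α] (s : Finset ι) (f : ι → Op α) :
    pr (∑ i ∈ s, f i) = ∑ i ∈ s, pr (f i) := by
  simp [pr, Matrix.trace_sum]

theorem pr_ofReal_smul {α : Type} [Fintype α] [DecidableEq α] (c : ℝ) (ρ : Op α) :
    pr ((c : ℂ) • ρ) = c * pr ρ := by
  simp [pr, Matrix.trace_smul]

theorem pr_uniform_smul {α : Type} [Fintype α] [DecidableEq α] (l : ℕ) (ρ : Op α) :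
    pr ((1 / 2 ^ l : ℂ) • ρ) = 1 / 2 ^ l * pr ρ := by
  rw [← pr_ofReal_smul]
  push_cast
  rfl

theorem pr_one_fin_zero : pr (1 : Op (Fin 0)) = 1 := by
  simp [pr_fin_zero]

/-! ## Bitwise exclusive or -/

theorem bitXor_bitXor_cancel {n : ℕ} (x y : Bits n) : bitXor (bitXor x y) y = x := by
  funext j
  simp [bitXor]

theorem bitXor_bitXor_cancel_left {n : ℕ} (x y : Bits n) : bitXor (bitXor x y) x = y := by
  funext j
  simp [bitXor, Bool.xor_comm (x j) (y j)]

/-- The one-time pad: adding a fixed string is an involution, hence a permutation of the masks. -/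
theorem sum_bitXor {n : ℕ} {M : Type*} [AddCommMonoid M] (x : Bits n) (f : Bits n → M) :
    ∑ y, f (bitXor x y) = ∑ y, f y :=
  Fintype.sum_bijective (bitXor x) (Function.Involutive.bijective fun y => by
    funext j; simp [bitXor]) _ _ fun _ => rfl

theorem sum_uniform (l : ℕ) (a : ℝ) : ∑ _ : Bits l, 1 / 2 ^ l * a = a := by
  simp

/-! ## The identity -/

theorem implements_nil (r : ℕ) :
    Implements [] (fun _ ρ _ => ρ : QAlg (Fin 0) (Fin r) (Fin 0) (Fin r)) := by
  rw [implements_iff]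
  intro x ρ y d d'
  obtain rfl : x = y := Subsingleton.elim _ _
  have hoff : ∀ b b' : Fin r → Bool, AgreeOff (Register.wire : Fin 0 ⊕ Fin r → Wire)
      (initConfig (Sum.elim x b)) (initConfig (Sum.elim x b')) := fun b b' v hv => by
    rw [initConfig_of_notMem _ hv, initConfig_of_notMem _ hv]
  have hin : ∀ b : Fin r → Bool, initConfig (Sum.elim x b) ∘ Register.wire = Sum.elim x b :=
    fun b => funext fun a => initConfig_wire _ a
  have hel : ∀ b b' : Fin r → Bool, Sum.elim x b = Sum.elim x b' ↔ b = b' := fun b b' =>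
    ⟨fun h => by simpa using congrArg (· ∘ Sum.inr) h, fun h => h ▸ rfl⟩
  simp only [kern_eq_pull, pull_nil, loc, if_pos (hoff _ _), hin, hel]
  simp [ite_and]

theorem isQPTFamily_id {n r : ℕ → ℕ} :
    IsQPTFamily (fun κ (_ : Fin (n κ)) =>
      (fun _ ρ _ => ρ : QAlg (Fin 0) (Fin (r κ)) (Fin 0) (Fin (r κ)))) :=
  ⟨.skip, 1, fun κ i => ⟨[], 1, _, .skip _, by simp, implements_nil _⟩⟩

/-! ## The transformed scheme -/

section

variable {l m k d : ℕ} {KG : QAlg (Fin 0) (Fin 0) (Fin k) (Fin d)}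
  {Enc : QAlg (Fin k ⊕ Fin m) (Fin 0) (Fin l) (Fin 0)}

/-- A linear map applied to an encryption. -/
theorem pr_map_maskedEnc {δ : Type} [Fintype δ] [DecidableEq δ] (L : Op (Fin (l + d)) →ₗ[ℂ] Op δ)
    (u : Bits l) (x : Bits m) :
    pr (L (maskedEnc KG Enc (Sum.elim u x) 1 ![])) = ∑ ek, ∑ ct, pr (Enc (Sum.elim ek x) 1 ct) *
      pr (L (join (tensor (basisState (bitXor ct u)) (KG ![] 1 ek)))) := by
  simp only [maskedEnc, map_sum, map_smul, pr_sum, pr_ofReal_smul, Sum.elim_comp_inl,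
    Sum.elim_comp_inr]

/-- The linear map that unmasks and runs a family of linear maps. -/
noncomputable def unmaskMap {ι γ : Type} (e : Fin l → ι)
    (G : Bits l → (γ → Bool) → Op (Fin d) →ₗ[ℂ] Op (Fin 0)) (x : ι → Bool) (y : γ → Bool) :
    Op (Fin (l + d)) →ₗ[ℂ] Op (Fin 0) :=
  ∑ c : Bits l, (G (bitXor c (x ∘ e)) y).comp (measureMap c)

theorem unmaskMap_apply {ι γ : Type} (e : Fin l → ι)
    (G : Bits l → (γ → Bool) → Op (Fin d) →ₗ[ℂ] Op (Fin 0)) (x : ι → Bool) (y : γ → Bool)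
    (ρ : Op (Fin (l + d))) :
    unmask e (fun x ρ y => G x y ρ) x ρ y = unmaskMap e G x y ρ := by
  rw [unmaskMap, LinearMap.sum_apply]
  rfl

theorem unmaskMap_join {ι γ : Type} (e : Fin l → ι)
    (G : Bits l → (γ → Bool) → Op (Fin d) →ₗ[ℂ] Op (Fin 0)) (x : ι → Bool) (y : γ → Bool)
    (c : Bits l) (σ : Op (Fin d)) :
    unmaskMap e G x y (join (tensor (basisState c) σ)) = G (bitXor c (x ∘ e)) y σ := by
  simp only [← unmaskMap_apply, unmask, afterOutcome_unjoin_join]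
  rw [Finset.sum_eq_single c]
  · rw [if_pos rfl]
  · intro c' _ hc'
    rw [if_neg hc'.symm, map_zero]
  · simp

/-- Decryption with the mask that was used for the encryption. -/
theorem pr_unmask_maskedEnc {γ : Type} {Dec : QAlg (Fin l) (Fin d) γ (Fin 0)}
    (hDec : ActsLinearly Dec) (u : Bits l) (x : Bits m) (y : γ → Bool) :
    pr (unmask id Dec u (maskedEnc KG Enc (Sum.elim u x) 1 ![]) y) =
      ∑ ek, ∑ ct, pr (Enc (Sum.elim ek x) 1 ct) * pr (Dec ct (KG ![] 1 ek) y) := by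
  obtain ⟨L, rfl⟩ := hDec
  rw [unmaskMap_apply, pr_map_maskedEnc]
  simp only [unmaskMap_join, Function.comp_id, bitXor_bitXor_cancel]

variable {n r s : ℕ} {Choose : QAlg (Fin 0) (Fin 0) (Fin m ⊕ Fin m) (Fin s)}
  {Share : QAlg (Fin 0) (Fin s ⊕ Fin (l + d)) (Fin 0) (Fin n × Fin r)}

theorem maskedShare_eq_zero (hShare : ActsLinearly Share) {y : Fin m ⊕ Fin m → Bool}
    (h : Choose ![] 1 y = 0) (ρ : Op (Fin d)) : maskedShare Choose Share ![] ρ y = 0 := by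
  obtain ⟨L, rfl⟩ := hShare
  simp [maskedShare, h, tensor_zero_left, attach_zero]

/-- An algorithm that runs on one of the registers prepared from a masked encryption. -/
theorem pr_reduced_maskedEnc {γ : Type} {G : QAlg (Fin l) (Fin r) γ (Fin 0)}
    (hShare : ActsLinearly Share) (hG : ActsLinearly G) (i : Fin n) (σ : Op (Fin s)) (u : Bits l)
    (x : Bits m) (y : γ → Bool) :
    pr (G u (reduced i (Share ![] (tensor σ (maskedEnc KG Enc (Sum.elim u x) 1 ![])) ![])) y) =
      ∑ ek, ∑ ct, pr (Enc (Sum.elim ek x) 1 ct) * pr (G u (reduced i (Share ![] (tensor σ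
        (join (tensor (basisState (bitXor ct u)) (KG ![] 1 ek)))) ![])) y) := by
  obtain ⟨L, rfl⟩ := hShare
  obtain ⟨M, rfl⟩ := hG
  exact pr_map_maskedEnc (M u y ∘ₗ reducedMap i ∘ₗ L ![] ![] ∘ₗ tensorMap σ) u x

/-- An algorithm that runs on one of the registers handed out by `maskedShare`. -/
theorem pr_unmask_maskedShare {γ : Type} {G : QAlg (Fin l) (Fin r) γ (Fin 0)}
    (hG : ActsLinearly G) (i : Fin n) (ρ : Op (Fin d)) (u : Bits 0) (ct : Bits l)
    (z : Fin m ⊕ Fin m → Bool) (y : γ → Bool) :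
    pr (unmask Sum.inr G (Sum.elim u ct) (reduced i (maskedShare Choose Share ![] ρ z)) y) =
      ∑ uk, 1 / 2 ^ l * pr (G uk (reduced i (Share ![] (tensor (Choose ![] 1 z)
        (join (tensor (basisState (bitXor ct uk)) ρ))) ![])) y) := by
  obtain ⟨M, rfl⟩ := hG
  rw [unmaskMap_apply]
  change pr ((unmaskMap _ M _ y ∘ₗ reducedMap i) (maskedShare Choose Share ![] ρ z)) = _
  simp only [maskedShare, map_sum, map_smul, pr_sum, pr_uniform_smul, LinearMap.comp_apply]
  -- The heart of the reduction: the uniform public string is reparametrized as `ct ⊕ uk`. The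
  -- decryptor, which adds `ct` to it, then recovers exactly `uk`.
  rw [← sum_bitXor ct]
  refine Finset.sum_congr rfl fun uk _ => ?_
  change _ * pr (unmaskMap _ M _ y (reduced i (attach _ _))) = _
  rw [reduced_attach, unmaskMap_join, Sum.elim_comp_inr, bitXor_bitXor_cancel_left]

end

theorem SDE.pr_toSKUE_KG (S : SDE) (κ : ℕ) (uk : Bits (S.ctLen κ)) :
    pr (S.toSKUE.KG κ ![] 1 uk) = 1 / 2 ^ S.ctLen κ := by
  refine (pr_uniform_smul _ _).trans ?_
  rw [pr_one_fin_zero, mul_one]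

/-- The mask cancels for each `uk` separately, and averaging a constant over `uk` changes nothing.
-/
theorem SDE.decProb_toSKUE {S : SDE} (hS : S.IsScheme) (κ : ℕ) (x : Bits (S.msgLen κ)) :
    S.toSKUE.decProb κ x = S.decProb κ x := by
  have hdec : ∀ uk : Bits (S.ctLen κ), pr (S.toSKUE.Dec κ uk
      (S.toSKUE.Enc κ (Sum.elim uk x) 1 ![]) (decrypted x)) = S.decProb κ x := fun uk =>
    pr_unmask_maskedEnc (KG := S.KG κ) (Enc := S.Enc κ) (Dec := S.Dec κ)
      (IsQPTFamily.actsLinearly hS.dec_qpt κ 0) uk x (decrypted x)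
  unfold SKUE.decProb
  calc ∑ uk : Bits (S.ctLen κ), _ = ∑ _uk : Bits (S.ctLen κ), 1 / 2 ^ S.ctLen κ * S.decProb κ x :=
        Finset.sum_congr rfl fun uk _ => by rw [S.pr_toSKUE_KG, hdec]
    _ = S.decProb κ x := sum_uniform _ _

theorem SDE.IsScheme.toSKUE {S : SDE} (hS : S.IsScheme) : S.toSKUE.IsScheme where
  msgLen_poly := hS.msgLen_poly
  ukLen_poly := hS.ctLen_poly
  ctLen_poly := hS.ctLen_poly.add hS.dkLen_poly
  kg_qpt := isQPT_uniform hS.ctLen_poly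
  enc_qpt := isQPT_maskedEnc hS.ctLen_poly hS.msgLen_poly hS.ekLen_poly hS.dkLen_poly hS.kg_qpt
    hS.enc_qpt
  -- The mask is the entire classical input, so it starts at port `0`.
  dec_qpt := isQPTFamily_unmask (.const 1) hS.ctLen_poly hS.dkLen_poly (e := fun _ => id)
    (fun _ => Function.surjective_id) zero_le_one (fun _ _ => rfl) hS.dec_qpt
  correct := by
    obtain ⟨ε, hε, h⟩ := hS.correct
    exact ⟨ε, hε, fun κ x hx => (h κ x hx).trans_eq (S.decProb_toSKUE hS κ x).symm⟩

/-! ## The reduction -/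

/-- The adversary against `S` that plays against `A` the game for `S.toSKUE`: it hands out the masked
ciphertext `c = ct ⊕ uk` for a uniform `c` together with the registers, and recovers `uk = c ⊕ ct`
once `ct` is known. -/
noncomputable def SKUE.Adversary.toSDE {S : SDE} {n : ℕ → ℕ} (A : S.toSKUE.Adversary n) :
    S.Adversary n where
  regLen κ := S.ctLen κ + A.regLen κ
  descLen _ := 0
  stateLen κ := S.ctLen κ + A.regLen κ
  share κ := maskedShare (A.choose κ) (A.share κ)
  decryptor _ _ := fun _ ρ _ => ρ
  eval κ i := unmask Sum.inr (A.guess κ i)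

section

variable {S : SDE} {n : ℕ → ℕ} {A : S.toSKUE.Adversary n}

theorem SKUE.Adversary.IsAdmissible.toSDE (hS : S.IsScheme) (hn : PolyTimeLength n)
    (hA : A.IsAdmissible) : A.toSDE.IsAdmissible where
  regLen_poly := hS.ctLen_poly.add hA.regLen_poly
  descLen_poly := .zero
  stateLen_poly := hS.ctLen_poly.add hA.regLen_poly
  share_qpt := isQPT_maskedShare hS.ctLen_poly hS.dkLen_poly hS.msgLen_poly hA.stateLen_poly hn
    hA.regLen_poly hA.choose_qpt hA.share_qpt
  decryptor_qpt := isQPTFamily_id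
  -- Here the role of the mask is played by `ct`, which stands behind an empty description; this is
  -- the case `p₀ = 1`.
  eval_qpt := isQPTFamily_unmask hn.polyBounded hS.ctLen_poly hA.regLen_poly
    (e := fun _ => Sum.inr) (fun _ => by rintro (j | j); exacts [j.elim0, ⟨j, rfl⟩]) le_rfl
    (fun _ _ => rfl) hA.guess_qpt
  msg_mem := by
    intro κ ek m₀ m₁ h
    -- Messages of probability zero in the original game must also have probability zero here.
    -- Positivity upgrades the vanishing trace of the kept state to a vanishing state, and linearity
    -- of `Share` carries the zero to the output.
    refine hA.msg_mem κ m₀ m₁ fun h0 => h ?_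
    obtain ⟨C, hC⟩ := hA.choose_qpt.exists_implements κ
    have h1 := eq_zero_of_pr_eq_zero hC h0
    have h2 : A.toSDE.share κ ![] (S.KG κ ![] 1 ek) (Sum.elim m₀ m₁) = 0 :=
      maskedShare_eq_zero (Choose := A.choose κ) (Share := A.share κ)
        (IsQPTFamily.actsLinearly hA.share_qpt κ 0) h1 _
    rw [h2, pr, Matrix.trace_zero, Complex.zero_re]

/-- Both sides are sums over one product type, related by a single permutation of coordinates. -/
theorem sum_reorder {E M I B C U : Type*} [Fintype E] [Fintype M] [Fintype I] [Fintype B]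
    [Fintype C] [Fintype U] (F : E → M → M → I → B → C → U → ℝ) :
    ∑ ek, ∑ m₀, ∑ m₁, ∑ α, ∑ b, ∑ ct, ∑ uk, F ek m₀ m₁ α b ct uk =
      ∑ m₀, ∑ m₁, ∑ b, ∑ uk, ∑ α, ∑ ek, ∑ ct, F ek m₀ m₁ α b ct uk := by
  calc _ = ∑ x : E × M × M × I × B × C × U,
        F x.1 x.2.1 x.2.2.1 x.2.2.2.1 x.2.2.2.2.1 x.2.2.2.2.2.1 x.2.2.2.2.2.2 := by
        simp only [Fintype.sum_prod_type]
    _ = ∑ x : M × M × B × U × I × E × C,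
        F x.2.2.2.2.2.1 x.1 x.2.1 x.2.2.2.2.1 x.2.2.1 x.2.2.2.2.2.2 x.2.2.2.1 :=
        Fintype.sum_equiv
          { toFun := fun x => (x.2.1, x.2.2.1, x.2.2.2.2.1, x.2.2.2.2.2.2, x.2.2.2.1, x.1,
              x.2.2.2.2.2.1)
            invFun := fun x => (x.2.2.2.2.2.1, x.1, x.2.1, x.2.2.2.2.1, x.2.2.1, x.2.2.2.2.2.2,
              x.2.2.2.1) } _ _ fun _ => rfl
    _ = _ := by simp only [Fintype.sum_prod_type]

/-- Both probabilities expand into the same weights over the keys, the messages, the index, the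
coin, `ct` and `uk`. Only the order of summation differs. -/
theorem SKUE.Adversary.winProb_toSDE (hA : A.IsAdmissible) (κ : ℕ) :
    A.toSDE.winProb κ = A.winProb κ := by
  have hShare : ActsLinearly (A.share κ) := IsQPTFamily.actsLinearly hA.share_qpt κ 0
  have hGuess : ∀ α, ActsLinearly (A.guess κ α) := hA.guess_qpt.actsLinearly κ
  -- The unnormalized weight of the guess `coin` when the original adversary receives `ct ⊕ uk` and
  -- `dk` as ciphertext and `uk` as key.
  let W (ek : Bits (S.ekLen κ)) (m₀ m₁ : Bits (S.msgLen κ)) (α : Fin (n κ)) (coin : Bool)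
      (ct uk : Bits (S.ctLen κ)) : ℝ :=
    pr (A.guess κ α uk (reduced α (A.share κ ![] (tensor (A.choose κ ![] 1 (Sum.elim m₀ m₁))
      (join (tensor (basisState (bitXor ct uk)) (S.KG κ ![] 1 ek)))) ![])) fun _ => coin)
  have hsde : ∀ ek m₀ m₁ α coin (ct : Bits (S.ctLen κ)) (u : Bits 0),
      pr (A.toSDE.eval κ α (Sum.elim u ct) (A.toSDE.decryptor κ α ![]
        (reduced α (A.toSDE.share κ ![] (S.KG κ ![] 1 ek) (Sum.elim m₀ m₁))) u) fun _ => coin) =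
      ∑ uk, 1 / 2 ^ S.ctLen κ * W ek m₀ m₁ α coin ct uk := fun ek m₀ m₁ α coin ct u =>
    pr_unmask_maskedShare (Choose := A.choose κ) (Share := A.share κ) (hGuess α) α
      (S.KG κ ![] 1 ek) u ct (Sum.elim m₀ m₁) fun _ => coin
  have hue : ∀ m₀ m₁ α (coin : Bool) (uk : Bits (S.ctLen κ)),
      pr (A.guess κ α uk (reduced α (A.share κ ![]
        (tensor (A.choose κ ![] 1 (Sum.elim m₀ m₁))
          (S.toSKUE.Enc κ (Sum.elim uk (if coin then m₁ else m₀)) 1 ![])) ![])) fun _ => coin) =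
      ∑ ek, ∑ ct, pr (S.Enc κ (Sum.elim ek (if coin then m₁ else m₀)) 1 ct) *
        W ek m₀ m₁ α coin ct uk := fun m₀ m₁ α coin uk =>
    pr_reduced_maskedEnc (KG := S.KG κ) (Enc := S.Enc κ) hShare (hGuess α) α
      (A.choose κ ![] 1 (Sum.elim m₀ m₁)) uk (if coin then m₁ else m₀) fun _ => coin
  have h1 : A.toSDE.winProb κ = ∑ ek : Bits (S.ekLen κ), ∑ m₀ : Bits (S.msgLen κ),
      ∑ m₁ : Bits (S.msgLen κ), ∑ α : Fin (n κ), ∑ coin : Bool, ∑ ct : Bits (S.ctLen κ),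
      ∑ uk : Bits (S.ctLen κ), (1 / (n κ : ℝ)) * (1 / 2) *
        pr (S.Enc κ (Sum.elim ek (if coin then m₁ else m₀)) 1 ct) *
          (1 / 2 ^ S.ctLen κ * W ek m₀ m₁ α coin ct uk) := by
    unfold SDE.Adversary.winProb
    refine Finset.sum_congr rfl fun ek _ => Finset.sum_congr rfl fun m₀ _ =>
      Finset.sum_congr rfl fun m₁ _ => Finset.sum_congr rfl fun α _ =>
      Finset.sum_congr rfl fun coin _ => Finset.sum_congr rfl fun ct _ => ?_
    -- The description of the decryptor has no bits, so the sum over descriptions has one term.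
    refine (sum_fin_zero _).trans ?_
    rw [hsde, Finset.mul_sum]
  have h2 : A.winProb κ = ∑ m₀ : Bits (S.msgLen κ),
      ∑ m₁ : Bits (S.msgLen κ), ∑ coin : Bool, ∑ uk : Bits (S.ctLen κ), ∑ α : Fin (n κ),
      ∑ ek : Bits (S.ekLen κ), ∑ ct : Bits (S.ctLen κ), (1 / (n κ : ℝ)) * (1 / 2) *
        pr (S.Enc κ (Sum.elim ek (if coin then m₁ else m₀)) 1 ct) *
          (1 / 2 ^ S.ctLen κ * W ek m₀ m₁ α coin ct uk) := by
    unfold SKUE.Adversary.winProb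
    refine Finset.sum_congr rfl fun m₀ _ => Finset.sum_congr rfl fun m₁ _ =>
      Finset.sum_congr rfl fun coin _ => Finset.sum_congr rfl fun uk _ =>
      Finset.sum_congr rfl fun α _ => ?_
    refine (congrArg₂ (fun a b => 1 / (n κ : ℝ) * (1 / 2) * a * b) (S.pr_toSKUE_KG κ uk)
      (hue m₀ m₁ α coin uk)).trans ?_
    simp only [Finset.mul_sum]
    refine Finset.sum_congr rfl fun ek _ => Finset.sum_congr rfl fun ct _ => ?_
    ring
  rw [h1, h2]
  exact sum_reorder _

theorem SDE.IsAntiPiracySecure.toSKUE (hS : S.IsScheme) (hsec : S.IsAntiPiracySecure) :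
    S.toSKUE.IsUnclonableIndSecure := by
  intro n hn A hA
  obtain ⟨ε, hε, h⟩ := hsec n hn A.toSDE (hA.toSDE hS hn)
  exact ⟨ε, hε, fun κ => (SKUE.Adversary.winProb_toSDE hA κ).symm.trans_le (h κ)⟩

end

end OneOutOfMany

theorem mainTheorem4 (S : OneOutOfMany.SDE) (hS : S.IsScheme) (hsec : S.IsAntiPiracySecure) :
    S.toSKUE.IsScheme ∧ S.toSKUE.IsUnclonableIndSecure :=
  ⟨hS.toSKUE, hsec.toSKUE hS⟩
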